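/- Let $\mathscr F$ be a finite set of functions $F:\{0,1\}^{k}\to\mathbb C$ (with arity $k\ge 1$ depending on $F$) all of whose values are algebraic numbers. An instance $I$ of $\#\mathrm{CSP}(\mathscr F)$ consists of variables $v_1,\dots,v_n$ and a finite list (repetitions allowed) of constraints $F(v_{i_1},\dots,v_{i_k})$ with $F\in\mathscr F$; the required output is $$Z(I)=\sum_{v_1,\dots,v_n\in\{0,1\}}\ \prod_{\text{constraints of } I}F(v_{i_1},\dots,v_{i_k}).$$ Let $\delta_0,\delta_1$ be the unary functions with $\delta_0(0)=1,\ \delta_0(1)=0$ and $\delta_1(0)=0,\ \delta_1(1)=1$. For a positive integer $D$ and a real $\varepsilon>0$, say that $\#\mathrm{CSP}(\mathscr F)$ has an $O(2^{\varepsilon n})$ time algorithm at degree $\le D$ if some deterministic algorithm returns $Z(I)$ exactly, in at most $C\cdot 2^{\varepsilon n}$ steps for a constant $C$, for every instance $I$ in which every variable appears in at most $D$ constraints, where $n$ is the number of variables of $I$. Here time is counted in a step-counting model polynomially equivalent to multitape Turing machines, and $Z(I)$ is returned through its rational coordinates (integer numerators over one positive common denominator, all in binary) in a fixed $\mathbb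 Q$-basis of the number field generated by the values of the functions in $\mathscr F$. **Theorem.** If there exist a real $\varepsilon>0$ and an integer $D>0$ such that $\#\mathrm{CSP}(\mathscr F\cup\{\delta_0,\delta_1\})$ has no $O(2^{\varepsilon n})$ time algorithm at degree $\le D$, then there exist a real $\varepsilon'>0$ and an integer $D'>0$ such that $\#\mathrm{CSP}(\mathscr F)$ has no $O(2^{\varepsilon' N})$ time algorithm at degree $\le D'$, where $n$ and $N$ denote the numbers of variables of the respective instances. -/

import Mathlib

namespace PinCSP

/-! ### Boolean constraint functions and counting CSPs -/

/-- A complex-valued function of finitely many Boolean variables. -/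
structure BoolFn where
  arity : ℕ
  toFun : (Fin arity → Bool) → ℂ

/-- The unary function `[1, 0]`, which forces its variable to be `0`. -/
def delta0 : BoolFn := ⟨1, fun x => if x 0 = false then 1 else 0⟩

/-- The unary function `[0, 1]`, which forces its variable to be `1`. -/
def delta1 : BoolFn := ⟨1, fun x => if x 0 = true then 1 else 0⟩

/-- A constraint `f (v_{i_1}, …, v_{i_k})` with `f ∈ F` on the variables `v_0, …, v_{n-1}`;
a variable may occupy several arguments. -/
structure Cstr (F : Set BoolFn) (n : ℕ) where
  fn : BoolFn
  mem : fn ∈ F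
  vars : Fin fn.arity → Fin n

/-- An instance of `#CSP(F)`: a number of variables and finitely many constraints on them
(the same constraint may be imposed several times). -/
structure Inst (F : Set BoolFn) where
  numVars : ℕ
  cstrs : List (Cstr F numVars)

/-- The output `Z(I)`: the sum, over all Boolean assignments, of the product of the values of
the constraints. -/
noncomputable def Inst.value {F : Set BoolFn} (I : Inst F) : ℂ :=
  ∑ σ : Fin I.numVars → Bool, (I.cstrs.map fun c => c.fn.toFun fun j => σ (c.vars j)).prod

/-- Every variable appears in at most `D` constraints (counted with multiplicity). -/
def Inst.DegreeLE {F : Set BoolFn} (I : Inst F) (D : ℕ) : Prop :=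
  ∀ v : Fin I.numVars, I.cstrs.countP (fun c => decide (∃ j, c.vars j = v)) ≤ D

/-! ### The model of computation

Deterministic `while` programs over binary trees, with a step count. The basic operations only
follow or create pointers: a tree is held in memory as a pointer to a node, so that every step
touches a bounded number of pointers and creates at most one node. The model simulates, and is
simulated by, multitape Turing machines with polynomial overhead. -/

/-- The data of a program: binary trees. -/
inductive Data where
  | leaf : Data
  | node : Data → Data → Data

/-- Left subtree (a leaf has none, and is returned itself). -/
def Data.hd : Data → Data
  | .leaf => .leaf
  | .node a _ => a

/-- Right subtree (a leaf has none, and is returned itself). -/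
def Data.tl : Data → Data
  | .leaf => .leaf
  | .node _ b => b

/-- Programs. Each maps an input tree to an output tree, if it halts. -/
inductive Prog where
  /-- return the input -/
  | skip : Prog
  /-- return a leaf -/
  | leaf : Prog
  /-- return the left subtree of the input -/
  | hd : Prog
  /-- return the right subtree of the input -/
  | tl : Prog
  /-- run both programs on the input, and join the two results by a new node -/
  | pair : Prog → Prog → Prog
  /-- run the first program, then the second one on its result -/
  | seq : Prog → Prog → Prog
  /-- run the first program on the input as a test: if it returns a node, run the second program
  on the input, and if it returns a leaf, run the third one on the input -/
  | cond : Prog → Prog → Prog → Prog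
  /-- `while test x is a node do x := body x`; return `x` -/
  | loop : Prog → Prog → Prog

/-- `Run p x y t`: on input `x` the program `p` halts after exactly `t` steps with output `y`. -/
inductive Run : Prog → Data → Data → ℕ → Prop where
  | skip (x : Data) : Run .skip x x 1
  | leaf (x : Data) : Run .leaf x .leaf 1
  | hd (x : Data) : Run .hd x x.hd 1
  | tl (x : Data) : Run .tl x x.tl 1
  | pair {p q : Prog} {x y z : Data} {s t : ℕ} :
      Run p x y s → Run q x z t → Run (.pair p q) x (.node y z) (s + t + 1)
  | seq {p q : Prog} {x y z : Data} {s t : ℕ} :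
      Run p x y s → Run q y z t → Run (.seq p q) x z (s + t + 1)
  | cond_node {c p q : Prog} {x a b y : Data} {s t : ℕ} :
      Run c x (.node a b) s → Run p x y t → Run (.cond c p q) x y (s + t + 1)
  | cond_leaf {c p q : Prog} {x y : Data} {s t : ℕ} :
      Run c x .leaf s → Run q x y t → Run (.cond c p q) x y (s + t + 1)
  | loop_node {c p : Prog} {x a b y z : Data} {s t u : ℕ} :
      Run c x (.node a b) s → Run p x y t → Run (.loop c p) y z u →
        Run (.loop c p) x z (s + t + u + 1)
  | loop_leaf {c p : Prog} {x : Data} {s : ℕ} :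
      Run c x .leaf s → Run (.loop c p) x x (s + 1)

/-! ### Inputs and outputs as trees -/

/-- A list of trees as one tree. -/
def encList : List Data → Data
  | [] => .leaf
  | a :: l => .node a (encList l)

/-- A natural number in unary. Only names of functions, names of variables and the number of
variables are written so, which keeps the size of a bounded-degree input polynomial in the
number of variables. -/
def encUnary (n : ℕ) : Data := encList (List.replicate n .leaf)

/-- A bit. -/
def encBool : Bool → Data
  | false => .leaf
  | true => .node .leaf .leaf

/-- A natural number in binary, least significant bit first, without leading zeros. -/
def encNat (n : ℕ) : Data := encList (n.bits.map encBool)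

/-- An integer: a sign bit and the absolute value in binary. -/
def encInt (z : ℤ) : Data := .node (encBool (decide (z < 0))) (encNat z.natAbs)

/-- A constraint: the name of its function and the list of its variables. -/
def Cstr.enc {F : Set BoolFn} {n : ℕ} (name : BoolFn → ℕ) (c : Cstr F n) : Data :=
  .node (encUnary (name c.fn)) (encList (List.ofFn fun j => encUnary (c.vars j)))

/-- An instance: the number of variables and the list of the constraints. -/
def Inst.enc {F : Set BoolFn} (name : BoolFn → ℕ) (I : Inst F) : Data :=
  .node (encUnary I.numVars) (encList (I.cstrs.map (Cstr.enc name)))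

/-- The subfield of `ℂ` generated by all values of the functions in `F`. It contains all outputs
of `#CSP(F)`, and is a number field if `F` is finite and its functions have algebraic values. -/
noncomputable def valueField (F : Set BoolFn) : IntermediateField ℚ ℂ :=
  IntermediateField.adjoin ℚ {z | ∃ f ∈ F, ∃ x, z = f.toFun x}

/-- The finite family `ω` of complex numbers is a basis over `ℚ` of the value field of `F`. -/
def IsValueBasis (F : Set BoolFn) {r : ℕ} (ω : Fin r → ℂ) : Prop :=
  LinearIndependent ℚ ω ∧ ∀ z : ℂ, z ∈ Submodule.span ℚ (Set.range ω) ↔ z ∈ valueField F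

/-- The tree `y` represents the complex number `w` in the basis `ω`: it consists of a positive
denominator `q` and integers `z_i`, all in binary, with `w = (∑ i, z_i ω_i) / q`. -/
def Represents {r : ℕ} (ω : Fin r → ℂ) (y : Data) (w : ℂ) : Prop :=
  ∃ (q : ℕ) (z : Fin r → ℤ), 0 < q ∧
    y = .node (encNat q) (encList (List.ofFn fun i => encInt (z i))) ∧
    w = (∑ i, (z i : ℂ) * ω i) / (q : ℂ)

/-- There is an `O(2 ^ (ε n))` time algorithm for `#CSP(F)` restricted to the instances in which
every variable appears in at most `D` constraints, where `n` is the number of variables: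
for some naming of the functions of `F` and some basis of the value field, one program returns
the exact output of every such instance in at most `C * 2 ^ (ε n)` steps. For finite `F`, neither
the naming nor the basis matters, as a change of either is hard-wired into a program. -/
def HasAlgorithm (F : Set BoolFn) (D : ℕ) (ε : ℝ) : Prop :=
  ∃ (name : BoolFn → ℕ) (r : ℕ) (ω : Fin r → ℂ) (p : Prog) (C : ℝ),
    Set.InjOn name F ∧ IsValueBasis F ω ∧
    ∀ I : Inst F, I.DegreeLE D →
      ∃ (y : Data) (t : ℕ), Run p (I.enc name) y t ∧ Represents ω y I.value ∧
        (t : ℝ) ≤ C * (2 : ℝ) ^ (ε * (I.numVars : ℝ))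

end PinCSP

open PinCSP

namespace PinCSP

/-! The contrapositive is a reduction. Suppose that `F` has algorithms for every exponent and every
degree. In an instance with pins, cut the `n` variables into blocks of `d` consecutive ones, `d` a
large constant, and give each block an even and an odd vertex of one new path `0, …, 2m`, where `m =
n / d + 1`. If the path carries the assignment `0, 1, 0, 1, …`, then a variable pinned to `0` or `1`
may be replaced by the even or odd vertex of its block. A path vertex absorbs at most `d` variables,
so degrees stay bounded. Every replaced variable is left without constraints and contributes a
factor `2`.

The alternation is forced by a weight on the edges. If `f ∈ F` is not constant, identifying its
arguments to two variables gives binary functions `g` with `g(0,1) ≠ g(0,0)`, or with `g(0,1) ≠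
g(1,1)`. For `c` one of the unwanted values, `(g(x,y) - c) / (g(0,1) - c)` is `1` at `(0,1)` and `0`
where `g = c`. The product of these factors over the path leaves only the alternating assignment and
its complement. If all of `F` is invariant under complementation, both contribute equally; otherwise
a third factor kills the complement. If all functions are constant, nothing has to be forced
(`exists_isPinning`).

Each factor is a binomial, a multiple of a constraint plus a constant. Expanding the product gives
`2 ^ O(n / d)` terms, each a scalar times an instance of `#CSP(F)` with at most `3 n + 3` variables
and bounded degree (`terms_spec`, `rawOut_spec`).

The reduction runs in time polynomial, of degree `B` say, in the number of terms, the time of the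
given algorithm and the height of the input. The exponent of that algorithm and `d` must be chosen
after `B`, so `B` may not depend on them: `PolyTime` speaks of families of problems with one common
degree, and the family here is indexed by `Oracle`. With `δ = ε / (B + 1)`, `d ≥ 2 |S| / δ` (`S` the
list of factors) and exponent `δ / 3`, the resources are `O(2 ^ (δ n))`, and their `B`-th power is
`O(2 ^ (ε n))`. -/

/-! ### Heights of trees and bounded runs -/

/-- The height of a tree. -/
def Data.ht : Data → ℕ
  | .leaf => 0
  | .node a b => max a.ht b.ht + 1

@[simp] theorem Data.ht_leaf : Data.leaf.ht = 0 := rfl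
@[simp] theorem Data.ht_node (a b : Data) : (Data.node a b).ht = max a.ht b.ht + 1 := rfl

/-- The number of nodes may explode when subtrees are shared, but a `pair` puts only one node on top
of its two results. Hence a time bound also bounds the height of the output, and heights serve as
the measure of size throughout. -/
theorem Run.ht_le {p : Prog} {x y : Data} {t : ℕ} (h : Run p x y t) : y.ht ≤ x.ht + t := by
  induction h with
  | skip x => omega
  | leaf x => simp
  | hd x => cases x <;> simp [Data.hd]; omega
  | tl x => cases x <;> simp [Data.tl]; omega
  | pair _ _ ih1 ih2 => simp only [Data.ht_node]; omega
  | seq _ _ ih1 ih2 => omega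
  | cond_node _ _ ih1 ih2 => omega
  | cond_leaf _ _ ih1 ih2 => omega
  | loop_node _ _ _ ih1 ih2 ih3 => omega
  | loop_leaf _ _ => omega

/-- On input `x` the program `p` halts within `T` steps with output `y`. -/
def RunLE (p : Prog) (x y : Data) (T : ℕ) : Prop := ∃ t, t ≤ T ∧ Run p x y t

namespace RunLE

variable {p q c : Prog} {x y z a b : Data} {S T U : ℕ}

theorem mono (h : RunLE p x y S) (hST : S ≤ T) : RunLE p x y T := by
  obtain ⟨t, ht, hr⟩ := h
  exact ⟨t, ht.trans hST, hr⟩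

theorem ht_le (h : RunLE p x y T) : y.ht ≤ x.ht + T := by
  obtain ⟨t, ht, hr⟩ := h
  exact hr.ht_le.trans (by omega)

theorem skip (x : Data) : RunLE .skip x x 1 := ⟨1, le_rfl, .skip x⟩
theorem leaf (x : Data) : RunLE .leaf x .leaf 1 := ⟨1, le_rfl, .leaf x⟩
theorem hd (x : Data) : RunLE .hd x x.hd 1 := ⟨1, le_rfl, .hd x⟩
theorem tl (x : Data) : RunLE .tl x x.tl 1 := ⟨1, le_rfl, .tl x⟩

theorem pair (h₁ : RunLE p x y S) (h₂ : RunLE q x z T) :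
    RunLE (.pair p q) x (.node y z) (S + T + 1) := by
  obtain ⟨s, hs, hr⟩ := h₁
  obtain ⟨t, ht, hr'⟩ := h₂
  exact ⟨s + t + 1, by omega, .pair hr hr'⟩

theorem seq (h₁ : RunLE p x y S) (h₂ : RunLE q y z T) : RunLE (.seq p q) x z (S + T + 1) := by
  obtain ⟨s, hs, hr⟩ := h₁
  obtain ⟨t, ht, hr'⟩ := h₂
  exact ⟨s + t + 1, by omega, .seq hr hr'⟩

theorem cond_node (h₁ : RunLE c x (.node a b) S) (h₂ : RunLE p x y T) :
    RunLE (.cond c p q) x y (S + T + 1) := by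
  obtain ⟨s, hs, hr⟩ := h₁
  obtain ⟨t, ht, hr'⟩ := h₂
  exact ⟨s + t + 1, by omega, .cond_node hr hr'⟩

theorem cond_leaf (h₁ : RunLE c x .leaf S) (h₂ : RunLE q x y T) :
    RunLE (.cond c p q) x y (S + T + 1) := by
  obtain ⟨s, hs, hr⟩ := h₁
  obtain ⟨t, ht, hr'⟩ := h₂
  exact ⟨s + t + 1, by omega, .cond_leaf hr hr'⟩

theorem loop_node (h₁ : RunLE c x (.node a b) S) (h₂ : RunLE p x y T)
    (h₃ : RunLE (.loop c p) y z U) : RunLE (.loop c p) x z (S + T + U + 1) := by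
  obtain ⟨s, hs, hr⟩ := h₁
  obtain ⟨t, ht, hr'⟩ := h₂
  obtain ⟨u, hu, hr''⟩ := h₃
  exact ⟨s + t + u + 1, by omega, .loop_node hr hr' hr''⟩

theorem loop_leaf (h₁ : RunLE c x .leaf S) : RunLE (.loop c p) x x (S + 1) := by
  obtain ⟨s, hs, hr⟩ := h₁
  exact ⟨s + 1, by omega, .loop_leaf hr⟩

end RunLE

/-! ### Encodings -/

/-- Types whose elements are encoded as trees. -/
class Enc (α : Type) where
  enc : α → Data

open PinCSP.Enc (enc)

instance : Enc Unit := ⟨fun _ => .leaf⟩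
instance : Enc Bool := ⟨encBool⟩
instance : Enc ℕ := ⟨encNat⟩
instance : Enc ℤ := ⟨encInt⟩
instance {α β : Type} [Enc α] [Enc β] : Enc (α × β) := ⟨fun x => .node (enc x.1) (enc x.2)⟩
instance {α : Type} [Enc α] : Enc (List α) := ⟨fun l => encList (l.map enc)⟩
instance {α : Type} [Enc α] {r : ℕ} : Enc (Fin r → α) :=
  ⟨fun f => encList (List.ofFn fun i => enc (f i))⟩

section EncLemmas

variable {α β : Type} [Enc α] [Enc β]

@[simp] theorem enc_unit (a : Unit) : enc a = Data.leaf := rfl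
@[simp] theorem enc_pair (a : α) (b : β) : enc (a, b) = Data.node (enc a) (enc b) := rfl
theorem enc_prod (a : α × β) : enc a = Data.node (enc a.1) (enc a.2) := rfl
@[simp] theorem enc_nil : enc ([] : List α) = Data.leaf := rfl
@[simp] theorem enc_cons (a : α) (l : List α) : enc (a :: l) = Data.node (enc a) (enc l) := rfl
@[simp] theorem enc_true : enc true = Data.node .leaf .leaf := rfl
@[simp] theorem enc_false : enc false = Data.leaf := rfl

theorem ht_enc_bool (b : Bool) : (enc b).ht ≤ 1 := by cases b <;> simp

theorem length_le_ht (l : List α) : l.length ≤ (enc l).ht := by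
  induction l with
  | nil => simp
  | cons a l ih => simp only [enc_cons, Data.ht_node, List.length_cons]; omega

theorem ht_le_of_mem {a : α} {l : List α} (h : a ∈ l) : (enc a).ht ≤ (enc l).ht := by
  induction l with
  | nil => simp at h
  | cons b l ih =>
    simp only [enc_cons, Data.ht_node]
    rcases List.mem_cons.1 h with rfl | h
    · omega
    · have := ih h; omega

theorem ht_list_le {l : List α} {m : ℕ} (h : ∀ a ∈ l, (enc a).ht ≤ m) :
    (enc l).ht ≤ l.length + m := by
  induction l with
  | nil => simp
  | cons b l ih =>
    simp only [enc_cons, Data.ht_node, List.length_cons]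
    have h1 := h b (by simp)
    have h2 := ih fun a ha => h a (by simp [ha])
    omega

end EncLemmas

/-! ### Polynomial time, uniformly in a family of problems -/

/-- A family of promise problems on `α`, indexed by `ι`: the valid inputs, and a size which
measures the resources granted on an input in addition to its height. -/
structure Ctx (ι α : Type) where
  dom : ι → α → Prop
  size : ι → α → ℕ

/-- All inputs are valid, and no additional resources are granted. -/
def Ctx.triv (ι α : Type) : Ctx ι α := ⟨fun _ _ => True, fun _ _ => 0⟩

variable {ι α β γ σ : Type} [Enc α] [Enc β] [Enc γ] [Enc σ]

/-- The total size of an input. -/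
def Ctx.total (Γ : Ctx ι α) (i : ι) (x : α) : ℕ := Γ.size i x + (enc x).ht + 1

theorem Ctx.total_pos (Γ : Ctx ι α) (i : ι) (x : α) : 1 ≤ Γ.total i x := by
  simp [Ctx.total]

/-- A family of functions is bounded by polynomials in the total size, of a common degree. -/
def PolyBdd (Γ : Ctx ι α) (m : ι → α → ℕ) : Prop :=
  -- The degree `B` comes before the index and the coefficient `k` after it; the final choice of
  -- parameters rests on this order.
  ∃ B : ℕ, ∀ i, ∃ k : ℕ, ∀ x, Γ.dom i x → m i x ≤ k * Γ.total i x ^ B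

namespace PolyBdd

variable {Γ : Ctx ι α} {m m' : ι → α → ℕ}

theorem mono (h : PolyBdd Γ m) (hm : ∀ i x, Γ.dom i x → m' i x ≤ m i x) : PolyBdd Γ m' := by
  obtain ⟨B, hB⟩ := h
  refine ⟨B, fun i => ?_⟩
  obtain ⟨k, hk⟩ := hB i
  exact ⟨k, fun x hx => (hm i x hx).trans (hk x hx)⟩

theorem const (Γ : Ctx ι α) (k : ι → ℕ) : PolyBdd Γ fun i _ => k i :=
  ⟨0, fun i => ⟨k i, fun x _ => by simp⟩⟩

theorem total (Γ : Ctx ι α) : PolyBdd Γ Γ.total :=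
  ⟨1, fun i => ⟨1, fun x _ => by simp⟩⟩

theorem size (Γ : Ctx ι α) : PolyBdd Γ Γ.size :=
  (total Γ).mono fun i x _ => by simp only [Ctx.total]; omega

theorem ht (Γ : Ctx ι α) : PolyBdd Γ fun _ x => (enc x).ht :=
  (total Γ).mono fun i x _ => by simp only [Ctx.total]; omega

theorem add (h : PolyBdd Γ m) (h' : PolyBdd Γ m') : PolyBdd Γ fun i x => m i x + m' i x := by
  obtain ⟨B, hB⟩ := h
  obtain ⟨B', hB'⟩ := h'
  refine ⟨B + B', fun i => ?_⟩
  obtain ⟨k, hk⟩ := hB i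
  obtain ⟨k', hk'⟩ := hB' i
  refine ⟨k + k', fun x hx => ?_⟩
  have h0 := Γ.total_pos i x
  have h1 : Γ.total i x ^ B ≤ Γ.total i x ^ (B + B') := Nat.pow_le_pow_right h0 (by omega)
  have h2 : Γ.total i x ^ B' ≤ Γ.total i x ^ (B + B') := Nat.pow_le_pow_right h0 (by omega)
  calc m i x + m' i x ≤ k * Γ.total i x ^ B + k' * Γ.total i x ^ B' :=
        add_le_add (hk x hx) (hk' x hx)
    _ ≤ k * Γ.total i x ^ (B + B') + k' * Γ.total i x ^ (B + B') := by gcongr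
    _ = _ := by ring

theorem mul (h : PolyBdd Γ m) (h' : PolyBdd Γ m') : PolyBdd Γ fun i x => m i x * m' i x := by
  obtain ⟨B, hB⟩ := h
  obtain ⟨B', hB'⟩ := h'
  refine ⟨B + B', fun i => ?_⟩
  obtain ⟨k, hk⟩ := hB i
  obtain ⟨k', hk'⟩ := hB' i
  refine ⟨k * k', fun x hx => ?_⟩
  calc m i x * m' i x ≤ (k * Γ.total i x ^ B) * (k' * Γ.total i x ^ B') :=
        Nat.mul_le_mul (hk x hx) (hk' x hx)
    _ = _ := by ring

theorem pow (h : PolyBdd Γ m) (n : ℕ) : PolyBdd Γ fun i x => m i x ^ n := by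
  induction n with
  | zero => exact (const Γ fun _ => 1).mono fun i x _ => by simp
  | succ n ih => exact (ih.mul h).mono fun i x _ => by rw [pow_succ]

theorem comp {Δ : Ctx ι β} {m : ι → β → ℕ} {f : ι → α → β} (h : PolyBdd Δ m)
    (hdom : ∀ i x, Γ.dom i x → Δ.dom i (f i x))
    (hsize : PolyBdd Γ fun i x => Δ.size i (f i x))
    (hht : PolyBdd Γ fun i x => (enc (f i x)).ht) : PolyBdd Γ fun i x => m i (f i x) := by
  obtain ⟨B, hB⟩ := h
  choose k hk using hB
  exact ((const Γ k).mul (((hsize.add hht).add (const Γ fun _ => 1)).pow B)).mono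
    fun i x hx => hk i _ (hdom i x hx)

end PolyBdd

/-- The functions `f i` are computed by programs in polynomial time, the degree of the
polynomial not depending on `i`. -/
def PolyTime (Γ : Ctx ι α) (f : ι → α → β) : Prop :=
  ∃ (p : ι → Prog) (m : ι → α → ℕ), PolyBdd Γ m ∧
    ∀ i x, Γ.dom i x → RunLE (p i) (enc x) (enc (f i x)) (m i x)

/-- A program that outputs a given tree. -/
def constProg : Data → Prog
  | .leaf => .leaf
  | .node a b => .pair (constProg a) (constProg b)

theorem exists_run_constProg (d : Data) : ∃ T, ∀ x, RunLE (constProg d) x d T := by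
  induction d with
  | leaf => exact ⟨1, RunLE.leaf⟩
  | node a b iha ihb =>
    obtain ⟨S, hS⟩ := iha
    obtain ⟨T, hT⟩ := ihb
    exact ⟨S + T + 1, fun x => (hS x).pair (hT x)⟩

namespace PolyTime

variable {Γ : Ctx ι α}

theorem of_prog {f : ι → α → β} (p : Prog) (T : ℕ)
    (h : ∀ i x, Γ.dom i x → RunLE p (enc x) (enc (f i x)) T) : PolyTime Γ f :=
  ⟨fun _ => p, fun _ _ => T, PolyBdd.const Γ _, h⟩

theorem congr_enc {f : ι → α → β} {g : ι → α → γ} (hf : PolyTime Γ f)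
    (h : ∀ i x, Γ.dom i x → enc (f i x) = enc (g i x)) : PolyTime Γ g := by
  obtain ⟨p, m, hm, hp⟩ := hf
  exact ⟨p, m, hm, fun i x hx => h i x hx ▸ hp i x hx⟩

theorem congr {f g : ι → α → β} (hf : PolyTime Γ f)
    (h : ∀ i x, Γ.dom i x → f i x = g i x) : PolyTime Γ g :=
  hf.congr_enc fun i x hx => by rw [h i x hx]

theorem ht {f : ι → α → β} (hf : PolyTime Γ f) : PolyBdd Γ fun i x => (enc (f i x)).ht := by
  obtain ⟨p, m, hm, hp⟩ := hf
  exact ((PolyBdd.ht Γ).add hm).mono fun i x hx => (hp i x hx).ht_le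

theorem id (Γ : Ctx ι α) : PolyTime Γ fun _ x => x :=
  of_prog .skip 1 fun _ x _ => RunLE.skip (enc x)

/-- Data that depend on the index only are hard-wired into the program. They affect the coefficient
of the time bound but not its degree. -/
theorem const (Γ : Ctx ι α) (b : ι → β) : PolyTime Γ fun i _ => b i := by
  choose T hT using exists_run_constProg
  exact ⟨fun i => constProg (enc (b i)), fun i _ => T (enc (b i)),
    PolyBdd.const Γ fun i => T (enc (b i)), fun i x _ => hT _ _⟩

/-- The resources that `g` needs are charged to the outer context. Calls to an oracle are composed
in this way, its running time being its size. -/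
theorem comp_ctx {Δ : Ctx ι β} {f : ι → α → β} {g : ι → β → γ} (hg : PolyTime Δ g)
    (hf : PolyTime Γ f) (hdom : ∀ i x, Γ.dom i x → Δ.dom i (f i x))
    (hsize : PolyBdd Γ fun i x => Δ.size i (f i x)) : PolyTime Γ fun i x => g i (f i x) := by
  have hht := hf.ht
  obtain ⟨p, m, hm, hp⟩ := hf
  obtain ⟨q, m', hm', hq⟩ := hg
  exact ⟨fun i => .seq (p i) (q i), fun i x => m i x + m' i (f i x) + 1,
    (hm.add (hm'.comp hdom hsize hht)).add (PolyBdd.const Γ fun _ => 1),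
    fun i x hx => (hp i x hx).seq (hq i _ (hdom i x hx))⟩

theorem comp {f : ι → α → β} {g : ι → β → γ} (hg : PolyTime (Ctx.triv ι β) g)
    (hf : PolyTime Γ f) : PolyTime Γ fun i x => g i (f i x) :=
  comp_ctx hg hf (fun _ _ _ => trivial) (PolyBdd.const Γ fun _ => 0)

theorem of_triv {f : ι → α → β} (hf : PolyTime (Ctx.triv ι α) f) : PolyTime Γ f :=
  hf.comp (id Γ)

theorem pair {f : ι → α → β} {g : ι → α → γ} (hf : PolyTime Γ f) (hg : PolyTime Γ g) :
    PolyTime Γ fun i x => (f i x, g i x) := by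
  obtain ⟨p, m, hm, hp⟩ := hf
  obtain ⟨q, m', hm', hq⟩ := hg
  exact ⟨fun i => .pair (p i) (q i), fun i x => m i x + m' i x + 1,
    (hm.add hm').add (PolyBdd.const Γ fun _ => 1), fun i x hx => (hp i x hx).pair (hq i x hx)⟩

theorem comp₂ {f : ι → α → β} {g : ι → α → γ} {h : ι → β → γ → σ}
    (hh : PolyTime (Ctx.triv ι (β × γ)) fun i x => h i x.1 x.2)
    (hf : PolyTime Γ f) (hg : PolyTime Γ g) : PolyTime Γ fun i x => h i (f i x) (g i x) :=
  hh.comp (hf.pair hg)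

theorem fst {f : ι → α → β × γ} (hf : PolyTime Γ f) : PolyTime Γ fun i x => (f i x).1 :=
  comp (g := fun _ (y : β × γ) => y.1) (of_prog .hd 1 fun _ x _ => RunLE.hd (enc x)) hf

theorem snd {f : ι → α → β × γ} (hf : PolyTime Γ f) : PolyTime Γ fun i x => (f i x).2 :=
  comp (g := fun _ (y : β × γ) => y.2) (of_prog .tl 1 fun _ x _ => RunLE.tl (enc x)) hf

theorem ite {c : ι → α → Bool} {f g : ι → α → β} (hc : PolyTime Γ c) (hf : PolyTime Γ f)
    (hg : PolyTime Γ g) : PolyTime Γ fun i x => if c i x then f i x else g i x := by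
  obtain ⟨pc, mc, hmc, hpc⟩ := hc
  obtain ⟨p, m, hm, hp⟩ := hf
  obtain ⟨q, m', hm', hq⟩ := hg
  refine ⟨fun i => .cond (pc i) (p i) (q i), fun i x => mc i x + (m i x + m' i x) + 1,
    (hmc.add (hm.add hm')).add (PolyBdd.const Γ fun _ => 1), fun i x hx => ?_⟩
  have h1 := hpc i x hx
  cases h : c i x
  · rw [h] at h1
    dsimp only
    rw [h]
    exact (h1.cond_leaf (p := p i) (hq i x hx)).mono
      (show mc i x + m' i x + 1 ≤ mc i x + (m i x + m' i x) + 1 by omega)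
  · rw [h] at h1
    dsimp only
    rw [h]
    exact (h1.cond_node (q := q i) (hp i x hx)).mono
      (show mc i x + m i x + 1 ≤ mc i x + (m i x + m' i x) + 1 by omega)

theorem cons {f : ι → α → β} {g : ι → α → List β} (hf : PolyTime Γ f) (hg : PolyTime Γ g) :
    PolyTime Γ fun i x => f i x :: g i x :=
  (hf.pair hg).congr_enc fun _ _ _ => rfl

theorem tail {f : ι → α → List β} (hf : PolyTime Γ f) : PolyTime Γ fun i x => (f i x).tail :=
  comp (g := fun _ (y : List β) => y.tail)
    (of_prog .tl 1 fun _ x _ => by cases x <;> exact RunLE.tl _) hf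

theorem isEmpty {f : ι → α → List β} (hf : PolyTime Γ f) :
    PolyTime Γ fun i x => (f i x).isEmpty :=
  comp (g := fun _ (y : List β) => y.isEmpty)
    (of_prog (.cond .skip .leaf (.pair .leaf .leaf)) 5 fun _ x _ => by
      cases x
      · exact ((RunLE.skip _).cond_leaf ((RunLE.leaf _).pair (RunLE.leaf _))).mono (by omega)
      · exact ((RunLE.skip _).cond_node (RunLE.leaf _)).mono (by omega)) hf

theorem not {f : ι → α → Bool} (hf : PolyTime Γ f) : PolyTime Γ fun i x => !(f i x) :=
  (hf.ite (const Γ fun _ => false) (const Γ fun _ => true)).congr fun i x _ => by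
    cases f i x <;> rfl

theorem and {f g : ι → α → Bool} (hf : PolyTime Γ f) (hg : PolyTime Γ g) :
    PolyTime Γ fun i x => f i x && g i x :=
  (hf.ite hg (const Γ fun _ => false)).congr fun i x _ => by cases f i x <;> rfl

theorem or {f g : ι → α → Bool} (hf : PolyTime Γ f) (hg : PolyTime Γ g) :
    PolyTime Γ fun i x => f i x || g i x :=
  (hf.ite (const Γ fun _ => true) hg).congr fun i x _ => by cases f i x <;> rfl

theorem xor {f g : ι → α → Bool} (hf : PolyTime Γ f) (hg : PolyTime Γ g) :
    PolyTime Γ fun i x => Bool.xor (f i x) (g i x) :=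
  (hf.ite hg.not hg).congr fun i x _ => by cases f i x <;> simp

end PolyTime

/-! ### Folding over a list -/

/-- The context of the step of a fold over the list `l`. -/
def Ctx.fold (Γ : Ctx ι α) (l : ι → α → List β) (σ : Type) : Ctx ι (α × σ × β) :=
  ⟨fun i y => Γ.dom i y.1 ∧ y.2.2 ∈ l i y.1, fun i y => Γ.size i y.1⟩

/-- The context of a function applied to the elements of the list `l`. -/
def Ctx.elem (Γ : Ctx ι α) (l : ι → α → List β) : Ctx ι (α × β) :=
  ⟨fun i y => Γ.dom i y.1 ∧ y.2 ∈ l i y.1, fun i y => Γ.size i y.1⟩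

/-- The loop that folds over a list with step `p`: a state consists of the remaining list, the
input and the accumulator. -/
def foldLoop (p : Prog) : Prog :=
  .loop .hd (.pair (.seq .hd .tl) (.pair (.seq .tl .hd)
    (.seq (.pair (.seq .tl .hd) (.pair (.seq .tl .tl) (.seq .hd .hd))) p)))

/-- The bound `T` is required only at accumulators that occur after some prefix, since a step may be
slow elsewhere. The constant `25` covers unpacking and repacking the state. -/
theorem run_foldLoop {p : Prog} {x : α} {h : σ → β → σ} {T : ℕ} (l : List β) (s : σ)
    (hT : ∀ pre b suf, l = pre ++ b :: suf →
      RunLE p (enc (x, pre.foldl h s, b)) (enc ((pre ++ [b]).foldl h s)) T) :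
    RunLE (foldLoop p) (.node (enc l) (.node (enc x) (enc s)))
      (.node .leaf (.node (enc x) (enc (l.foldl h s)))) (l.length * (T + 25) + 2) := by
  induction l generalizing s with
  | nil => exact (RunLE.loop_leaf (RunLE.hd _)).mono (by simp)
  | cons b l ih =>
    have h1 := hT [] b l rfl
    simp only [List.nil_append, List.foldl_nil, List.foldl_cons] at h1
    have h2 := ih (h s b) fun pre c suf e => by
      have := hT (b :: pre) c suf (by simp [e])
      simpa using this
    have hin : RunLE (.pair (.seq .tl .hd) (.pair (.seq .tl .tl) (.seq .hd .hd)))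
        (.node (enc (b :: l)) (.node (enc x) (enc s))) (enc (x, s, b)) 11 := by
      refine (RunLE.pair (y := enc x) ?_ (RunLE.pair (y := enc s) (z := enc b) ?_ ?_)).mono
        (show 3 + (3 + 3 + 1) + 1 ≤ 11 by omega)
      · exact (RunLE.tl _).seq (RunLE.hd _)
      · exact (RunLE.tl _).seq (RunLE.tl _)
      · exact (RunLE.hd _).seq (RunLE.hd _)
    have hbody := RunLE.pair (p := .seq .hd .tl) (x := .node (enc (b :: l)) (.node (enc x) (enc s)))
      (y := enc l) ((RunLE.hd _).seq (RunLE.tl _))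
      (RunLE.pair (p := .seq .tl .hd) (y := enc x) ((RunLE.tl _).seq (RunLE.hd _)) (hin.seq h1))
    refine (RunLE.loop_node (a := enc b) (b := enc l) (RunLE.hd _) hbody h2).mono ?_
    simp only [List.length_cons]
    ring_nf
    omega

namespace PolyTime

variable {Γ : Ctx ι α}

/-- Iterating a polynomial-time step may produce huge accumulators, so a bound on the heights of all
intermediate ones has to be supplied. -/
theorem foldl {l : ι → α → List β} {g : ι → α → σ} {h : ι → α × σ × β → σ}
    (hl : PolyTime Γ l) (hg : PolyTime Γ g) (hh : PolyTime (Γ.fold l σ) h)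
    {B : ι → α → ℕ} (hB : PolyBdd Γ B)
    (hbd : ∀ i x, Γ.dom i x → ∀ pre suf, l i x = pre ++ suf →
      (enc (pre.foldl (fun s b => h i (x, s, b)) (g i x))).ht ≤ B i x) :
    PolyTime Γ fun i x => (l i x).foldl (fun s b => h i (x, s, b)) (g i x) := by
  have hlht := hl.ht
  obtain ⟨pl, ml, hml, hpl⟩ := hl
  obtain ⟨pg, mg, hmg, hpg⟩ := hg
  obtain ⟨ph, mh, ⟨C, hC⟩, hph⟩ := hh
  choose k hk using hC
  -- The time bound of one step, evaluated at the largest total size that a state can have.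
  let T : ι → α → ℕ := fun i x =>
    k i * (Γ.size i x + ((enc x).ht + B i x + (enc (l i x)).ht + 2) + 1) ^ C
  have hT : PolyBdd Γ T := (PolyBdd.const Γ k).mul ((((PolyBdd.size Γ).add
    ((((PolyBdd.ht Γ).add hB).add hlht).add (PolyBdd.const Γ fun _ => 2))).add
    (PolyBdd.const Γ fun _ => 1)).pow C)
  refine ⟨fun i => .seq (.seq (.pair (pl i) (.pair .skip (pg i))) (foldLoop (ph i)))
      (.seq .tl .tl),
    fun i x => (ml i x + (1 + mg i x + 1) + 1) + ((enc (l i x)).ht * (T i x + 25) + 2) + 1 + 3 + 1,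
    ?_, fun i x hx => ?_⟩
  · exact (((((hml.add (((PolyBdd.const Γ fun _ => 1).add hmg).add
      (PolyBdd.const Γ fun _ => 1))).add (PolyBdd.const Γ fun _ => 1)).add
      ((hlht.mul (hT.add (PolyBdd.const Γ fun _ => 25))).add (PolyBdd.const Γ fun _ => 2))).add
      (PolyBdd.const Γ fun _ => 1)).add (PolyBdd.const Γ fun _ => 3)).add
      (PolyBdd.const Γ fun _ => 1)
  · have hloop := run_foldLoop (p := ph i) (x := x) (h := fun s b => h i (x, s, b)) (T := T i x)
      (l i x) (g i x) fun pre b suf e => by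
        have hmem : b ∈ l i x := by simp [e]
        have hd : (Γ.fold l σ).dom i (x, pre.foldl (fun s b => h i (x, s, b)) (g i x), b) :=
          ⟨hx, hmem⟩
        have h1 := hph i _ hd
        rw [List.foldl_append, List.foldl_cons, List.foldl_nil]
        refine h1.mono ((hk i _ hd).trans ?_)
        have h2 := hbd i x hx pre (b :: suf) e
        have h3 := ht_le_of_mem hmem
        simp only [T, Ctx.total, Ctx.fold, enc_pair, Data.ht_node]
        refine Nat.mul_le_mul_left _ (Nat.pow_le_pow_left ?_ _)
        omega
    have hlen := length_le_ht (l i x)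
    refine ((((hpl i x hx).pair ((RunLE.skip _).pair (hpg i x hx))).seq
      (hloop.mono (?_ : _ ≤ (enc (l i x)).ht * (T i x + 25) + 2))).seq
      ((RunLE.tl _).seq (RunLE.tl _))).mono le_rfl
    gcongr

/-- A fold whose steps increase the height by a bounded amount. -/
theorem foldl_add {l : ι → α → List β} {g : ι → α → σ} {h : ι → α × σ × β → σ}
    (hl : PolyTime Γ l) (hg : PolyTime Γ g) (hh : PolyTime (Γ.fold l σ) h)
    {B : ι → α → ℕ} (hB : PolyBdd Γ B)
    (hbd : ∀ i x s b, Γ.dom i x → b ∈ l i x → (enc (h i (x, s, b))).ht ≤ (enc s).ht + B i x) :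
    PolyTime Γ fun i x => (l i x).foldl (fun s b => h i (x, s, b)) (g i x) := by
  refine foldl hl hg hh (B := fun i x => (enc (g i x)).ht + (enc (l i x)).ht * B i x)
    (hg.ht.add (hl.ht.mul hB)) fun i x hx pre suf e => ?_
  have key : ∀ (pre : List β) (s : σ), (∀ b ∈ pre, b ∈ l i x) →
      (enc (pre.foldl (fun s b => h i (x, s, b)) s)).ht ≤ (enc s).ht + pre.length * B i x := by
    intro pre
    induction pre with
    | nil => simp
    | cons b pre ih =>
      intro s hs
      have h1 := ih (h i (x, s, b)) fun c hc => hs c (by simp [hc])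
      have h2 := hbd i x s b hx (hs b (by simp))
      simp only [List.foldl_cons, List.length_cons, add_mul, one_mul]
      omega
  have h1 := key pre (g i x) fun b hb => by simp [e, hb]
  have h2 : pre.length ≤ (enc (l i x)).ht :=
    le_trans (by simp [e]) (length_le_ht (l i x))
  have h3 := Nat.mul_le_mul_right (B i x) h2
  omega

theorem reverse {f : ι → α → List β} (hf : PolyTime Γ f) :
    PolyTime Γ fun i x => (f i x).reverse := by
  refine comp (g := fun _ (y : List β) => y.reverse) ?_ hf
  refine (foldl_add (g := fun _ _ => ([] : List β))
    (h := fun _ y => y.2.2 :: y.2.1) (id _) (const _ fun _ => [])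
    ((id _).snd.snd.cons (id _).snd.fst)
    (B := fun _ x => (enc x).ht + 1) ((PolyBdd.ht _).add (PolyBdd.const _ fun _ => 1))
    fun i x s b _ hb => ?_).congr fun i x _ => ?_
  · have := ht_le_of_mem hb
    simp only [enc_cons, Data.ht_node]
    omega
  · have h (y : List β) (acc : List β) :
        y.foldl (fun s b => b :: s) acc = y.reverse ++ acc := by
      induction y generalizing acc with
      | nil => rfl
      | cons a y ih => simp [ih]
    simp [h]

theorem append {f g : ι → α → List β} (hf : PolyTime Γ f) (hg : PolyTime Γ g) :
    PolyTime Γ fun i x => f i x ++ g i x := by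
  refine (foldl_add (h := fun _ y => y.2.2 :: y.2.1) hf.reverse hg
    ((id _).snd.snd.cons (id _).snd.fst)
    (B := fun i x => (enc (f i x)).ht + 1) (hf.ht.add (PolyBdd.const _ fun _ => 1))
    fun i x s b _ hb => ?_).congr fun i x _ => ?_
  · have := ht_le_of_mem (List.mem_reverse.1 hb)
    simp only [enc_cons, Data.ht_node]
    omega
  · simp

theorem map {l : ι → α → List β} {f : ι → α × β → γ} (hl : PolyTime Γ l)
    (hf : PolyTime (Γ.elem l) f) : PolyTime Γ fun i x => (l i x).map fun b => f i (x, b) := by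
  have hlht := hl.ht
  obtain ⟨C, hC⟩ := hf.ht
  choose k hk using hC
  -- The fold collects the images in reverse order.
  have key : PolyTime Γ fun i x =>
      (l i x).foldl (fun (s : List γ) b => f i (x, b) :: s) [] := by
    refine foldl_add (h := fun i (y : α × List γ × β) => f i (y.1, y.2.2) :: y.2.1) hl
      (const _ fun _ => [])
      (cons (f := fun i (y : α × List γ × β) => f i (y.1, y.2.2))
        (comp_ctx (f := fun i (y : α × List γ × β) => (y.1, y.2.2)) hf
          ((id _).fst.pair (id _).snd.snd) (fun i y hy => hy) (PolyBdd.size _)) (id _).snd.fst)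
      (B := fun i x => k i * (Γ.size i x + ((enc x).ht + (enc (l i x)).ht + 1) + 1) ^ C + 1)
      ?_ fun i x s b hx hb => ?_
    · exact ((PolyBdd.const Γ k).mul ((((PolyBdd.size Γ).add (((PolyBdd.ht Γ).add hlht).add
        (PolyBdd.const Γ fun _ => 1))).add (PolyBdd.const Γ fun _ => 1)).pow C)).add
        (PolyBdd.const Γ fun _ => 1)
    · have h1 := hk i (x, b) ⟨hx, hb⟩
      have h2 := ht_le_of_mem hb
      have h3 : (Γ.elem l).total i (x, b) ≤
          Γ.size i x + ((enc x).ht + (enc (l i x)).ht + 1) + 1 := by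
        simp only [Ctx.total, Ctx.elem, enc_pair, Data.ht_node]
        omega
      have h4 := Nat.mul_le_mul_left (k i) (Nat.pow_le_pow_left h3 C)
      simp only [enc_cons, Data.ht_node] at h1 ⊢
      omega
  refine key.reverse.congr fun i x _ => ?_
  have h (y : List β) (acc : List γ) :
      y.foldl (fun (s : List γ) b => f i (x, b) :: s) acc
        = (y.map fun b => f i (x, b)).reverse ++ acc := by
    induction y generalizing acc with
    | nil => rfl
    | cons a y ih => simp [ih]
  simp [h]

theorem filter {l : ι → α → List β} {f : ι → α × β → Bool} (hl : PolyTime Γ l)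
    (hf : PolyTime (Γ.elem l) f) :
    PolyTime Γ fun i x => (l i x).filter fun b => f i (x, b) := by
  have key : PolyTime Γ fun i x =>
      (l i x).foldl (fun (s : List β) b => if f i (x, b) then b :: s else s) [] := by
    refine foldl_add
      (h := fun i (y : α × List β × β) => if f i (y.1, y.2.2) then y.2.2 :: y.2.1 else y.2.1) hl
      (const _ fun _ => [])
      (ite (c := fun i (y : α × List β × β) => f i (y.1, y.2.2))
        (comp_ctx (f := fun i (y : α × List β × β) => (y.1, y.2.2)) hf
          ((id _).fst.pair (id _).snd.snd) (fun i y hy => hy) (PolyBdd.size _))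
        ((id _).snd.snd.cons (id _).snd.fst) (id _).snd.fst)
      (B := fun i x => (enc (l i x)).ht + 1) (hl.ht.add (PolyBdd.const Γ fun _ => 1))
      fun i x s b hx hb => ?_
    have h2 := ht_le_of_mem hb
    dsimp only
    split_ifs
    · simp only [enc_cons, Data.ht_node]
      omega
    · omega
  refine key.reverse.congr fun i x _ => ?_
  have h (y : List β) (acc : List β) :
      y.foldl (fun (s : List β) b => if f i (x, b) then b :: s else s) acc
        = (y.filter fun b => f i (x, b)).reverse ++ acc := by
    induction y generalizing acc with
    | nil => rfl
    | cons a y ih => cases hb : f i (x, a) <;> simp [ih, hb]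
  simp [h]

theorem any {l : ι → α → List β} {f : ι → α × β → Bool} (hl : PolyTime Γ l)
    (hf : PolyTime (Γ.elem l) f) :
    PolyTime Γ fun i x => (l i x).any fun b => f i (x, b) :=
  (hl.filter hf).isEmpty.not.congr fun i x _ => by
    rw [Bool.eq_iff_iff]
    simp

end PolyTime

/-! ### Vectors -/

theorem ht_le_of_apply {r : ℕ} (f : Fin r → β) (j : Fin r) : (enc (f j)).ht ≤ (enc f).ht := by
  have h : enc f = enc (List.ofFn f) := by
    change encList _ = encList _
    rw [List.map_ofFn]
    rfl
  rw [h]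
  exact ht_le_of_mem (by simp [List.mem_ofFn])

theorem ht_fun_le {r : ℕ} {f : Fin r → β} {m : ℕ} (h : ∀ j, (enc (f j)).ht ≤ m) :
    (enc f).ht ≤ r + m := by
  have he : enc f = enc (List.ofFn f) := by
    change encList _ = encList _
    rw [List.map_ofFn]
    rfl
  rw [he]
  refine (ht_list_le (m := m) fun a ha => ?_).trans (by simp)
  obtain ⟨j, rfl⟩ := (List.mem_ofFn' _ _).1 ha
  exact h j

theorem enc_fun_succ {r : ℕ} (f : Fin (r + 1) → β) :
    enc f = Data.node (enc (f 0)) (enc fun j : Fin r => f j.succ) := by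
  change encList _ = _
  rw [List.ofFn_succ]
  rfl

namespace PolyTime

variable {Γ : Ctx ι α}

theorem tuple {r : ℕ} {f : ι → α → Fin r → β} (h : ∀ j, PolyTime Γ fun i x => f i x j) :
    PolyTime Γ f := by
  induction r with
  | zero => exact (const Γ fun _ => ()).congr_enc fun i x _ =>
      (congrArg encList (List.ofFn_zero (f := fun j => enc (f i x j)))).symm
  | succ r ih =>
    exact ((h 0).pair (ih (f := fun i x j => f i x j.succ) fun j => h j.succ)).congr_enc
      fun i x _ => (enc_fun_succ (f i x)).symm

theorem apply {r : ℕ} {f : ι → α → Fin r → β} (hf : PolyTime Γ f) (j : Fin r) :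
    PolyTime Γ fun i x => f i x j := by
  induction r with
  | zero => exact j.elim0
  | succ r ih =>
    refine Fin.cases ?_ (fun j => ?_) j
    · refine comp (g := fun _ (y : Fin (r + 1) → β) => y 0) (of_prog .hd 1 fun _ y _ => ?_) hf
      rw [enc_fun_succ]
      exact RunLE.hd _
    · refine ih (f := fun i x j => f i x j.succ)
        (comp (g := fun _ (y : Fin (r + 1) → β) (j : Fin r) => y j.succ)
          (of_prog .tl 1 fun _ y _ => ?_) hf) j
      rw [enc_fun_succ]
      exact RunLE.tl _

end PolyTime

/-! ### Natural numbers in unary -/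

/-- A natural number, to be encoded in unary. -/
@[ext] structure Un where
  val : ℕ

instance : Enc Un := ⟨fun n => encUnary n.val⟩

theorem enc_un (n : Un) : enc n = enc (List.replicate n.val ()) := by
  change encUnary _ = encList _
  rw [List.map_replicate]
  rfl

@[simp] theorem ht_un (n : Un) : (enc n).ht = n.val := by
  rw [enc_un]
  induction n.val with
  | zero => rfl
  | succ k ih => simp [List.replicate_succ, ih]


namespace PolyTime

variable {Γ : Ctx ι α}

theorem units {f : ι → α → Un} (hf : PolyTime Γ f) :
    PolyTime Γ fun i x => List.replicate (f i x).val () :=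
  hf.congr_enc fun _ _ _ => enc_un _

theorem of_units {f : ι → α → List Unit} (hf : PolyTime Γ f) :
    PolyTime Γ fun i x => Un.mk (f i x).length :=
  hf.congr_enc fun i x _ => by
    rw [enc_un]
    congr 1
    exact List.eq_replicate_of_mem fun _ _ => rfl

theorem un_succ {f : ι → α → Un} (hf : PolyTime Γ f) :
    PolyTime Γ fun i x => Un.mk ((f i x).val + 1) :=
  ((const Γ fun _ => ()).pair hf).congr_enc fun _ _ _ => rfl

theorem un_pred {f : ι → α → Un} (hf : PolyTime Γ f) :
    PolyTime Γ fun i x => Un.mk ((f i x).val - 1) :=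
  hf.units.tail.of_units.congr fun i x _ => by simp

theorem un_isZero {f : ι → α → Un} (hf : PolyTime Γ f) :
    PolyTime Γ fun i x => decide ((f i x).val = 0) :=
  hf.units.isEmpty.congr fun i x _ => by simp

theorem un_add {f g : ι → α → Un} (hf : PolyTime Γ f) (hg : PolyTime Γ g) :
    PolyTime Γ fun i x => Un.mk ((f i x).val + (g i x).val) :=
  (hf.units.append hg.units).of_units.congr fun i x _ => by simp

theorem un_sub {f g : ι → α → Un} (hf : PolyTime Γ f) (hg : PolyTime Γ g) :
    PolyTime Γ fun i x => Un.mk ((f i x).val - (g i x).val) := by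
  refine (foldl_add (h := fun _ y => Un.mk (y.2.1.val - 1)) hg.units hf (id _).snd.fst.un_pred
    (PolyBdd.const Γ fun _ => 0) fun i x s b _ _ => ?_).congr fun i x _ => ?_
  · simp
  · have h (n : ℕ) : ∀ s : Un, (List.replicate n ()).foldl (fun s _ => Un.mk (s.val - 1)) s
        = Un.mk (s.val - n) := by
      induction n with
      | zero => simp
      | succ n ih =>
        intro s
        rw [List.replicate_succ, List.foldl_cons, ih, Nat.sub_sub, Nat.add_comm]
    exact h _ _

theorem un_eq {f g : ι → α → Un} (hf : PolyTime Γ f) (hg : PolyTime Γ g) :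
    PolyTime Γ fun i x => decide ((f i x).val = (g i x).val) :=
  ((hf.un_sub hg).un_isZero.and (hg.un_sub hf).un_isZero).congr fun i x _ => by
    rw [Bool.eq_iff_iff]
    simp only [Bool.and_eq_true, decide_eq_true_eq]
    omega

/-- Division by a positive number that depends on the problem only. -/
theorem un_div {f : ι → α → Un} (hf : PolyTime Γ f) (d : ι → ℕ) (hd : ∀ i, 0 < d i) :
    PolyTime Γ fun i x => Un.mk ((f i x).val / d i) := by
  -- The state is the remainder and the quotient of the number of units read so far.
  have key : PolyTime Γ fun i x => (List.replicate (f i x).val ()).foldl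
      (fun (s : Un × Un) _ => if decide (s.1.val + 1 = d i) then (⟨0⟩, ⟨s.2.val + 1⟩)
        else (⟨s.1.val + 1⟩, s.2)) (⟨0⟩, ⟨0⟩) := by
    refine foldl_add (h := fun i y => if decide (y.2.1.1.val + 1 = d i) then
        (Un.mk 0, Un.mk (y.2.1.2.val + 1)) else (Un.mk (y.2.1.1.val + 1), y.2.1.2)) hf.units
      (const _ fun _ => (Un.mk 0, Un.mk 0))
      (ite (un_eq (g := fun i _ => ⟨d i⟩) (id _).snd.fst.fst.un_succ (const _ fun i => Un.mk (d i)))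
        ((const _ fun _ => Un.mk 0).pair (id _).snd.fst.snd.un_succ)
        ((id _).snd.fst.fst.un_succ.pair (id _).snd.fst.snd))
      (PolyBdd.const Γ fun _ => 1) fun i x s b _ _ => ?_
    dsimp only
    rw [enc_prod s]
    split_ifs <;> simp
    omega
  refine key.snd.congr fun i x _ => ?_
  have h (n : ℕ) : (List.replicate n ()).foldl
      (fun (s : Un × Un) _ => if decide (s.1.val + 1 = d i) then (⟨0⟩, ⟨s.2.val + 1⟩)
        else (⟨s.1.val + 1⟩, s.2)) (⟨0⟩, ⟨0⟩) = (⟨n % d i⟩, ⟨n / d i⟩) := by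
    induction n with
    | zero => simp
    | succ n ih =>
      rw [List.replicate_succ', List.foldl_append, ih]
      have hlt := Nat.mod_lt n (hd i)
      simp only [List.foldl_cons, List.foldl_nil, decide_eq_true_eq]
      split_ifs with hc
      · have h1 : n + 1 = d i * (n / d i + 1) := by
          have := Nat.div_add_mod n (d i)
          rw [mul_add]
          omega
        simp only [Prod.mk.injEq, Un.mk.injEq]
        rw [h1]
        exact ⟨by simp, by rw [Nat.mul_div_cancel_left _ (hd i)]⟩
      · have h1 : n + 1 = (n % d i + 1) + d i * (n / d i) := by
          have := Nat.div_add_mod n (d i)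
          omega
        simp only [Prod.mk.injEq, Un.mk.injEq]
        constructor
        · conv_rhs => rw [h1]
          rw [Nat.add_mul_mod_self_left, Nat.mod_eq_of_lt (a := n % d i + 1) (by omega)]
        · conv_rhs => rw [h1]
          rw [Nat.add_mul_div_left _ _ (hd i), Nat.div_eq_of_lt (a := n % d i + 1) (by omega), zero_add]
  rw [h]

theorem un_range {f : ι → α → Un} (hf : PolyTime Γ f) :
    PolyTime Γ fun i x => (List.range (f i x).val).map Un.mk := by
  have key : PolyTime Γ fun i x => (List.replicate (f i x).val ()).foldl
      (fun (s : Un × List Un) _ => (⟨s.1.val + 1⟩, s.1 :: s.2)) (⟨0⟩, []) := by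
    refine foldl_add (h := fun i y => (Un.mk (y.2.1.1.val + 1), y.2.1.1 :: y.2.1.2)) hf.units
      (const _ fun _ => (Un.mk 0, [])) ((id _).snd.fst.fst.un_succ.pair
        ((id _).snd.fst.fst.cons (id _).snd.fst.snd)) (PolyBdd.const Γ fun _ => 1)
      fun i x s b _ _ => ?_
    dsimp only
    rw [enc_prod s]
    simp
  refine key.snd.reverse.congr fun i x _ => ?_
  have h (n : ℕ) : (List.replicate n ()).foldl
      (fun (s : Un × List Un) _ => (⟨s.1.val + 1⟩, s.1 :: s.2)) (⟨0⟩, [])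
        = (⟨n⟩, ((List.range n).map Un.mk).reverse) := by
    induction n with
    | zero => simp
    | succ n ih =>
      rw [List.replicate_succ', List.foldl_append, ih]
      simp [List.range_succ]
  rw [h]
  simp

end PolyTime

/-! ### Natural numbers in binary -/

theorem enc_nat (n : ℕ) : enc n = enc n.bits := rfl

/-- The hypothesis excludes a leading zero, the one case in which prefixing a digit spoils the
canonical binary form. -/
theorem enc_bit {b : Bool} {n : ℕ} (h : n = 0 → b = true) :
    enc (Nat.bit b n) = Data.node (enc b) (enc n) := by
  rw [enc_nat, Nat.bits_append_bit n b h]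
  rfl

theorem enc_nat_eq {n : ℕ} (hn : n ≠ 0) : enc n = Data.node (enc n.bodd) (enc n.div2) := by
  conv_lhs => rw [← Nat.bit_bodd_div2 n]
  refine enc_bit fun h => ?_
  have := Nat.bodd_add_div2 n
  rw [h] at this
  cases hb : n.bodd
  · rw [hb] at this
    simp at this
    omega
  · rfl

theorem enc_nat_zero : enc (0 : ℕ) = Data.leaf := by
  rw [enc_nat, Nat.zero_bits]
  rfl

theorem size_le_ht (n : ℕ) : n.size ≤ (enc n).ht := by
  rw [← Nat.size_eq_bits_len, enc_nat]
  exact length_le_ht _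

theorem lt_two_pow_ht (n : ℕ) : n < 2 ^ (enc n).ht := Nat.size_le.1 (size_le_ht n)

theorem ht_nat_le_size (n : ℕ) : (enc n).ht ≤ n.size + 1 := by
  rw [enc_nat, ← Nat.size_eq_bits_len]
  exact ht_list_le fun a _ => ht_enc_bool a

theorem ht_nat_le {n k : ℕ} (h : n < 2 ^ k) : (enc n).ht ≤ k + 1 :=
  (ht_nat_le_size n).trans (by have := Nat.size_le.2 h; omega)

theorem ht_div2_le (n : ℕ) : (enc n.div2).ht ≤ (enc n).ht := by
  by_cases hn : n = 0
  · subst hn; simp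
  · rw [enc_nat_eq hn, Data.ht_node]
    omega

/-- The number with the given binary digits, most significant digit first. -/
def msbVal : List Bool → ℕ
  | [] => 0
  | b :: l => b.toNat * 2 ^ l.length + msbVal l

theorem msbVal_lt (l : List Bool) : msbVal l < 2 ^ l.length := by
  induction l with
  | nil => simp [msbVal]
  | cons b l ih => cases b <;> simp [msbVal, pow_succ] <;> omega

theorem foldl_bit (l : List Bool) (n : ℕ) :
    l.foldl (fun n b => Nat.bit b n) n = n * 2 ^ l.length + msbVal l := by
  induction l generalizing n with
  | nil => simp [msbVal]
  | cons b l ih =>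
    rw [List.foldl_cons, ih]
    cases b <;> simp [msbVal, Nat.bit_val, pow_succ] <;> ring

/-- One step of the addition (or, if `neg`, subtraction) of binary numbers: the state consists of
the remaining numbers, the carry and the digits found so far. -/
def carryStep (neg : Bool) (s : (ℕ × ℕ) × Bool × List Bool) : (ℕ × ℕ) × Bool × List Bool :=
  ((s.1.1.div2, s.1.2.div2),
    ((Bool.xor s.1.1.bodd neg && (s.1.2.bodd || s.2.1)) || (s.1.2.bodd && s.2.1),
      (Bool.xor s.1.1.bodd (Bool.xor s.1.2.bodd s.2.1)) :: s.2.2))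

/-- The carry and the digits of `a + b` (or `a - b`, if `neg`). -/
def carryAdd (neg : Bool) (a b : ℕ) : Bool × List Bool :=
  -- The list only counts the steps; its extra element leaves room for the last carry.
  ((a.bits ++ (b.bits ++ [true])).foldl (fun s _ => carryStep neg s) ((a, b), false, [])).2

/-- Loop invariant: the digits found, plus `2 ^ k` times what remains, with the carry counted
together with `b'`, give the signed sum. One step is a check of all values of four bits. -/
theorem carryStep_iterate (neg : Bool) (a b k : ℕ) :
    ∃ a' b' c l, (carryStep neg)^[k] ((a, b), false, []) = ((a', b'), c, l) ∧ l.length = k ∧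
      a' = a / 2 ^ k ∧ b' = b / 2 ^ k ∧
      (msbVal l : ℤ) + 2 ^ k * (a' + (if neg then -1 else 1) * (b' + c.toNat)) =
        a + (if neg then -1 else 1) * b := by
  induction k with
  | zero => exact ⟨a, b, false, [], rfl, rfl, by simp, by simp, by simp [msbVal]⟩
  | succ k ih =>
    obtain ⟨a', b', c, l, h, hl, ha, hb, hv⟩ := ih
    refine ⟨_, _, _, _, by rw [Function.iterate_succ_apply', h], ?_, ?_, ?_, ?_⟩
    · simp [carryStep, hl]
    · change a'.div2 = _
      rw [Nat.div2_val, ha, Nat.div_div_eq_div_mul, pow_succ]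
    · change b'.div2 = _
      rw [Nat.div2_val, hb, Nat.div_div_eq_div_mul, pow_succ]
    · rw [← hv]
      have h1 : (a' : ℤ) = a'.bodd.toNat + 2 * a'.div2 := by
        exact_mod_cast (Nat.bodd_add_div2 a').symm
      have h2 : (b' : ℤ) = b'.bodd.toNat + 2 * b'.div2 := by
        exact_mod_cast (Nat.bodd_add_div2 b').symm
      simp only [carryStep]
      rw [h1, h2]
      generalize (a'.div2 : ℤ) = p
      generalize (b'.div2 : ℤ) = q
      generalize a'.bodd = u
      generalize b'.bodd = v
      cases neg <;> cases u <;> cases v <;> cases c <;>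
        simp [msbVal, hl, pow_succ] <;> ring

theorem carryAdd_spec (neg : Bool) (a b : ℕ) :
    ∃ k c l, carryAdd neg a b = (c, l) ∧ l.length = k ∧ a + b < 2 ^ k ∧
      (msbVal l : ℤ) + 2 ^ k * ((if neg then -1 else 1) * c.toNat) =
        a + (if neg then -1 else 1) * b := by
  obtain ⟨a', b', c, l, h, hl, ha, hb, hv⟩ :=
    carryStep_iterate neg a b (a.bits ++ (b.bits ++ [true])).length
  set k := (a.bits ++ (b.bits ++ [true])).length with hk
  have hk' : k = a.size + (b.size + 1) := by
    simp [hk, Nat.size_eq_bits_len]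
  have ha2 : a < 2 ^ (k - 1) :=
    (Nat.lt_size_self a).trans_le (Nat.pow_le_pow_right (by omega) (by omega))
  have hb2 : b < 2 ^ (k - 1) :=
    (Nat.lt_size_self b).trans_le (Nat.pow_le_pow_right (by omega) (by omega))
  have hpow : 2 ^ k = 2 * 2 ^ (k - 1) := by
    rw [← pow_succ']
    congr 1
    omega
  refine ⟨k, c, l, ?_, hl, by omega, ?_⟩
  · rw [carryAdd, List.foldl_const, ← hk, h]
  · rw [Nat.div_eq_of_lt (by omega)] at ha hb
    subst ha hb
    simpa using hv

theorem carryAdd_add (a b : ℕ) : msbVal (carryAdd false a b).2 = a + b := by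
  obtain ⟨k, c, l, h, hl, hlt, hv⟩ := carryAdd_spec false a b
  rw [h]
  cases c
  · simp at hv
    exact_mod_cast hv
  · exfalso
    simp at hv
    have : msbVal l + 2 ^ k = a + b := by exact_mod_cast hv
    omega

/-- A final borrow weighs `-2 ^ k` while the digits stay below `2 ^ k`, so it is set exactly when
the difference is negative. -/
theorem carryAdd_sub (a b : ℕ) : (carryAdd true a b).1 = decide (a < b) ∧
    (b ≤ a → msbVal (carryAdd true a b).2 = a - b) := by
  obtain ⟨k, c, l, h, hl, hlt, hv⟩ := carryAdd_spec true a b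
  rw [h]
  have hm := msbVal_lt l
  rw [hl] at hm
  cases c
  · simp at hv
    constructor
    · simp; omega
    · intro hab; dsimp only; omega
  · simp at hv
    have : ((2 ^ k : ℕ) : ℤ) = 2 ^ k := by push_cast; rfl
    constructor
    · simp; omega
    · intro hab; omega

namespace PolyTime

variable {Γ : Ctx ι α}

theorem bits {f : ι → α → ℕ} (hf : PolyTime Γ f) : PolyTime Γ fun i x => (f i x).bits :=
  hf.congr_enc fun _ _ _ => rfl

theorem bodd {f : ι → α → ℕ} (hf : PolyTime Γ f) : PolyTime Γ fun i x => (f i x).bodd :=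
  comp (g := fun _ (y : ℕ) => y.bodd) (of_prog .hd 1 fun _ n _ => by
    by_cases hn : n = 0
    · subst hn
      rw [enc_nat_zero]
      exact RunLE.hd _
    · rw [enc_nat_eq hn]
      exact RunLE.hd _) hf

theorem div2 {f : ι → α → ℕ} (hf : PolyTime Γ f) : PolyTime Γ fun i x => (f i x).div2 :=
  comp (g := fun _ (y : ℕ) => y.div2) (of_prog .tl 1 fun _ n _ => by
    by_cases hn : n = 0
    · subst hn
      rw [Nat.div2_zero, enc_nat_zero]
      exact RunLE.tl _
    · rw [enc_nat_eq hn]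
      exact RunLE.tl _) hf

theorem bit {b : ι → α → Bool} {f : ι → α → ℕ} (hb : PolyTime Γ b) (hf : PolyTime Γ f) :
    PolyTime Γ fun i x => Nat.bit (b i x) (f i x) :=
  comp₂ (h := fun _ b n => Nat.bit b n)
    -- The pair `(b, n)` already encodes `Nat.bit b n`, unless both parts are zero and a leaf is
    -- needed.
    (of_prog (.cond .hd .skip (.cond .tl .skip .leaf)) 5 fun _ y _ => by
      obtain ⟨b, n⟩ := y
      cases b
      · by_cases hn : n = 0
        · subst hn
          have h := RunLE.tl (enc (false, 0))
          have h' : (enc (false, 0)).tl = _ := enc_nat_zero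
          rw [h'] at h
          have := (RunLE.cond_leaf (p := .skip) (RunLE.hd (enc (false, 0)))
            (RunLE.cond_leaf (p := .skip) h (RunLE.leaf _))).mono (T := 5) (by omega)
          simpa [enc_nat_zero] using this
        · dsimp only
          rw [enc_bit (by simp [hn])]
          have h := RunLE.tl (enc (false, n))
          have h' : (enc (false, n)).tl = _ := enc_nat_eq hn
          rw [h'] at h
          exact (RunLE.cond_leaf (RunLE.hd _) (RunLE.cond_node h
            (RunLE.skip _))).mono (T := 5) (by omega)
      · dsimp only
        rw [enc_bit (by simp)]
        exact (RunLE.cond_node (RunLE.hd _) (RunLE.skip _)).mono (T := 5) (by omega)) hb hf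

theorem msbVal {f : ι → α → List Bool} (hf : PolyTime Γ f) :
    PolyTime Γ fun i x => msbVal (f i x) := by
  refine (foldl_add (h := fun _ y => Nat.bit y.2.2 y.2.1) hf (const Γ fun _ => 0)
    (bit (id _).snd.snd (id _).snd.fst) (PolyBdd.const Γ fun _ => 2)
    fun i x s b _ _ => ?_).congr fun i x _ => by rw [foldl_bit]; simp
  by_cases h : s = 0 ∧ b = false
  · obtain ⟨rfl, rfl⟩ := h
    simp
  · dsimp only
    rw [enc_bit (by intro h0; cases b <;> simp_all), Data.ht_node]
    have := ht_enc_bool b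
    omega

theorem carryAdd (neg : Bool) {f g : ι → α → ℕ} (hf : PolyTime Γ f) (hg : PolyTime Γ g) :
    PolyTime Γ fun i x => carryAdd neg (f i x) (g i x) := by
  refine (foldl_add (h := fun _ y => carryStep neg y.2.1)
    (hf.bits.append (hg.bits.append (const Γ fun _ => [true])))
    ((hf.pair hg).pair (const Γ fun _ => (false, []))) ?_ (PolyBdd.const Γ fun _ => 5)
    fun _ _ s _ _ _ => ?_).snd
  · have hs : PolyTime (Γ.fold (fun i x => (f i x).bits ++ ((g i x).bits ++ [true]))
        ((ℕ × ℕ) × Bool × List Bool)) fun _ y => y.2.1 := (id _).snd.fst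
    exact (hs.fst.fst.div2.pair hs.fst.snd.div2).pair
      ((((hs.fst.fst.bodd.xor (const _ fun _ => neg)).and (hs.fst.snd.bodd.or hs.snd.fst)).or
        (hs.fst.snd.bodd.and hs.snd.fst)).pair
        ((hs.fst.fst.bodd.xor (hs.fst.snd.bodd.xor hs.snd.fst)).cons hs.snd.snd))
  · obtain ⟨⟨a, b⟩, c, l⟩ := s
    have h1 := ht_div2_le a
    have h2 := ht_div2_le b
    dsimp only [carryStep]
    generalize (_ || _ : Bool) = u
    generalize Bool.xor _ _ = v
    have h3 := ht_enc_bool u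
    have h4 := ht_enc_bool v
    simp only [enc_pair, enc_cons, Data.ht_node]
    omega

theorem nat_add {f g : ι → α → ℕ} (hf : PolyTime Γ f) (hg : PolyTime Γ g) :
    PolyTime Γ fun i x => f i x + g i x :=
  (hf.carryAdd false hg).snd.msbVal.congr fun _ _ _ => carryAdd_add _ _

theorem nat_mul {f g : ι → α → ℕ} (hf : PolyTime Γ f) (hg : PolyTime Γ g) :
    PolyTime Γ fun i x => f i x * g i x := by
  refine comp₂ (h := fun _ a b => a * b) ?_ hf hg
  -- Horner's rule from the most significant bit: double, then add the second factor if the bit is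
  -- set. Each step adds to the height an amount depending on that factor only.
  refine (foldl_add (l := fun _ x => x.1.bits.reverse) (g := fun _ _ => 0)
    (h := fun _ (y : (ℕ × ℕ) × ℕ × Bool) => Nat.bit false y.2.1 + if y.2.2 then y.1.2 else 0)
    (id _).fst.bits.reverse
    (const _ fun _ => 0)
    ((bit (const _ fun _ => false) (id _).snd.fst).nat_add
      (ite (id _).snd.snd (id _).fst.snd (const _ fun _ => 0)))
    (B := fun _ x => (enc x.2).ht + 3)
    ((snd (id _)).ht.add (PolyBdd.const _ fun _ => 3))
    fun i x s b _ _ => ?_).congr fun i x _ => ?_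
  · have h1 := lt_two_pow_ht s
    have h2 := lt_two_pow_ht x.2
    refine (ht_nat_le (k := (enc s).ht + (enc x.2).ht + 2) ?_).trans (by omega)
    have e1 : 2 ^ (enc s).ht ≤ 2 ^ ((enc s).ht + (enc x.2).ht) :=
      Nat.pow_le_pow_right (by omega) (by omega)
    have e2 : 2 ^ (enc x.2).ht ≤ 2 ^ ((enc s).ht + (enc x.2).ht) :=
      Nat.pow_le_pow_right (by omega) (by omega)
    rw [pow_add _ _ 2, Nat.bit_val]
    dsimp only
    split_ifs <;> simp <;> omega
  · obtain ⟨a, b⟩ := x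
    clear * -
    dsimp only
    rw [List.foldl_reverse]
    induction a using Nat.binaryRec' with
    | zero => simp
    | bit u n h ih =>
      rw [Nat.bits_append_bit _ _ h, List.foldr_cons, ih]
      cases u <;> simp [Nat.bit_val] <;> ring

/-! ### Integers -/

theorem int_sign_natAbs {f : ι → α → ℤ} (hf : PolyTime Γ f) :
    PolyTime Γ fun i x => (decide (f i x < 0), (f i x).natAbs) :=
  hf.congr_enc fun _ _ _ => rfl

/-- The subtraction is run in both directions; the borrow of the first one gives the sign and
selects the digits. -/
theorem nat_sub_cast {f g : ι → α → ℕ} (hf : PolyTime Γ f) (hg : PolyTime Γ g) :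
    PolyTime Γ fun i x => (f i x : ℤ) - g i x := by
  refine ((hf.carryAdd true hg).fst.pair (ite (hf.carryAdd true hg).fst
    (hg.carryAdd true hf).snd.msbVal (hf.carryAdd true hg).snd.msbVal)).congr_enc fun i x _ => ?_
  obtain ⟨h1, h2⟩ := carryAdd_sub (f i x) (g i x)
  obtain ⟨h3, h4⟩ := carryAdd_sub (g i x) (f i x)
  change _ = Data.node (enc (decide ((f i x : ℤ) - g i x < 0))) (enc ((f i x : ℤ) - g i x).natAbs)
  rw [h1, enc_pair]
  congr 2
  · rw [Bool.eq_iff_iff]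
    simp
  · by_cases h : f i x < g i x
    · simp only [h, decide_true, if_true]
      rw [h4 h.le]
      omega
    · simp only [h, decide_false]
      rw [if_neg (by simp), h2 (by omega)]
      omega

theorem int_posPart {f : ι → α → ℤ} (hf : PolyTime Γ f) :
    PolyTime Γ fun i x => (f i x).toNat :=
  (ite hf.int_sign_natAbs.fst (const Γ fun _ => 0) hf.int_sign_natAbs.snd).congr
    fun i x _ => by
      by_cases h : f i x < 0
      · simp [h]; omega
      · simp [h]; omega

theorem int_negPart {f : ι → α → ℤ} (hf : PolyTime Γ f) :
    PolyTime Γ fun i x => (-f i x).toNat :=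
  (ite hf.int_sign_natAbs.fst hf.int_sign_natAbs.snd (const Γ fun _ => 0)).congr
    fun i x _ => by
      by_cases h : f i x < 0
      · simp [h]; omega
      · simp [h]; omega

theorem int_add {f g : ι → α → ℤ} (hf : PolyTime Γ f) (hg : PolyTime Γ g) :
    PolyTime Γ fun i x => f i x + g i x :=
  ((hf.int_posPart.nat_add hg.int_posPart).nat_sub_cast
    (hf.int_negPart.nat_add hg.int_negPart)).congr fun i x _ => by
      push_cast
      have h1 := Int.toNat_sub_toNat_neg (f i x)
      have h2 := Int.toNat_sub_toNat_neg (g i x)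
      linarith

theorem int_mul {f g : ι → α → ℤ} (hf : PolyTime Γ f) (hg : PolyTime Γ g) :
    PolyTime Γ fun i x => f i x * g i x :=
  (((hf.int_posPart.nat_mul hg.int_posPart).nat_add
      (hf.int_negPart.nat_mul hg.int_negPart)).nat_sub_cast
    ((hf.int_posPart.nat_mul hg.int_negPart).nat_add
      (hf.int_negPart.nat_mul hg.int_posPart))).congr fun i x _ => by
      conv_rhs => rw [← Int.toNat_sub_toNat_neg (f i x), ← Int.toNat_sub_toNat_neg (g i x)]
      push_cast
      ring

theorem nat_cast {f : ι → α → ℕ} (hf : PolyTime Γ f) : PolyTime Γ fun i x => (f i x : ℤ) :=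
  (hf.nat_sub_cast (const Γ fun _ => 0)).congr fun i x _ => by simp

theorem int_sum {κ : Type} (s : Finset κ) {f : κ → ι → α → ℤ}
    (hf : ∀ j ∈ s, PolyTime Γ (f j)) : PolyTime Γ fun i x => ∑ j ∈ s, f j i x := by
  classical
  induction s using Finset.induction_on with
  | empty => exact (const Γ fun _ => (0 : ℤ)).congr fun _ _ _ => by simp
  | insert a s ha ih =>
    exact ((hf a (by simp)).int_add (ih fun j hj => hf j (by simp [hj]))).congr
      fun i x _ => by rw [Finset.sum_insert ha]

end PolyTime

/-! ### Heights of integers and of concatenated lists. -/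

theorem natAbs_lt_two_pow_ht (z : ℤ) : z.natAbs < 2 ^ (enc z).ht := by
  refine (lt_two_pow_ht z.natAbs).trans_le (Nat.pow_le_pow_right (by omega) ?_)
  have : enc z = Data.node (enc (decide (z < 0))) (enc z.natAbs) := rfl
  rw [this, Data.ht_node]
  omega

theorem ht_int_le {z : ℤ} {k : ℕ} (h : z.natAbs < 2 ^ k) : (enc z).ht ≤ k + 2 := by
  have h1 : enc z = Data.node (enc (decide (z < 0))) (enc z.natAbs) := rfl
  have h2 := ht_nat_le h
  have h3 := ht_enc_bool (decide (z < 0))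
  rw [h1, Data.ht_node]
  omega

theorem ht_append_le (l l' : List β) : (enc (l ++ l')).ht ≤ (enc l).ht + (enc l').ht := by
  induction l with
  | nil => simp
  | cons b l ih => simp only [List.cons_append, enc_cons, Data.ht_node]; omega

namespace PolyTime

variable {Γ : Ctx ι α}

theorem flatten {f : ι → α → List (List β)} (hf : PolyTime Γ f) :
    PolyTime Γ fun i x => (f i x).flatten := by
  refine (foldl_add (h := fun _ (y : α × List β × List β) => y.2.1 ++ y.2.2) hf
    (const Γ fun _ => []) ((id _).snd.fst.append (id _).snd.snd) (B := fun i x => (enc (f i x)).ht)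
    hf.ht fun i x s b _ hb => ?_).congr fun i x _ => ?_
  · have h1 := ht_le_of_mem hb
    have h2 := ht_append_le s b
    dsimp only
    omega
  · rw [List.foldl_append_eq_append]
    simp

end PolyTime

/-! ### Coordinates in a number field -/

/-- Rational coordinates of an element of a number field: a denominator and the numerators. -/
abbrev Vec (r : ℕ) := ℕ × (Fin r → ℤ)

/-- A rational matrix: a denominator and the numerators. -/
abbrev Mat (r : ℕ) := ℕ × (Fin r → Fin r → ℤ)

/-- The product of a matrix and a vector. -/
def Mat.app {r : ℕ} (M : Mat r) (v : Vec r) : Vec r :=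
  (M.1 * v.1, fun i => ∑ j, M.2 i j * v.2 j)

/-- The sum of two vectors. -/
def Vec.add {r : ℕ} (v w : Vec r) : Vec r := (v.1 * w.1, fun i => v.2 i * w.1 + w.2 i * v.1)

/-- Half of a vector. -/
def Vec.half {r : ℕ} (v : Vec r) : Vec r := (Nat.bit false v.1, v.2)

theorem Vec.ht_le {r : ℕ} {v : Vec r} {k : ℕ} (h1 : v.1 < 2 ^ k) (h2 : ∀ i, (v.2 i).natAbs < 2 ^ k) :
    (enc v).ht ≤ k + r + 3 := by
  have h3 := ht_nat_le h1
  have h4 : (enc v.2).ht ≤ r + (k + 2) := ht_fun_le fun j => ht_int_le (h2 j)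
  rw [enc_prod, Data.ht_node]
  omega

theorem Vec.fst_lt {r : ℕ} (v : Vec r) : v.1 < 2 ^ (enc v).ht := by
  refine (lt_two_pow_ht v.1).trans_le (Nat.pow_le_pow_right (by omega) ?_)
  rw [enc_prod, Data.ht_node]
  omega

theorem Vec.snd_lt {r : ℕ} (v : Vec r) (i : Fin r) : (v.2 i).natAbs < 2 ^ (enc v).ht := by
  refine (natAbs_lt_two_pow_ht (v.2 i)).trans_le (Nat.pow_le_pow_right (by omega) ?_)
  have := ht_le_of_apply v.2 i
  rw [enc_prod, Data.ht_node]
  omega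

theorem Mat.fst_lt {r : ℕ} (M : Mat r) : M.1 < 2 ^ (enc M).ht := by
  refine (lt_two_pow_ht M.1).trans_le (Nat.pow_le_pow_right (by omega) ?_)
  rw [enc_prod, Data.ht_node]
  omega

theorem Mat.snd_lt {r : ℕ} (M : Mat r) (i j : Fin r) : (M.2 i j).natAbs < 2 ^ (enc M).ht := by
  refine (natAbs_lt_two_pow_ht (M.2 i j)).trans_le (Nat.pow_le_pow_right (by omega) ?_)
  have := ht_le_of_apply (M.2 i) j
  have := ht_le_of_apply M.2 i
  rw [enc_prod, Data.ht_node]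
  omega

/-- The increase depends on the matrix alone, as `foldl_add` demands. Hence long products stay small
enough without ever reducing fractions. -/
theorem Mat.ht_app_le {r : ℕ} (M : Mat r) (v : Vec r) :
    (enc (M.app v)).ht ≤ (enc v).ht + ((enc M).ht + 2 * r + 3) := by
  refine (Vec.ht_le (k := r + ((enc M).ht + (enc v).ht)) ?_ fun i => ?_).trans (by omega)
  · calc M.1 * v.1 < 2 ^ (enc M).ht * 2 ^ (enc v).ht := Nat.mul_lt_mul'' M.fst_lt v.fst_lt
      _ = 2 ^ ((enc M).ht + (enc v).ht) := (pow_add _ _ _).symm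
      _ ≤ _ := Nat.pow_le_pow_right (by omega) (by omega)
  · calc (∑ j, M.2 i j * v.2 j).natAbs ≤ ∑ j, (M.2 i j * v.2 j).natAbs :=
          Int.natAbs_sum_le _ _
      _ ≤ ∑ _j : Fin r, 2 ^ ((enc M).ht + (enc v).ht) := by
          refine Finset.sum_le_sum fun j _ => ?_
          rw [Int.natAbs_mul, pow_add]
          exact Nat.mul_le_mul (M.snd_lt i j).le (v.snd_lt j).le
      _ = r * 2 ^ ((enc M).ht + (enc v).ht) := by simp
      _ < 2 ^ r * 2 ^ ((enc M).ht + (enc v).ht) :=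
          Nat.mul_lt_mul_of_pos_right Nat.lt_two_pow_self (by positivity)
      _ = _ := (pow_add _ _ _).symm

theorem Vec.ht_add_le {r : ℕ} (v w : Vec r) :
    (enc (v.add w)).ht ≤ (enc v).ht + ((enc w).ht + r + 4) := by
  refine (Vec.ht_le (k := (enc v).ht + (enc w).ht + 1) ?_ fun i => ?_).trans (by omega)
  · calc v.1 * w.1 < 2 ^ (enc v).ht * 2 ^ (enc w).ht := Nat.mul_lt_mul'' v.fst_lt w.fst_lt
      _ = 2 ^ ((enc v).ht + (enc w).ht) := (pow_add _ _ _).symm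
      _ ≤ _ := Nat.pow_le_pow_right (by omega) (by omega)
  · have h1 : (v.2 i * w.1).natAbs < 2 ^ (enc v).ht * 2 ^ (enc w).ht := by
      rw [Int.natAbs_mul, Int.natAbs_natCast]
      exact Nat.mul_lt_mul'' (v.snd_lt i) w.fst_lt
    have h2 : (w.2 i * v.1).natAbs < 2 ^ (enc w).ht * 2 ^ (enc v).ht := by
      rw [Int.natAbs_mul, Int.natAbs_natCast]
      exact Nat.mul_lt_mul'' (w.snd_lt i) v.fst_lt
    have h3 := Int.natAbs_add_le (v.2 i * w.1) (w.2 i * v.1)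
    rw [pow_succ, pow_add]
    rw [mul_comm (2 ^ (enc w).ht)] at h2
    change (v.2 i * w.1 + w.2 i * v.1).natAbs < _
    omega

namespace PolyTime

variable {Γ : Ctx ι α} {r : ℕ}

theorem mat_app {M : ι → α → Mat r} {v : ι → α → Vec r} (hM : PolyTime Γ M) (hv : PolyTime Γ v) :
    PolyTime Γ fun i x => (M i x).app (v i x) :=
  (hM.fst.nat_mul hv.fst).pair (tuple fun k => int_sum Finset.univ
    (f := fun j i x => (M i x).2 k j * (v i x).2 j)
    fun j _ => ((hM.snd.apply k).apply j).int_mul (hv.snd.apply j))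

theorem vec_add {v w : ι → α → Vec r} (hv : PolyTime Γ v) (hw : PolyTime Γ w) :
    PolyTime Γ fun i x => (v i x).add (w i x) :=
  (hv.fst.nat_mul hw.fst).pair (tuple (f := fun i x k => (v i x).2 k * (w i x).1 +
    (w i x).2 k * (v i x).1) fun k =>
    ((hv.snd.apply k).int_mul hw.fst.nat_cast).int_add ((hw.snd.apply k).int_mul hv.fst.nat_cast))

theorem vec_half {v : ι → α → Vec r} (hv : PolyTime Γ v) :
    PolyTime Γ fun i x => (v i x).half :=
  ((const Γ fun _ => false).bit hv.fst).pair hv.snd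

end PolyTime

/-- A list of matrices is applied to a vector. -/
def applyAll {r : ℕ} (p : List (Mat r) × Vec r) : Vec r := p.1.foldl (fun v M => M.app v) p.2

/-- The sum of a list of vectors. -/
def sumAll {r : ℕ} (l : List (Vec r)) : Vec r := l.foldl Vec.add (1, 0)

/-- A vector is halved as often as a list is long. -/
def halveAll {r : ℕ} {δ : Type} (l : List δ) (v : Vec r) : Vec r := l.foldl (fun v _ => v.half) v

namespace PolyTime

variable {Γ : Ctx ι α} {r : ℕ}

theorem applyAll {f : ι → α → List (Mat r) × Vec r} (hf : PolyTime Γ f) :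
    PolyTime Γ fun i x => applyAll (f i x) :=
  foldl_add (h := fun _ (y : α × Vec r × Mat r) => y.2.2.app y.2.1) hf.fst hf.snd
    (mat_app (id _).snd.snd (id _).snd.fst) (B := fun i x => (enc (f i x).1).ht + 2 * r + 3)
    ((hf.fst.ht.add (PolyBdd.const _ fun _ => 2 * r)).add (PolyBdd.const _ fun _ => 3))
    fun i x s b _ hb => by
      have h1 := ht_le_of_mem hb
      have h2 := Mat.ht_app_le b s
      dsimp only
      omega

theorem sumAll {f : ι → α → List (Vec r)} (hf : PolyTime Γ f) :
    PolyTime Γ fun i x => sumAll (f i x) :=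
  foldl_add (h := fun _ (y : α × Vec r × Vec r) => y.2.1.add y.2.2) hf (const Γ fun _ => (1, 0))
    (vec_add (id _).snd.fst (id _).snd.snd) (B := fun i x => (enc (f i x)).ht + r + 4)
    ((hf.ht.add (PolyBdd.const _ fun _ => r)).add (PolyBdd.const _ fun _ => 4))
    fun i x s b _ hb => by
      have h1 := ht_le_of_mem hb
      have h2 := Vec.ht_add_le s b
      dsimp only
      omega

theorem halveAll {l : ι → α → List β} {f : ι → α → Vec r} (hl : PolyTime Γ l)
    (hf : PolyTime Γ f) : PolyTime Γ fun i x => halveAll (l i x) (f i x) :=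
  foldl_add (h := fun _ (y : α × Vec r × β) => y.2.1.half) hl hf (vec_half (id _).snd.fst)
    (B := fun _ _ => 1) (PolyBdd.const _ fun _ => 1)
    fun i x s b _ hb => by
      dsimp only [Vec.half]
      rw [enc_pair, enc_prod s, Data.ht_node, Data.ht_node]
      by_cases h : s.1 = 0
      · rw [h]
        simp
      · rw [enc_bit (by simp [h]), Data.ht_node, enc_false, Data.ht_leaf]
        omega

end PolyTime

/-! ### The reduction, on encoded instances -/

/-- A constraint: the name of the function and the names of the variables. -/
abbrev Raw := Un × List Un

/-- An instance: the number of variables and the constraints. -/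
abbrev RawInst := Un × List Raw

/-- Does some constraint with the function named `s` contain the variable `v`? -/
def rawPin (s : ℕ) (x : RawInst) (v : Un) : Bool :=
  x.2.any fun c => decide (c.1.val = s) && c.2.any fun w => decide (w.val = v.val)

/-- The variable that is to replace the variable `v`. -/
def rawSub (d : ℕ) (x : RawInst) (v : Un) : Un :=
  -- Block `v / d` owns the path vertices `2 (v / d)`, standing for `0`, and `2 (v / d) + 1`,
  -- standing for `1`.
  if rawPin 0 x v then ⟨x.1.val + (v.val / d + v.val / d)⟩
  else if rawPin 1 x v then ⟨x.1.val + (v.val / d + v.val / d) + 1⟩ else v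

/-- The constraints other than pins, after replacing the pinned variables. -/
def rawBase (d : ℕ) (x : RawInst) : List Raw :=
  -- The names `0` and `1` are reserved for the pins; all others are shifted by two.
  (x.2.filter fun c => !decide (c.1.val = 0) && !decide (c.1.val = 1)).map fun c =>
    (⟨c.1.val - 1 - 1⟩, c.2.map (rawSub d x))

/-- The edges of a path on the new variables `n, …, n + 2 m`, oriented from the even to the odd
positions. -/
def rawEdges (n m : ℕ) : List (Un × Un) :=
  -- With this orientation every edge sees `(0, 1)` under the alternating assignment, so one
  -- asymmetric weight serves all edges.
  ((List.range m).map fun b => (⟨n + (b + b)⟩, ⟨n + (b + b) + 1⟩)) ++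
    (List.range m).map fun b => (⟨n + (b + b) + 1 + 1⟩, ⟨n + (b + b) + 1⟩)

/-- One step of the expansion of a product of binomials. -/
def expandStep {μ γ : Type} (L : List (List μ × List γ)) (s : (μ × μ) × List γ) :
    List (List μ × List γ) :=
  (L.map fun p => (s.1.1 :: p.1, s.2 ++ p.2)) ++ L.map fun p => (s.1.2 :: p.1, p.2)

/-- The expansion of a product of binomials: a list of coefficients and a list of constraints for
each of the terms. -/
def expand {μ γ : Type} (steps : List ((μ × μ) × List γ)) (base : List γ) :
    List (List μ × List γ) :=
  steps.foldl expandStep [([], base)]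

/-- A binomial: two coefficients, and constraints on the two vertices of an edge. -/
abbrev RawFactor (r : ℕ) := (Mat r × Mat r) × List (Un × List Bool)

/-- The binomials of an edge. -/
def rawEdgeSteps {r : ℕ} (S : List (RawFactor r)) (e : Un × Un) :
    List ((Mat r × Mat r) × List Raw) :=
  S.map fun s => (s.1, s.2.map fun g => (g.1, g.2.map fun b => if b then e.2 else e.1))

/-- All binomials. -/
def rawSteps {r : ℕ} (S : List (RawFactor r)) (d : ℕ) (x : RawInst) :
    List ((Mat r × Mat r) × List Raw) :=
  ((rawEdges x.1.val (x.1.val / d + 1)).map (rawEdgeSteps S)).flatten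

/-- The new number of variables. -/
def newNum (d n : ℕ) : ℕ := n + ((n / d + 1) + (n / d + 1) + 1)

/-- The terms of the expansion. -/
def rawTerms {r : ℕ} (S : List (RawFactor r)) (d : ℕ) (x : RawInst) :
    List (List (Mat r) × List Raw) :=
  expand (rawSteps S d x) (rawBase d x)

/-- Is some variable pinned to both values? -/
def rawConflict (x : RawInst) : Bool :=
  ((List.range x.1.val).map Un.mk).any fun v => rawPin 0 x v && rawPin 1 x v

/-- The pinned variables. -/
def rawPinned (x : RawInst) : List Un :=
  ((List.range x.1.val).map Un.mk).filter fun v => rawPin 0 x v || rawPin 1 x v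

/-- The output of the reduction, which uses an oracle `O` and halves the result `k` additional
times. -/
def rawOut {r : ℕ} (S : List (RawFactor r)) (d k : ℕ) (O : RawInst → Vec r) (x : RawInst) :
    Vec r :=
  -- Contradictory pins make the value zero. They are treated apart because the substitution can
  -- respect only one of the two.
  if rawConflict x then (1, 0) else
    -- Each pinned variable, left without constraints, contributes a factor `2`; the total weight of
    -- the path is `2 ^ k`.
    halveAll (rawPinned x ++ List.replicate k ⟨0⟩) (sumAll ((rawTerms S d x).map fun p =>
      applyAll (p.1, O (⟨newNum d x.1.val⟩, p.2))))

theorem length_rawSteps {r : ℕ} (S : List (RawFactor r)) (d : ℕ) (x : RawInst) :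
    (rawSteps S d x).length = 2 * (x.1.val / d + 1) * S.length := by
  simp [rawSteps, rawEdges, List.length_flatten, Function.comp_def, rawEdgeSteps]
  ring

/-! ### Cost of expanding a product of binomials. -/

section Expand

variable {μ : Type} [Enc μ]

/-- A binomial doubles the number of terms but enlarges each single term only additively. -/
theorem expand_bound (pre : List ((μ × μ) × List γ)) {H M : ℕ} (hH : ∀ s ∈ pre, (enc s).ht ≤ H)
    (L : List (List μ × List γ)) (hM : ∀ p ∈ L, (enc p).ht ≤ M) :
    (pre.foldl expandStep L).length = 2 ^ pre.length * L.length ∧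
      ∀ p ∈ pre.foldl expandStep L, (enc p).ht ≤ M + pre.length * (H + 1) := by
  induction pre generalizing L M with
  | nil => simpa using hM
  | cons s pre ih =>
    have hs := hH s (by simp)
    obtain ⟨⟨a, b⟩, T⟩ := s
    simp only [enc_pair, Data.ht_node] at hs
    have h := ih (M := M + (H + 1)) (fun t ht => hH t (by simp [ht])) (expandStep L ((a, b), T))
      fun p hp => by
        rcases List.mem_append.1 hp with hp | hp
        · obtain ⟨q, hq, rfl⟩ := List.mem_map.1 hp
          have h1 := hM q hq
          have h2 := ht_append_le T q.2
          rw [enc_prod, Data.ht_node] at h1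
          simp only [enc_pair, enc_cons, Data.ht_node]
          omega
        · obtain ⟨q, hq, rfl⟩ := List.mem_map.1 hp
          have h1 := hM q hq
          rw [enc_prod, Data.ht_node] at h1
          simp only [enc_pair, enc_cons, Data.ht_node]
          omega
    constructor
    · rw [List.foldl_cons, h.1]
      simp [expandStep, pow_succ]
      ring
    · intro p hp
      have := h.2 p hp
      rw [List.length_cons, add_mul]
      omega

/-- The number of terms is exponential; `h` says that the context has granted it as a resource. -/
theorem PolyTime.expand {Γ : Ctx ι α} {steps : ι → α → List ((μ × μ) × List γ)}
    {base : ι → α → List γ} (hs : PolyTime Γ steps) (hb : PolyTime Γ base)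
    (h : PolyBdd Γ fun i x => 2 ^ (steps i x).length) :
    PolyTime Γ fun i x => expand (steps i x) (base i x) := by
  refine PolyTime.foldl
    (h := fun _ (y : α × List (List μ × List γ) × ((μ × μ) × List γ)) => expandStep y.2.1 y.2.2)
    hs (((const Γ fun _ => []).pair hb).cons (const Γ fun _ => [])) ?_
    (B := fun i x => 2 ^ (steps i x).length + (((enc (base i x)).ht + 1) +
      (enc (steps i x)).ht * ((enc (steps i x)).ht + 1)))
    (h.add ((hb.ht.add (PolyBdd.const _ fun _ => 1)).add
      (hs.ht.mul (hs.ht.add (PolyBdd.const _ fun _ => 1))))) fun i x _ pre suf e => ?_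
  · refine PolyTime.append
      (f := fun _ (y : α × List (List μ × List γ) × ((μ × μ) × List γ)) =>
        y.2.1.map fun p => (y.2.2.1.1 :: p.1, y.2.2.2 ++ p.2))
      (g := fun _ (y : α × List (List μ × List γ) × ((μ × μ) × List γ)) =>
        y.2.1.map fun p => (y.2.2.1.2 :: p.1, p.2)) ?_ ?_
    · exact map (f := fun _ (z : (α × List (List μ × List γ) × ((μ × μ) × List γ)) ×
          (List μ × List γ)) => (z.1.2.2.1.1 :: z.2.1, z.1.2.2.2 ++ z.2.2)) (id _).snd.fst
        (((id _).fst.snd.snd.fst.fst.cons (id _).snd.fst).pair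
          ((id _).fst.snd.snd.snd.append (id _).snd.snd))
    · exact map (f := fun _ (z : (α × List (List μ × List γ) × ((μ × μ) × List γ)) ×
          (List μ × List γ)) => (z.1.2.2.1.2 :: z.2.1, z.2.2)) (id _).snd.fst
        (((id _).fst.snd.snd.fst.snd.cons (id _).snd.fst).pair (id _).snd.snd)
  · have hlen : pre.length ≤ (steps i x).length := by simp [e]
    have hlen' := length_le_ht (steps i x)
    obtain ⟨h1, h2⟩ := expand_bound pre (H := (enc (steps i x)).ht)
      (M := (enc (base i x)).ht + 1) (fun s hs => ht_le_of_mem (by simp [e, hs]))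
      [([], base i x)] (by simp)
    refine (ht_list_le h2).trans ?_
    rw [h1, List.length_singleton, mul_one]
    have h3 : 2 ^ pre.length ≤ 2 ^ (steps i x).length := Nat.pow_le_pow_right (by omega) hlen
    have h4 := Nat.mul_le_mul_right ((enc (steps i x)).ht + 1) (hlen.trans hlen')
    omega

end Expand

/-! ### Running time of the reduction. -/

namespace PolyTime

variable {Γ : Ctx ι α}

theorem rawPin (s : ℕ) {x : ι → α → RawInst} {v : ι → α → Un} (hx : PolyTime Γ x)
    (hv : PolyTime Γ v) : PolyTime Γ fun i a => rawPin s (x i a) (v i a) := by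
  refine comp₂ (h := fun _ x v => PinCSP.rawPin s x v) ?_ hx hv
  refine any (f := fun _ (y : (RawInst × Un) × Raw) => decide (y.2.1.val = s) &&
    y.2.2.any fun w => decide (w.val = y.1.2.val)) (id _).fst.snd ?_
  exact (un_eq (g := fun _ _ => ⟨s⟩) (id _).snd.fst (const _ fun _ => Un.mk s)).and
    (any (f := fun _ (z : ((RawInst × Un) × Raw) × Un) => decide (z.2.val = z.1.1.2.val))
      (id _).snd.snd (un_eq (id _).snd (id _).fst.fst.snd))

theorem rawSub (d : ι → ℕ) (hd : ∀ i, 0 < d i) {x : ι → α → RawInst} {v : ι → α → Un}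
    (hx : PolyTime Γ x) (hv : PolyTime Γ v) :
    PolyTime Γ fun i a => rawSub (d i) (x i a) (v i a) :=
  ite (rawPin 0 hx hv) (un_add hx.fst (un_add (un_div hv d hd) (un_div hv d hd)))
    (ite (rawPin 1 hx hv) (un_add hx.fst (un_add (un_div hv d hd) (un_div hv d hd))).un_succ hv)

theorem rawBase (d : ι → ℕ) (hd : ∀ i, 0 < d i) :
    PolyTime (Ctx.triv ι RawInst) fun i x => rawBase (d i) x := by
  refine map (l := fun _ (x : RawInst) =>
      x.2.filter fun c => !decide (c.1.val = 0) && !decide (c.1.val = 1))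
    (f := fun i (y : RawInst × Raw) =>
      ((⟨y.2.1.val - 1 - 1⟩, y.2.2.map (PinCSP.rawSub (d i) y.1)) : Raw)) ?_ ?_
  · exact filter (f := fun _ (y : RawInst × Raw) =>
        !decide (y.2.1.val = 0) && !decide (y.2.1.val = 1)) (id _).snd
      ((un_eq (g := fun _ _ => ⟨0⟩) (id _).snd.fst (const _ fun _ => Un.mk 0)).not.and
        (un_eq (g := fun _ _ => ⟨1⟩) (id _).snd.fst (const _ fun _ => Un.mk 1)).not)
  · exact (id _).snd.fst.un_pred.un_pred.pair
      (map (f := fun i (z : (RawInst × Raw) × Un) => PinCSP.rawSub (d i) z.1.1 z.2) (id _).snd.snd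
        (rawSub d hd (id _).fst.fst (id _).snd))

theorem rawEdges {n m : ι → α → Un} (hn : PolyTime Γ n) (hm : PolyTime Γ m) :
    PolyTime Γ fun i x => rawEdges (n i x).val (m i x).val := by
  refine comp₂ (h := fun _ (n m : Un) => PinCSP.rawEdges n.val m.val) ?_ hn hm
  have h1 : PolyTime ((Ctx.triv ι (Un × Un)).elem
      fun _ y => (List.range y.2.val).map Un.mk) fun _ (y : (Un × Un) × Un) =>
        Un.mk (y.1.1.val + (y.2.val + y.2.val)) :=
    un_add (id _).fst.fst (un_add (id _).snd (id _).snd)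
  refine ((map (f := fun _ (y : (Un × Un) × Un) => (Un.mk (y.1.1.val + (y.2.val + y.2.val)),
      Un.mk (y.1.1.val + (y.2.val + y.2.val) + 1))) (un_range (id _).snd)
      (h1.pair h1.un_succ)).append (map (f := fun _ (y : (Un × Un) × Un) =>
      (Un.mk (y.1.1.val + (y.2.val + y.2.val) + 1 + 1),
      Un.mk (y.1.1.val + (y.2.val + y.2.val) + 1))) (un_range (id _).snd)
      (h1.un_succ.un_succ.pair h1.un_succ))).congr fun i x _ => ?_
  simp [PinCSP.rawEdges, Function.comp_def]

theorem rawSteps {r : ℕ} (S : ι → List (RawFactor r)) (d : ι → ℕ) (hd : ∀ i, 0 < d i) :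
    PolyTime (Ctx.triv ι RawInst) fun i x => rawSteps (S i) (d i) x := by
  refine flatten (map (f := fun i (y : RawInst × Un × Un) => rawEdgeSteps (S i) y.2)
    (rawEdges (id _).fst (un_div (id _).fst d hd).un_succ) ?_)
  exact map (f := fun _ (z : (RawInst × Un × Un) × RawFactor r) =>
      (z.2.1, z.2.2.map fun g => (g.1, g.2.map fun b => if b then z.1.2.2 else z.1.2.1)))
    (const _ S) ((id _).snd.fst.pair (map (f := fun _ (w : ((RawInst × Un × Un) × RawFactor r) ×
      Un × List Bool) => (w.2.1, w.2.2.map fun b => if b then w.1.1.2.2 else w.1.1.2.1))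
      (id _).snd.snd ((id _).snd.fst.pair
        (map (f := fun _ (u : (((RawInst × Un × Un) × RawFactor r) × Un × List Bool) × Bool) =>
          if u.2 then u.1.1.1.2.2 else u.1.1.1.2.1) (id _).snd.snd
          (ite (id _).snd (id _).fst.fst.fst.snd.snd (id _).fst.fst.fst.snd.fst)))))

/-- The reduction runs in polynomial time in the size of the expansion and the time granted to the
oracle. -/
theorem rawOut {r : ℕ} {Γ Δ : Ctx ι RawInst} {S : ι → List (RawFactor r)} {d : ι → ℕ} (k : ℕ)
    {O : ι → RawInst → Vec r} (hd : ∀ i, 0 < d i) (hO : PolyTime Δ O)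
    (hdom : ∀ i x, Γ.dom i x → ∀ p ∈ rawTerms (S i) (d i) x,
      Δ.dom i (⟨newNum (d i) x.1.val⟩, p.2) ∧
        Δ.size i (⟨newNum (d i) x.1.val⟩, p.2) ≤ Γ.size i x)
    (hexp : ∀ i x, Γ.dom i x → 2 ^ (PinCSP.rawSteps (S i) (d i) x).length ≤ Γ.size i x) :
    PolyTime Γ fun i x => rawOut (S i) (d i) k (O i) x := by
  have hpin (s : ℕ) {l : ι → RawInst → List Un} :
      PolyTime (Γ.elem l) fun _ (y : RawInst × Un) => PinCSP.rawPin s y.1 y.2 :=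
    rawPin s (id _).fst (id _).snd
  have hrange : PolyTime Γ fun _ (x : RawInst) => (List.range x.1.val).map Un.mk :=
    un_range (id _).fst
  have hconf : PolyTime Γ fun _ x => rawConflict x :=
    any (f := fun _ (y : RawInst × Un) => PinCSP.rawPin 0 y.1 y.2 && PinCSP.rawPin 1 y.1 y.2)
      hrange ((hpin 0).and (hpin 1))
  have hpinned : PolyTime Γ fun _ x => rawPinned x :=
    filter (f := fun _ (y : RawInst × Un) => PinCSP.rawPin 0 y.1 y.2 || PinCSP.rawPin 1 y.1 y.2)
      hrange ((hpin 0).or (hpin 1))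
  have hterms : PolyTime Γ fun i x => rawTerms (S i) (d i) x :=
    expand (of_triv (rawSteps S d hd)) (of_triv (rawBase d hd)) ((PolyBdd.size Γ).mono hexp)
  have hnum : PolyTime Γ fun i (x : RawInst) => Un.mk (newNum (d i) x.1.val) :=
    un_add (id _).fst (un_add (un_div (id _).fst d hd).un_succ
      (un_div (id _).fst d hd).un_succ).un_succ
  refine ite hconf (const _ fun _ => (1, 0)) (halveAll (hpinned.append (const _ fun _ => _))
    (sumAll (map (f := fun i (y : RawInst × (List (Mat r) × List Raw)) =>
      PinCSP.applyAll (y.2.1, O i (⟨newNum (d i) y.1.1.val⟩, y.2.2))) hterms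
      (applyAll ((id _).snd.fst.pair ?_)))))
  -- The oracle call. By `hdom` the terms are legal queries, and their cost is within the outer
  -- resources.
  refine comp_ctx (f := fun i (y : RawInst × (List (Mat r) × List Raw)) =>
    ((Un.mk (newNum (d i) y.1.1.val), y.2.2) : RawInst)) hO ?_
    (fun i y hy => (hdom i y.1 hy.1 y.2 hy.2).1)
    ((PolyBdd.size _).mono fun i y hy => (hdom i y.1 hy.1 y.2 hy.2).2)
  refine pair ?_ (id _).snd.snd
  exact un_add (id _).fst.fst (un_add (un_div (id _).fst.fst d hd).un_succ
      (un_div (id _).fst.fst d hd).un_succ).un_succ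

end PolyTime

/-! ### Values of coordinate vectors -/

/-- The complex number with the given coordinates. -/
noncomputable def Vec.val {r : ℕ} (ω : Fin r → ℂ) (v : Vec r) : ℂ :=
  (∑ i, (v.2 i : ℂ) * ω i) / (v.1 : ℂ)

/-- The matrix `M` describes the multiplication by `α`. -/
def Mat.IsMul {r : ℕ} (ω : Fin r → ℂ) (M : Mat r) (α : ℂ) : Prop :=
  0 < M.1 ∧ ∀ v : Vec r, (M.app v).val ω = α * v.val ω

section Values

variable {r : ℕ} {ω : Fin r → ℂ}

theorem Vec.val_add {v w : Vec r} (hv : 0 < v.1) (hw : 0 < w.1) :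
    (v.add w).val ω = v.val ω + w.val ω := by
  have hv' : (v.1 : ℂ) ≠ 0 := by exact_mod_cast hv.ne'
  have hw' : (w.1 : ℂ) ≠ 0 := by exact_mod_cast hw.ne'
  simp only [Vec.val, Vec.add]
  push_cast
  rw [div_add_div _ _ hv' hw']
  congr 1
  rw [Finset.sum_mul, Finset.mul_sum, ← Finset.sum_add_distrib]
  exact Finset.sum_congr rfl fun i _ => by ring

theorem sumAll_val (l : List (Vec r)) (h : ∀ v ∈ l, 0 < v.1) :
    0 < (sumAll l).1 ∧ (sumAll l).val ω = (l.map (Vec.val ω)).sum := by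
  have key : ∀ (l : List (Vec r)) (s : Vec r), 0 < s.1 → (∀ v ∈ l, 0 < v.1) →
      0 < (l.foldl Vec.add s).1 ∧
        (l.foldl Vec.add s).val ω = s.val ω + (l.map (Vec.val ω)).sum := by
    intro l
    induction l with
    | nil => intro s hs _; simpa using hs
    | cons v l ih =>
      intro s hs h
      have hv := h v (by simp)
      have := ih (s.add v) (Nat.mul_pos hs hv) fun w hw => h w (by simp [hw])
      refine ⟨this.1, ?_⟩
      rw [List.foldl_cons, this.2, Vec.val_add hs hv, List.map_cons, List.sum_cons, add_assoc]
  have := key l (1, 0) one_pos h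
  refine ⟨this.1, this.2.trans ?_⟩
  simp [Vec.val]

theorem applyAll_val {mat : ℂ → Mat r} (l : List ℂ) (h : ∀ a ∈ l, (mat a).IsMul ω a)
    (v : Vec r) (hv : 0 < v.1) :
    0 < (applyAll (l.map mat, v)).1 ∧ (applyAll (l.map mat, v)).val ω = l.prod * v.val ω := by
  induction l generalizing v with
  | nil => simpa [applyAll] using hv
  | cons a l ih =>
    obtain ⟨h0, h1⟩ := h a (by simp)
    have := ih (fun b hb => h b (by simp [hb])) ((mat a).app v) (Nat.mul_pos h0 hv)
    refine ⟨this.1, this.2.trans ?_⟩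
    rw [h1, List.prod_cons]
    ring

theorem halveAll_val {δ : Type} (l : List δ) (v : Vec r) (hv : 0 < v.1) :
    0 < (halveAll l v).1 ∧ (halveAll l v).val ω = v.val ω / 2 ^ l.length := by
  induction l generalizing v with
  | nil => simpa [halveAll] using hv
  | cons a l ih =>
    have := ih v.half (by simp [Vec.half, Nat.bit_val]; omega)
    refine ⟨this.1, this.2.trans ?_⟩
    rw [List.length_cons, pow_succ]
    simp only [Vec.val, Vec.half, Nat.bit_val]
    push_cast
    simp only [Bool.toNat_false, Nat.cast_zero, add_zero]
    rw [div_div, div_div]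
    congr 1
    ring

/-- The span of `ω` is a field containing `α`, so each `α * ω j` expands in `ω`. The product of all
denominators serves as the common one. -/
theorem exists_isMul {F : Set BoolFn} (hω : IsValueBasis F ω) {α : ℂ} (hα : α ∈ valueField F) :
    ∃ M : Mat r, M.IsMul ω α := by
  have hmem : ∀ j, α * ω j ∈ Submodule.span ℚ (Set.range ω) := fun j =>
    (hω.2 _).2 (mul_mem hα ((hω.2 _).1 (Submodule.subset_span ⟨j, rfl⟩)))
  have hc : ∀ j, ∃ c : Fin r → ℚ, ∑ i, c i • ω i = α * ω j := fun j =>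
    (Submodule.mem_span_range_iff_exists_fun ℚ).1 (hmem j)
  choose c hc using hc
  set q : ℕ := ∏ i, ∏ j, (c j i).den with hq
  have hq0 : 0 < q := Finset.prod_pos fun i _ => Finset.prod_pos fun j _ => (c j i).den_pos
  have hint : ∀ i j, ∃ z : ℤ, (z : ℚ) = c j i * q := by
    intro i j
    have hdvd : (c j i).den ∣ q :=
      (Finset.dvd_prod_of_mem (fun j => (c j i).den) (Finset.mem_univ j)).trans
        (Finset.dvd_prod_of_mem (fun i => ∏ j, (c j i).den) (Finset.mem_univ i))
    obtain ⟨t, ht⟩ := hdvd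
    refine ⟨(c j i).num * t, ?_⟩
    rw [ht]
    push_cast
    rw [← mul_assoc, Rat.mul_den_eq_num]
  choose z hz using hint
  refine ⟨(q, z), hq0, fun v => ?_⟩
  have hq' : (q : ℂ) ≠ 0 := by exact_mod_cast hq0.ne'
  have hz' : ∀ i j, (z i j : ℂ) = c j i * q := fun i j => by
    have := congrArg (fun t : ℚ => (t : ℂ)) (hz i j)
    push_cast at this
    exact this
  simp only [Vec.val, Mat.app]
  push_cast
  have key : ∑ i, (∑ j, (z i j : ℂ) * v.2 j) * ω i = q * (α * ∑ j, (v.2 j : ℂ) * ω j) := by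
    calc ∑ i, (∑ j, (z i j : ℂ) * v.2 j) * ω i
        = ∑ j, ∑ i, (z i j : ℂ) * v.2 j * ω i := by
          rw [Finset.sum_comm]
          exact Finset.sum_congr rfl fun i _ => Finset.sum_mul _ _ _
      _ = ∑ j, q * v.2 j * (α * ω j) := by
          refine Finset.sum_congr rfl fun j _ => ?_
          rw [← hc j, Finset.mul_sum]
          refine Finset.sum_congr rfl fun i _ => ?_
          rw [hz', Rat.smul_def]
          ring
      _ = _ := by
          rw [Finset.mul_sum, Finset.mul_sum]
          exact Finset.sum_congr rfl fun j _ => by ring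
  rw [key, mul_div_mul_left _ _ hq', mul_div_assoc]

theorem represents_iff {v : Vec r} {w : ℂ} (hv : 0 < v.1) (h : v.val ω = w) :
    Represents ω (Enc.enc v) w :=
  ⟨v.1, v.2, hv, rfl, h.symm⟩

end Values

/-! ### Values of expansions -/

section ExpandValue

variable {μ μ' γ γ' : Type}

/-- The sum of the values of the terms of an expansion. -/
noncomputable def termSum (w : γ → ℂ) (L : List (List ℂ × List γ)) : ℂ :=
  (L.map fun p => p.1.prod * (p.2.map w).prod).sum

theorem termSum_expandStep (w : γ → ℂ) (L : List (List ℂ × List γ)) (s : (ℂ × ℂ) × List γ) :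
    termSum w (expandStep L s) = (s.1.1 * (s.2.map w).prod + s.1.2) * termSum w L := by
  simp only [termSum, expandStep, List.map_append, List.sum_append, List.map_map, add_mul]
  rw [← List.sum_map_mul_left, ← List.sum_map_mul_left]
  congr 2
  · refine List.map_congr_left fun p _ => ?_
    simp only [Function.comp_apply, List.prod_cons, List.map_append, List.prod_append]
    ring
  · refine List.map_congr_left fun p _ => ?_
    simp only [Function.comp_apply, List.prod_cons]
    ring

/-- The distributive law, one binomial at a time. -/
theorem termSum_expand (w : γ → ℂ) (steps : List ((ℂ × ℂ) × List γ)) (base : List γ) :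
    termSum w (expand steps base) =
      (steps.map fun s => s.1.1 * (s.2.map w).prod + s.1.2).prod * (base.map w).prod := by
  have key : ∀ (steps : List ((ℂ × ℂ) × List γ)) (L : List (List ℂ × List γ)),
      termSum w (steps.foldl expandStep L) =
        (steps.map fun s => s.1.1 * (s.2.map w).prod + s.1.2).prod * termSum w L := by
    intro steps
    induction steps with
    | nil => simp
    | cons s steps ih =>
      intro L
      rw [List.foldl_cons, ih, termSum_expandStep, List.map_cons, List.prod_cons]
      ring
  rw [expand, key]
  simp [termSum]

/-- Expansion never inspects coefficients or constraints. This identifies the expansion on encoded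
data with the one on actual constraints. -/
theorem expand_map (f : μ → μ') (g : γ → γ') (steps : List ((μ × μ) × List γ)) (base : List γ) :
    expand (steps.map fun s => ((f s.1.1, f s.1.2), s.2.map g)) (base.map g) =
      (expand steps base).map fun p => (p.1.map f, p.2.map g) := by
  have key : ∀ (steps : List ((μ × μ) × List γ)) (L : List (List μ × List γ)),
      (steps.map fun s => ((f s.1.1, f s.1.2), s.2.map g)).foldl expandStep
          (L.map fun p => (p.1.map f, p.2.map g)) =
        (steps.foldl expandStep L).map fun p => (p.1.map f, p.2.map g) := by
    intro steps
    induction steps with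
    | nil => simp
    | cons s steps ih =>
      intro L
      rw [List.map_cons, List.foldl_cons, List.foldl_cons, ← ih]
      simp [expandStep, Function.comp_def]
  exact key steps [([], base)]

/-- A term takes the constraints of each binomial at most once, so its degrees are bounded by those
of everything together, however many terms there are. -/
theorem expand_mem (q : γ → Bool) (P : μ → Prop) (steps : List ((μ × μ) × List γ))
    (base : List γ) (hP : ∀ s ∈ steps, P s.1.1 ∧ P s.1.2) :
    ∀ p ∈ expand steps base, (∀ a ∈ p.1, P a) ∧
      p.2.countP q ≤ (steps.map fun s => s.2.countP q).sum + base.countP q := by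
  have key : ∀ (steps : List ((μ × μ) × List γ)) (L : List (List μ × List γ)) (B : ℕ),
      (∀ s ∈ steps, P s.1.1 ∧ P s.1.2) → (∀ p ∈ L, (∀ a ∈ p.1, P a) ∧ p.2.countP q ≤ B) →
      ∀ p ∈ steps.foldl expandStep L, (∀ a ∈ p.1, P a) ∧
        p.2.countP q ≤ (steps.map fun s => s.2.countP q).sum + B := by
    intro steps
    induction steps with
    | nil => simp
    | cons s steps ih =>
      intro L B hs hL p hp
      have hs' := hs s (by simp)
      have := ih (expandStep L s) (s.2.countP q + B) (fun t ht => hs t (by simp [ht])) ?_ p hp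
      · refine ⟨this.1, this.2.trans ?_⟩
        rw [List.map_cons, List.sum_cons]
        omega
      · intro p hp
        rcases List.mem_append.1 hp with hp | hp
        · obtain ⟨p', hp', rfl⟩ := List.mem_map.1 hp
          obtain ⟨h1, h2⟩ := hL p' hp'
          refine ⟨fun a ha => ?_, ?_⟩
          · rcases List.mem_cons.1 ha with rfl | ha
            exacts [hs'.1, h1 a ha]
          · rw [List.countP_append]
            omega
        · obtain ⟨p', hp', rfl⟩ := List.mem_map.1 hp
          obtain ⟨h1, h2⟩ := hL p' hp'
          refine ⟨fun a ha => ?_, ?_⟩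
          · rcases List.mem_cons.1 ha with rfl | ha
            exacts [hs'.2, h1 a ha]
          · dsimp only
            omega
  exact key steps [([], base)] _ hP (by simp)

end ExpandValue

/-! ### Forcing an alternating assignment of a path -/

/-- The edges of the path on `0, …, 2 m`, oriented from the even to the odd positions. -/
def pathEdges (m : ℕ) : List (Fin (m + m + 1) × Fin (m + m + 1)) :=
  ((List.finRange m).map fun b => (⟨b + b, by omega⟩, ⟨b + b + 1, by omega⟩)) ++
    (List.finRange m).map fun b => (⟨b + b + 1 + 1, by omega⟩, ⟨b + b + 1, by omega⟩)

/-- The product over all edges of the path. -/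
noncomputable def pathVal (R : Bool → Bool → ℂ) {m : ℕ} (a : Fin (m + m + 1) → Bool) : ℂ :=
  ((pathEdges m).map fun e => R (a e.1) (a e.2)).prod

/-- The alternating assignment. -/
def alt (m : ℕ) (k : Fin (m + m + 1)) : Bool := decide (k.val % 2 = 1)

theorem mem_pathEdges {m : ℕ} (e : Fin (m + m + 1) × Fin (m + m + 1)) :
    e ∈ pathEdges m ↔ ∃ b < m, (e.1.val = b + b ∨ e.1.val = b + b + 2) ∧ e.2.val = b + b + 1 := by
  obtain ⟨x, y⟩ := e
  simp only [pathEdges, List.mem_append, List.mem_map, List.mem_finRange, true_and, Prod.mk.injEq,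
    Fin.ext_iff]
  constructor
  · rintro (⟨b, h1, h2⟩ | ⟨b, h1, h2⟩)
    · exact ⟨b, b.2, Or.inl h1.symm, h2.symm⟩
    · exact ⟨b, b.2, Or.inr h1.symm, h2.symm⟩
  · rintro ⟨b, hb, h1 | h1, h2⟩
    · exact Or.inl ⟨⟨b, hb⟩, h1.symm, h2.symm⟩
    · exact Or.inr ⟨⟨b, hb⟩, h1.symm, h2.symm⟩

theorem alt_edge {m : ℕ} {e : Fin (m + m + 1) × Fin (m + m + 1)} (he : e ∈ pathEdges m) :
    alt m e.1 = false ∧ alt m e.2 = true := by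
  obtain ⟨b, _, h1, h2⟩ := (mem_pathEdges e).1 he
  simp only [alt, decide_eq_false_iff_not, decide_eq_true_eq]
  omega

theorem pathVal_eq_one {R : Bool → Bool → ℂ} {m : ℕ} {a : Fin (m + m + 1) → Bool}
    (h : ∀ e ∈ pathEdges m, R (a e.1) (a e.2) = 1) : pathVal R a = 1 :=
  List.prod_eq_one fun x hx => by
    obtain ⟨e, he, rfl⟩ := List.mem_map.1 hx
    exact h e he

theorem pathVal_alt {R : Bool → Bool → ℂ} (h : R false true = 1) (m : ℕ) :
    pathVal R (alt m) = 1 :=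
  pathVal_eq_one fun e he => by rw [(alt_edge he).1, (alt_edge he).2, h]

theorem pathVal_not_alt {R : Bool → Bool → ℂ} (h : R true false = 1) (m : ℕ) :
    pathVal R (fun k => !alt m k) = 1 :=
  pathVal_eq_one fun e he => by rw [(alt_edge he).1, (alt_edge he).2]; exact h

theorem pathVal_not_alt_eq_zero {R : Bool → Bool → ℂ} (h : R true false = 0) {m : ℕ}
    (hm : 0 < m) : pathVal R (fun k => !alt m k) = 0 := by
  refine List.prod_eq_zero (List.mem_map.2 ⟨(⟨0, by omega⟩, ⟨1, by omega⟩), ?_, ?_⟩)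
  · exact (mem_pathEdges _).2 ⟨0, hm, by simp⟩
  · simpa [alt] using h

/-- As `R` vanishes on the diagonal, neighbours must differ, and the value at vertex `0` determines
the rest. -/
theorem eq_alt_of_pathVal_ne_zero {R : Bool → Bool → ℂ} (h0 : R false false = 0)
    (h1 : R true true = 0) {m : ℕ} {a : Fin (m + m + 1) → Bool} (ha : pathVal R a ≠ 0) :
    a = alt m ∨ a = fun k => !alt m k := by
  have hne : ∀ e ∈ pathEdges m, a e.1 ≠ a e.2 := by
    intro e he heq
    refine ha (List.prod_eq_zero (List.mem_map.2 ⟨e, he, ?_⟩))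
    rw [heq]
    cases a e.2 <;> assumption
  have hstep : ∀ k (hk : k + 1 < m + m + 1), a ⟨k + 1, hk⟩ = !a ⟨k, by omega⟩ := by
    intro k hk
    rcases Nat.even_or_odd' k with ⟨b, rfl | rfl⟩
    · have := hne (⟨2 * b, by omega⟩, ⟨2 * b + 1, hk⟩)
        ((mem_pathEdges _).2 ⟨b, by omega, Or.inl (two_mul b), by simp [two_mul]⟩)
      exact Bool.eq_not.2 this.symm
    · have := hne (⟨2 * b + 1 + 1, hk⟩, ⟨2 * b + 1, by omega⟩)
        ((mem_pathEdges _).2 ⟨b, by omega, Or.inr (by simp [two_mul]), by simp [two_mul]⟩)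
      exact Bool.eq_not.2 this
  have hall : ∀ k (hk : k < m + m + 1), a ⟨k, hk⟩ = Bool.xor (a ⟨0, by omega⟩) (alt m ⟨k, hk⟩) := by
    intro k
    induction k with
    | zero => intro hk; simp [alt]
    | succ k ih =>
      intro hk
      rw [hstep k hk, ih (by omega)]
      have : alt m ⟨k + 1, hk⟩ = !alt m ⟨k, by omega⟩ := by
        rw [Bool.eq_not]
        simp only [alt, ne_eq, decide_eq_decide]
        omega
      rw [this, Bool.xor_not]
  cases h : a ⟨0, by omega⟩
  · left
    funext k
    rw [hall k k.2, h, Bool.false_xor]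
  · right
    funext k
    rw [hall k k.2, h, Bool.true_xor]

theorem sum_pathVal {R : Bool → Bool → ℂ} (h0 : R false false = 0) (h1 : R true true = 0) (m : ℕ) :
    ∑ a : Fin (m + m + 1) → Bool, pathVal R a =
      pathVal R (alt m) + pathVal R (fun k => !alt m k) := by
  have hne : alt m ≠ fun k => !alt m k := fun h => by
    have := congrFun h ⟨0, by omega⟩
    simp at this
  rw [← Finset.sum_pair hne]
  refine (Finset.sum_subset (Finset.subset_univ _) fun a _ ha => ?_).symm
  by_contra hc
  rcases eq_alt_of_pathVal_ne_zero h0 h1 hc with h | h <;> simp [h] at ha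

/-! ### Binomials from constraint functions -/

/-- A binary function obtained from a function in `F` by identifying variables. -/
structure Gadget (F : Set BoolFn) where
  fn : BoolFn
  mem : fn ∈ F
  pat : Fin fn.arity → Bool

/-- The value of a gadget. -/
def Gadget.val {F : Set BoolFn} (g : Gadget F) (x y : Bool) : ℂ :=
  g.fn.toFun fun j => if g.pat j then y else x

/-- A binomial: two coefficients, and a product of gadgets for the first one. -/
abbrev Factor (F : Set BoolFn) := (ℂ × ℂ) × List (Gadget F)

/-- The product of the values of the binomials in a list. -/
noncomputable def edgeVal {F : Set BoolFn} (S : List (Factor F)) (x y : Bool) : ℂ :=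
  (S.map fun s => s.1.1 * (s.2.map fun g => g.val x y).prod + s.1.2).prod

/-- The product of the values of all constraints in a list. -/
noncomputable def evalAll {F : Set BoolFn} {n : ℕ} (l : List (Cstr F n)) (τ : Fin n → Bool) : ℂ :=
  (l.map fun c => c.fn.toFun fun j => τ (c.vars j)).prod

/-- The binomials in `S` may be used to pin: on a path, they force an assignment which is
equivalent to the alternating one. -/
structure IsPinning (F : Set BoolFn) (S : List (Factor F)) (k : ℕ) : Prop where
  coeff : ∀ s ∈ S, s.1.1 ∈ valueField F ∧ s.1.2 ∈ valueField F
  -- A power of two independent of `m`, to be removed by `k` halvings.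
  sum_eq : ∀ m, 0 < m → ∑ a : Fin (m + m + 1) → Bool, pathVal (edgeVal S) a = 2 ^ k
  -- Only the sums over `τ` are compared: complementing the path changes single summands but, in the
  -- invariant case, only permutes them.
  equiv : ∀ m, 0 < m → ∀ a : Fin (m + m + 1) → Bool, pathVal (edgeVal S) a ≠ 0 →
    ∀ (n : ℕ) (l : List (Cstr F n)) (g : Fin n → Fin (n + (m + m + 1))),
      ∑ τ : Fin n → Bool, evalAll l (fun v => Fin.append τ a (g v)) =
        ∑ τ : Fin n → Bool, evalAll l (fun v => Fin.append τ (alt m) (g v))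

/-! ### Construction of the pinning binomials. -/

section Pinning

variable {F : Set BoolFn}

theorem toFun_mem_valueField {f : BoolFn} (hf : f ∈ F) (x : Fin f.arity → Bool) :
    f.toFun x ∈ valueField F :=
  IntermediateField.subset_adjoin ℚ _ ⟨f, hf, x, rfl⟩

/-- The binomial which is `1` at `(0, 1)` and `0` at `(x, y)`, if the gadget separates these. -/
noncomputable def Gadget.sep (g : Gadget F) (x y : Bool) : Factor F :=
  (((g.val false true - g.val x y)⁻¹, -g.val x y * (g.val false true - g.val x y)⁻¹), [g])

theorem Gadget.sep_mem (g : Gadget F) (x y : Bool) :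
    (g.sep x y).1.1 ∈ valueField F ∧ (g.sep x y).1.2 ∈ valueField F := by
  have h1 : g.val false true ∈ valueField F := toFun_mem_valueField g.mem _
  have h2 : g.val x y ∈ valueField F := toFun_mem_valueField g.mem _
  exact ⟨inv_mem (sub_mem h1 h2), mul_mem (neg_mem h2) (inv_mem (sub_mem h1 h2))⟩

theorem edgeVal_cons (s : Factor F) (S : List (Factor F)) (x y : Bool) :
    edgeVal (s :: S) x y =
      (s.1.1 * (s.2.map fun g => g.val x y).prod + s.1.2) * edgeVal S x y := by
  simp [edgeVal]

theorem Gadget.sep_val (g : Gadget F) (x y u v : Bool) :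
    (g.sep x y).1.1 * ((g.sep x y).2.map fun g => g.val u v).prod + (g.sep x y).1.2 =
      (g.val u v - g.val x y) * (g.val false true - g.val x y)⁻¹ := by
  simp [Gadget.sep]
  ring

/-- The values on the path do not matter here. The weight `1 / 2` on each of the `2m` edges reduces
the count `2 ^ (2m + 1)` of assignments to `2`. -/
theorem isPinning_of_const (h : ∀ f ∈ F, ∀ x y, f.toFun x = f.toFun y) :
    IsPinning F [((1 / 2, 0), [])] 1 where
  coeff := by
    intro s hs
    rw [List.mem_singleton] at hs
    subst hs
    exact ⟨div_mem (one_mem _) (ofNat_mem _ 2), zero_mem _⟩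
  sum_eq := by
    intro m _
    have hR : ∀ x y, edgeVal ([((1 / 2, 0), [])] : List (Factor F)) x y = 1 / 2 := by
      intro x y
      simp [edgeVal]
    have : ∀ a : Fin (m + m + 1) → Bool,
        pathVal (edgeVal ([((1 / 2, 0), [])] : List (Factor F))) a = (1 / 2) ^ (m + m) := by
      intro a
      unfold pathVal
      simp only [hR, List.map_const', List.prod_replicate]
      simp [pathEdges]
    simp only [this, Finset.sum_const, Finset.card_univ, Fintype.card_fun, Fintype.card_bool,
      Fintype.card_fin, nsmul_eq_mul]
    push_cast
    rw [pow_succ, mul_right_comm, ← mul_pow]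
    norm_num
  equiv := by
    intro m _ a _ n l g
    refine Finset.sum_congr rfl fun τ _ => ?_
    unfold evalAll
    congr 1
    exact List.map_congr_left fun c _ => h c.fn c.mem _ _

theorem sum_not {n : ℕ} (G : (Fin n → Bool) → ℂ) : ∑ τ : Fin n → Bool, G (fun v => !τ v) = ∑ τ, G τ :=
  Fintype.sum_equiv (Equiv.arrowCongr (Equiv.refl _) Equiv.boolNot) _ _ fun _ => rfl

/-- Three cases: all functions constant; some function not constant but all invariant under
complementation, where both alternating assignments survive and `k = 1`; some function not
invariant, where one survives and `k = 0`. -/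
theorem exists_isPinning (F : Set BoolFn) : ∃ S k, IsPinning F S k := by
  by_cases hconst : ∀ f ∈ F, ∀ x y, f.toFun x = f.toFun y
  · exact ⟨_, _, isPinning_of_const hconst⟩
  push Not at hconst
  obtain ⟨f, hf, x, y, hxy⟩ := hconst
  have hex : ∀ c : ℂ, ∃ z, f.toFun z ≠ c := by
    intro c
    by_contra hc
    push Not at hc
    exact hxy ((hc x).trans (hc y).symm)
  obtain ⟨z₀, hz₀⟩ := hex (f.toFun fun _ => false)
  obtain ⟨z₁, hz₁⟩ := hex (f.toFun fun _ => true)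
  -- With `z` as the pattern, `(0, 1)` evaluates `f` at `z`, while `(0, 0)` and `(1, 1)` evaluate it
  -- at the constant inputs.
  let g₀ : Gadget F := ⟨f, hf, z₀⟩
  let g₁ : Gadget F := ⟨f, hf, z₁⟩
  have h01 (h : BoolFn) (hh : h ∈ F) (z) : (⟨h, hh, z⟩ : Gadget F).val false true = h.toFun z := by
    simp [Gadget.val]
  have h10 (h : BoolFn) (hh : h ∈ F) (z) :
      (⟨h, hh, z⟩ : Gadget F).val true false = h.toFun fun j => !z j := by
    simp only [Gadget.val]
    congr 1
    funext j
    change (if z j = true then false else true) = _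
    rcases z j <;> simp
  have hg₀ : g₀.val false true - g₀.val false false ≠ 0 := by
    rw [sub_ne_zero, h01]
    simpa [Gadget.val, g₀] using hz₀
  have hg₁ : g₁.val false true - g₁.val true true ≠ 0 := by
    rw [sub_ne_zero, h01]
    simpa [Gadget.val, g₁] using hz₁
  by_cases hsymm : ∀ f ∈ F, ∀ x, f.toFun (fun j => !x j) = f.toFun x
  · let S : List (Factor F) := [g₀.sep false false, g₁.sep true true]
    have hS : ∀ x y, edgeVal S x y = (g₀.val x y - g₀.val false false) *
        (g₀.val false true - g₀.val false false)⁻¹ * ((g₁.val x y - g₁.val true true) *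
          (g₁.val false true - g₁.val true true)⁻¹) := by
      intro x y
      simp only [S, edgeVal_cons, Gadget.sep_val]
      simp [edgeVal]
    have e00 : edgeVal S false false = 0 := by simp [hS]
    have e11 : edgeVal S true true = 0 := by simp [hS]
    have e01 : edgeVal S false true = 1 := by
      rw [hS, mul_inv_cancel₀ hg₀, mul_inv_cancel₀ hg₁, one_mul]
    have e10 : edgeVal S true false = 1 := by
      rw [← e01, hS, hS, h10, h10, h01, h01, hsymm f hf, hsymm f hf]
    refine ⟨S, 1, ?_, fun m hm => ?_, fun m hm a ha n l g => ?_⟩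
    · intro s hs
      simp only [S, List.mem_cons, List.not_mem_nil, or_false] at hs
      rcases hs with rfl | rfl <;> exact Gadget.sep_mem _ _ _
    · rw [sum_pathVal e00 e11, pathVal_alt e01, pathVal_not_alt e10]
      norm_num
    · rcases eq_alt_of_pathVal_ne_zero e00 e11 ha with rfl | rfl
      · rfl
      -- Complementing `τ` as well flips the whole assignment, which no constraint notices.
      · rw [← sum_not]
        refine Finset.sum_congr rfl fun τ _ => ?_
        have happ : ∀ v, Fin.append (fun v => !τ v) (fun k => !alt m k) v =
            !Fin.append τ (alt m) v := by
          intro v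
          refine Fin.addCases (fun v => ?_) (fun v => ?_) v <;> simp
        unfold evalAll
        congr 1
        refine List.map_congr_left fun c _ => ?_
        simp only [happ]
        exact hsymm c.fn c.mem _
  · push Not at hsymm
    obtain ⟨h, hh, z, hz⟩ := hsymm
    let g₂ : Gadget F := ⟨h, hh, z⟩
    have hg₂ : g₂.val false true - g₂.val true false ≠ 0 := by
      rw [sub_ne_zero, h01, h10]
      exact hz.symm
    -- The third factor vanishes at `(1, 0)`, hence the complement of the alternating assignment has
    -- weight zero.
    let S : List (Factor F) := [g₀.sep false false, g₁.sep true true, g₂.sep true false]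
    have hS : ∀ x y, edgeVal S x y = (g₀.val x y - g₀.val false false) *
        (g₀.val false true - g₀.val false false)⁻¹ * ((g₁.val x y - g₁.val true true) *
          (g₁.val false true - g₁.val true true)⁻¹ * ((g₂.val x y - g₂.val true false) *
          (g₂.val false true - g₂.val true false)⁻¹)) := by
      intro x y
      simp only [S, edgeVal_cons, Gadget.sep_val]
      simp [edgeVal]
    have e00 : edgeVal S false false = 0 := by simp [hS]
    have e11 : edgeVal S true true = 0 := by simp [hS]
    have e10 : edgeVal S true false = 0 := by simp [hS]
    have e01 : edgeVal S false true = 1 := by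
      rw [hS, mul_inv_cancel₀ hg₀, mul_inv_cancel₀ hg₁, mul_inv_cancel₀ hg₂, one_mul, one_mul]
    refine ⟨S, 0, ?_, fun m hm => ?_, fun m hm a ha n l g => ?_⟩
    · intro s hs
      simp only [S, List.mem_cons, List.not_mem_nil, or_false] at hs
      rcases hs with rfl | rfl | rfl <;> exact Gadget.sep_mem _ _ _
    · rw [sum_pathVal e00 e11, pathVal_alt e01, pathVal_not_alt_eq_zero e10 hm]
      norm_num
    · rcases eq_alt_of_pathVal_ne_zero e00 e11 ha with rfl | rfl
      · rfl
      · exact absurd (pathVal_not_alt_eq_zero e10 hm) ha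

end Pinning

/-! ### Instances and their encodings -/

/-- The encoded constraint, as a typed object. -/
def rawC {F : Set BoolFn} {n : ℕ} (name : BoolFn → ℕ) (c : Cstr F n) : Raw :=
  (⟨name c.fn⟩, List.ofFn fun j => ⟨(c.vars j).val⟩)

/-- The encoded instance, as a typed object. -/
def rawI {F : Set BoolFn} (name : BoolFn → ℕ) (I : Inst F) : RawInst :=
  (⟨I.numVars⟩, I.cstrs.map (rawC name))

theorem enc_rawC {F : Set BoolFn} {n : ℕ} (name : BoolFn → ℕ) (c : Cstr F n) :
    enc (rawC name c) = c.enc name := by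
  change Data.node _ (encList _) = Data.node _ (encList _)
  rw [rawC, List.map_ofFn]
  rfl

theorem enc_rawI {F : Set BoolFn} (name : BoolFn → ℕ) (I : Inst F) :
    enc (rawI name I) = I.enc name := by
  change Data.node _ (encList _) = Data.node _ (encList _)
  rw [rawI, List.map_map]
  congr 3
  funext c
  exact enc_rawC name c

theorem rawC_injective {F : Set BoolFn} {n : ℕ} {name : BoolFn → ℕ} (h : Set.InjOn name F) :
    Function.Injective (rawC name : Cstr F n → Raw) := by
  intro c c' hc
  obtain ⟨f, hf, v⟩ := c
  obtain ⟨f', hf', v'⟩ := c'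
  simp only [rawC, Prod.mk.injEq, Un.mk.injEq] at hc
  obtain rfl := h hf hf' hc.1
  have := List.ofFn_injective hc.2
  congr
  funext j
  exact Fin.ext (Un.mk.inj (congrFun this j))

theorem rawI_injective {F : Set BoolFn} {name : BoolFn → ℕ} (h : Set.InjOn name F) :
    Function.Injective (rawI name : Inst F → RawInst) := by
  intro I I' hI
  obtain ⟨n, l⟩ := I
  obtain ⟨n', l'⟩ := I'
  simp only [rawI, Prod.mk.injEq, Un.mk.injEq] at hI
  obtain ⟨rfl, hl⟩ := hI
  rw [List.map_injective_iff.2 (rawC_injective h) hl]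

/-- The naming of the functions in `F ∪ {δ₀, δ₁}`. -/
noncomputable def extName (name : BoolFn → ℕ) (f : BoolFn) : ℕ :=
  -- A pin that already belongs to `F` is treated as a pin too.
  open Classical in if f = delta0 then 0 else if f = delta1 then 1 else name f + 2

theorem delta0_ne_delta1 : delta0 ≠ delta1 := by
  intro h
  have h1 : ∀ f : BoolFn, f = delta0 → f.toFun (fun _ => false) = 1 := by
    rintro f rfl
    simp [delta0]
  have h2 := h1 delta1 h.symm
  simp [delta1] at h2

theorem extName_eq_zero {name : BoolFn → ℕ} {f : BoolFn} : extName name f = 0 ↔ f = delta0 := by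
  unfold extName
  split_ifs <;> simp [*, delta0_ne_delta1.symm]

theorem extName_eq_one {name : BoolFn → ℕ} {f : BoolFn} : extName name f = 1 ↔ f = delta1 := by
  unfold extName
  split_ifs with h1 h2
  · subst h1
    simp [delta0_ne_delta1]
  · simpa using h2
  · simpa using h2

theorem extName_of_ne {name : BoolFn → ℕ} {f : BoolFn} (h0 : f ≠ delta0) (h1 : f ≠ delta1) :
    extName name f = name f + 2 := by
  simp [extName, h0, h1]

theorem extName_injOn {F : Set BoolFn} {name : BoolFn → ℕ} (h : Set.InjOn name F) :
    Set.InjOn (extName name) (F ∪ {delta0, delta1}) := by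
  intro f hf g hg hfg
  by_cases f0 : f = delta0
  · rw [extName_eq_zero.2 f0] at hfg
    rw [f0, extName_eq_zero.1 hfg.symm]
  by_cases f1 : f = delta1
  · rw [extName_eq_one.2 f1] at hfg
    rw [f1, extName_eq_one.1 hfg.symm]
  have g0 : g ≠ delta0 := fun g0 => f0 (extName_eq_zero.1 (hfg.trans (extName_eq_zero.2 g0)))
  have g1 : g ≠ delta1 := fun g1 => f1 (extName_eq_one.1 (hfg.trans (extName_eq_one.2 g1)))
  rw [extName_of_ne f0 f1, extName_of_ne g0 g1] at hfg
  have hf' : f ∈ F := by simpa [f0, f1] using hf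
  have hg' : g ∈ F := by simpa [g0, g1] using hg
  exact h hf' hg' (by omega)

/-! ### The reduction, on instances -/

section Reduction

variable {F : Set BoolFn} {n : ℕ}

/-- A constraint of an instance with pins, unless it is a pin. -/
noncomputable def Cstr.unpin (c : Cstr (F ∪ {delta0, delta1}) n) : Option (Cstr F n) :=
  open Classical in
  if h : c.fn = delta0 ∨ c.fn = delta1 then none else
    some ⟨c.fn, c.mem.resolve_right (by simpa using h), c.vars⟩

/-- The variables of a constraint are replaced. -/
def Cstr.mapVars {m : ℕ} (g : Fin n → Fin m) (c : Cstr F n) : Cstr F m :=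
  ⟨c.fn, c.mem, fun j => g (c.vars j)⟩

theorem evalAll_mapVars {m : ℕ} (g : Fin n → Fin m) (l : List (Cstr F n)) (σ : Fin m → Bool) :
    evalAll (l.map (Cstr.mapVars g)) σ = evalAll l fun v => σ (g v) := by
  simp [evalAll, Cstr.mapVars, Function.comp_def]

open Classical in
theorem Cstr.eval_of_delta (c : Cstr (F ∪ {delta0, delta1}) n)
    (hc : c.fn = delta0 ∨ c.fn = delta1) (τ : Fin n → Bool) :
    (c.fn.toFun fun j => τ (c.vars j)) =
      if ∀ j, (τ (c.vars j) = true ↔ c.fn = delta1) then 1 else 0 := by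
  obtain ⟨f, hf, vars⟩ := c
  dsimp only at hc
  rcases hc with rfl | rfl
  · have : ∀ x : Fin delta0.arity → Bool, delta0.toFun x = if x (0 : Fin 1) = false then 1 else 0 :=
      fun x => by simp [delta0]
    rw [this]
    simp only [delta0_ne_delta1, iff_false, Bool.not_eq_true]
    refine if_congr ⟨fun h j => ?_, fun h => h (0 : Fin 1)⟩ rfl rfl
    rwa [Subsingleton.elim (α := Fin 1) j 0]
  · have : ∀ x : Fin delta1.arity → Bool, delta1.toFun x = if x (0 : Fin 1) = true then 1 else 0 :=
      fun x => by simp [delta1]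
    rw [this]
    simp only [iff_true]
    refine if_congr ⟨fun h j => ?_, fun h => h (0 : Fin 1)⟩ rfl rfl
    rwa [Subsingleton.elim (α := Fin 1) j 0]

/-- The assignment `τ` satisfies all pins in the list. -/
def PinsOK (l : List (Cstr (F ∪ {delta0, delta1}) n)) (τ : Fin n → Bool) : Prop :=
  ∀ c ∈ l, c.fn = delta0 ∨ c.fn = delta1 → ∀ j, (τ (c.vars j) = true ↔ c.fn = delta1)

open Classical in
theorem evalAll_eq_unpin (l : List (Cstr (F ∪ {delta0, delta1}) n)) (τ : Fin n → Bool) :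
    evalAll l τ = (if PinsOK l τ then 1 else 0) * evalAll (l.filterMap Cstr.unpin) τ := by
  induction l with
  | nil => simp [evalAll, PinsOK]
  | cons c l ih =>
    have hev : evalAll (c :: l) τ = (c.fn.toFun fun j => τ (c.vars j)) * evalAll l τ := rfl
    rw [hev, ih]
    by_cases h : c.fn = delta0 ∨ c.fn = delta1
    · rw [List.filterMap_cons_none (by simp [Cstr.unpin, h]), ← mul_assoc,
        c.eval_of_delta h]
      congr 1
      have hcons : PinsOK (c :: l) τ ↔
          (∀ j, (τ (c.vars j) = true ↔ c.fn = delta1)) ∧ PinsOK l τ := by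
        simp only [PinsOK, List.forall_mem_cons, h, true_imp_iff]
      by_cases h1 : ∀ j, (τ (c.vars j) = true ↔ c.fn = delta1) <;> by_cases h2 : PinsOK l τ <;>
        simp only [hcons, h1, h2, if_true, if_false, and_self, and_true, and_false, mul_one,
          mul_zero]
    · have hc : c.unpin = some ⟨c.fn, c.mem.resolve_right (by simpa using h), c.vars⟩ := by
        simp [Cstr.unpin, h]
      rw [List.filterMap_cons_some hc]
      have hev' : ∀ l' : List (Cstr F n),
          evalAll (⟨c.fn, c.mem.resolve_right (by simpa using h), c.vars⟩ :: l') τ =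
            (c.fn.toFun fun j => τ (c.vars j)) * evalAll l' τ := fun _ => rfl
      rw [hev']
      have hcons : PinsOK (c :: l) τ ↔ PinsOK l τ := by
        simp only [PinsOK, List.forall_mem_cons, h, false_imp_iff, true_and]
      simp only [hcons]
      ring

/-- The sum over the assignments of the free variables. -/
theorem sum_override (p : Fin n → Prop) [DecidablePred p] (c : Fin n → Bool)
    (G : (Fin n → Bool) → ℂ) :
    ∑ τ : Fin n → Bool, G (fun v => if p v then c v else τ v) =
      2 ^ Fintype.card {v // p v} *
        ∑ τ : Fin n → Bool, if ∀ v, p v → τ v = c v then G τ else 0 := by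
  classical
  -- Split off the coordinates in `p`: the left summand does not depend on them, and on the right
  -- only one choice of them survives.
  let e := Equiv.piEquivPiSubtypeProd p fun _ => Bool
  rw [← e.symm.sum_comp, ← e.symm.sum_comp, Fintype.sum_prod_type, Fintype.sum_prod_type]
  have h1 : ∀ u w, (fun v => if p v then c v else e.symm (u, w) v) =
      e.symm (fun v => c v, w) := by
    intro u w
    funext v
    by_cases hv : p v <;> simp [e, Equiv.piEquivPiSubtypeProd, hv]
  have h2 : ∀ u w, (∀ v, p v → e.symm (u, w) v = c v) ↔ u = fun v : {v // p v} => c v := by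
    intro u w
    constructor
    · intro h
      funext v
      have := h v v.2
      simpa [e, Equiv.piEquivPiSubtypeProd, v.2] using this
    · rintro rfl v hv
      simp [e, Equiv.piEquivPiSubtypeProd, hv]
  simp only [h1, h2]
  rw [Finset.sum_const, Finset.card_univ, Fintype.card_fun, Fintype.card_bool, nsmul_eq_mul]
  congr 1
  · push_cast
    rfl
  · rw [Finset.sum_eq_single (fun v : {v // p v} => c v)]
    · simp
    · intro u _ hu
      simp [hu]
    · simp

/-- The variable that replaces `v` in the reduction. -/
def subst (d : ℕ) (x : RawInst) (v : Fin n) : Fin (n + ((n / d + 1) + (n / d + 1) + 1)) :=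
  -- As `v / d ≤ n / d`, both vertices of the block lie on the path with `m = n / d + 1`.
  if rawPin 0 x ⟨v⟩ then Fin.natAdd n ⟨v / d + v / d, by
    have := Nat.div_le_div_right (c := d) v.2.le; omega⟩
  else if rawPin 1 x ⟨v⟩ then Fin.natAdd n ⟨v / d + v / d + 1, by
    have := Nat.div_le_div_right (c := d) v.2.le; omega⟩
  else Fin.castAdd _ v

theorem rawSub_eq (d : ℕ) (x : RawInst) (hx : x.1.val = n) (v : Fin n) :
    rawSub d x ⟨v⟩ = ⟨(subst d x v).val⟩ := by
  unfold rawSub subst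
  split_ifs <;> simp [hx, add_assoc]

/-- The purpose of the alternation: a pinned variable finds its value at the vertex that replaces
it. A pin to `0` takes precedence, which matters only for contradictory pins. -/
theorem append_subst (d : ℕ) (x : RawInst) (τ : Fin n → Bool) (v : Fin n) :
    Fin.append τ (alt (n / d + 1)) (subst d x v) =
      if rawPin 0 x ⟨v⟩ || rawPin 1 x ⟨v⟩ then !rawPin 0 x ⟨v⟩ else τ v := by
  unfold subst
  cases h0 : rawPin 0 x ⟨v⟩
  · cases h1 : rawPin 1 x ⟨v⟩
    · simp
    · simp only [Bool.false_eq_true, if_false, if_true, Fin.append_right, alt]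
      simp
      omega
  · simp only [if_true, Fin.append_right, alt]
    simp
    omega

/-- The binomials on an edge. -/
def edgeSteps {N : ℕ} (S : List (Factor F)) (x y : Fin N) : List ((ℂ × ℂ) × List (Cstr F N)) :=
  S.map fun s => (s.1, s.2.map fun g => ⟨g.fn, g.mem, fun j => if g.pat j then y else x⟩)

/-- All binomials of the reduction. -/
def pathSteps (S : List (Factor F)) (n m : ℕ) :
    List ((ℂ × ℂ) × List (Cstr F (n + (m + m + 1)))) :=
  ((pathEdges m).map fun e => edgeSteps S (Fin.natAdd n e.1) (Fin.natAdd n e.2)).flatten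

theorem pathSteps_val (S : List (Factor F)) (n m : ℕ) (τ : Fin n → Bool)
    (a : Fin (m + m + 1) → Bool) :
    ((pathSteps S n m).map fun s => s.1.1 *
      (s.2.map fun c => c.fn.toFun fun j => Fin.append τ a (c.vars j)).prod + s.1.2).prod =
      pathVal (edgeVal S) a := by
  have hedge : ∀ e : Fin (m + m + 1) × Fin (m + m + 1),
      ((edgeSteps S (Fin.natAdd n e.1) (Fin.natAdd n e.2)).map fun s => s.1.1 *
        (s.2.map fun c => c.fn.toFun fun j => Fin.append τ a (c.vars j)).prod + s.1.2).prod =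
        edgeVal S (a e.1) (a e.2) := by
    intro e
    unfold edgeSteps edgeVal
    rw [List.map_map]
    congr 1
    refine List.map_congr_left fun s _ => ?_
    simp only [Function.comp_apply, List.map_map]
    congr 3
    refine List.map_congr_left fun g _ => ?_
    simp only [Function.comp_apply, Gadget.val]
    congr 1
    funext j
    split_ifs <;> simp
  unfold pathSteps pathVal
  rw [List.map_flatten, List.prod_flatten, List.map_map, List.map_map]
  congr 1
  exact List.map_congr_left fun e _ => hedge e

/-- The encoded binomials. -/
def rawFactors {r : ℕ} (mat : ℂ → Mat r) (name : BoolFn → ℕ) (S : List (Factor F)) :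
    List (RawFactor r) :=
  S.map fun s => ((mat s.1.1, mat s.1.2), s.2.map fun g => (⟨name g.fn⟩, List.ofFn g.pat))

theorem rawSteps_eq {r : ℕ} (mat : ℂ → Mat r) (name : BoolFn → ℕ) (S : List (Factor F)) (d : ℕ)
    (x : RawInst) (hx : x.1.val = n) :
    rawSteps (rawFactors mat name S) d x = (pathSteps S n (n / d + 1)).map
      fun s => ((mat s.1.1, mat s.1.2), s.2.map (rawC name)) := by
  have hedges : ∀ m, rawEdges n m = (pathEdges m).map fun e =>
      (⟨(Fin.natAdd n e.1).val⟩, ⟨(Fin.natAdd n e.2).val⟩) := by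
    intro m
    unfold rawEdges pathEdges
    rw [← List.map_coe_finRange_eq_range, List.map_map, List.map_map, List.map_append,
      List.map_map, List.map_map]
    rfl
  unfold rawSteps pathSteps
  rw [hx, hedges, List.map_flatten, List.map_map, List.map_map]
  congr 1
  refine List.map_congr_left fun e _ => ?_
  simp only [Function.comp_apply, rawEdgeSteps, edgeSteps, rawFactors, List.map_map]
  refine List.map_congr_left fun s _ => ?_
  simp only [Function.comp_apply, List.map_map]
  congr 1
  refine List.map_congr_left fun g _ => ?_
  simp only [Function.comp_apply, rawC, List.map_ofFn]
  congr 2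
  funext j
  simp only [Function.comp_apply]
  split_ifs <;> rfl

theorem rawBase_eq {name : BoolFn → ℕ} (d : ℕ) (x : RawInst) (hx : x.1.val = n)
    (l : List (Cstr (F ∪ {delta0, delta1}) n)) (hl : x.2 = l.map (rawC (extName name))) :
    rawBase d x = ((l.filterMap Cstr.unpin).map (Cstr.mapVars (subst d x))).map (rawC name) := by
  unfold rawBase
  rw [hl]
  clear hl
  induction l with
  | nil => rfl
  | cons c l ih =>
    rw [List.map_cons]
    by_cases h : c.fn = delta0 ∨ c.fn = delta1
    · rw [List.filterMap_cons_none (by simp [Cstr.unpin, h]), ← ih, List.filter_cons_of_neg]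
      rcases h with h | h
      · simp [rawC, extName_eq_zero.2 h]
      · simp [rawC, extName_eq_one.2 h]
    · have hc : c.unpin = some ⟨c.fn, c.mem.resolve_right (by simpa using h), c.vars⟩ := by
        simp [Cstr.unpin, h]
      push Not at h
      have hname := extName_of_ne (name := name) h.1 h.2
      rw [List.filterMap_cons_some hc, List.filter_cons_of_pos (by simp [rawC, hname]),
        List.map_cons, List.map_cons, List.map_cons, ← ih]
      congr 1
      simp only [rawC, hname, Cstr.mapVars, List.map_ofFn]
      congr 2
      funext j
      exact rawSub_eq d x hx _

/-- The terms of the reduction. -/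
noncomputable def terms (S : List (Factor F)) (d : ℕ) (x : RawInst)
    (l : List (Cstr (F ∪ {delta0, delta1}) n)) :
    List (List ℂ × List (Cstr F (n + ((n / d + 1) + (n / d + 1) + 1)))) :=
  expand (pathSteps S n (n / d + 1)) ((l.filterMap Cstr.unpin).map (Cstr.mapVars (subst d x)))

theorem rawTerms_eq {r : ℕ} (mat : ℂ → Mat r) (name : BoolFn → ℕ) (S : List (Factor F)) (d : ℕ)
    (x : RawInst) (hx : x.1.val = n) (l : List (Cstr (F ∪ {delta0, delta1}) n))
    (hl : x.2 = l.map (rawC (extName name))) :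
    rawTerms (rawFactors mat name S) d x =
      (terms S d x l).map fun p => (p.1.map mat, p.2.map (rawC name)) := by
  rw [rawTerms, rawSteps_eq mat name S d x hx, rawBase_eq d x hx l hl, expand_map, terms]

/-! ### Degrees -/

/-- A union bound. -/
theorem countP_exists_le {γ κ : Type} [DecidableEq κ] (A : Finset κ) (q : κ → γ → Bool)
    (q' : γ → Bool) (h : ∀ c, q' c = true → ∃ v ∈ A, q v c = true) (l : List γ) :
    l.countP q' ≤ ∑ v ∈ A, l.countP (q v) := by
  induction l with
  | nil => simp
  | cons c l ih =>
    simp only [List.countP_cons, Finset.sum_add_distrib]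
    refine add_le_add ih ?_
    split_ifs with hc
    · obtain ⟨v, hv, hq⟩ := h c hc
      calc 1 = if q v c = true then 1 else 0 := by simp [hq]
        _ ≤ _ := Finset.single_le_sum (f := fun v => if q v c = true then 1 else 0)
          (fun _ _ => Nat.zero_le _) hv
    · exact Nat.zero_le _

/-- Old variables, even path vertices and odd path vertices are disjoint, and within each kind the
image determines the block. -/
theorem subst_div {d : ℕ} {x : RawInst} {v v' : Fin n} (h : subst d x v = subst d x v') :
    v.val / d = v'.val / d := by
  have h' := congrArg Fin.val h
  unfold subst at h'
  have hv := v.2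
  have hv' := v'.2
  split_ifs at h' <;> simp at h' <;> first
    | omega
    | (exfalso; generalize v.val / d = a at h'; omega)
    | (exfalso; generalize v'.val / d = a at h'; omega)
    | rw [h']

/-- Variables merged into `w` lie in one block and are told apart by their residues modulo `d`. So
there are at most `d` of them, each in at most `D` constraints. -/
theorem countP_base_le {d : ℕ} (hd : 0 < d) {x : RawInst} {D : ℕ}
    (l : List (Cstr (F ∪ {delta0, delta1}) n))
    (hD : ∀ v, l.countP (fun c => decide (∃ j, c.vars j = v)) ≤ D) (w) :
    ((l.filterMap Cstr.unpin).map (Cstr.mapVars (subst d x))).countP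
      (fun c => decide (∃ j, c.vars j = w)) ≤ d * D := by
  let A : Finset (Fin n) := Finset.univ.filter fun v => subst d x v = w
  have hA : A.card ≤ d := by
    rw [← Finset.card_range d]
    refine Finset.card_le_card_of_injOn (fun v => v.val % d)
      (fun v _ => by simpa using Nat.mod_lt _ hd) fun v hv v' hv' he => ?_
    have h1 : subst d x v = w := by simpa [A] using hv
    have h2 : subst d x v' = w := by simpa [A] using hv'
    have h3 := subst_div (h1.trans h2.symm)
    have he' : v.val % d = v'.val % d := he
    refine Fin.ext ?_
    rw [← Nat.div_add_mod v.val d, ← Nat.div_add_mod v'.val d, h3, he']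
  have h1 : ((l.filterMap Cstr.unpin).map (Cstr.mapVars (subst d x))).countP
      (fun c => decide (∃ j, c.vars j = w)) ≤
        l.countP fun c => decide (∃ j, subst d x (c.vars j) = w) := by
    rw [List.countP_map]
    induction l with
    | nil => simp
    | cons c l ih =>
      have ih := ih fun v => le_trans (Nat.le_add_right _ _) (List.countP_cons ▸ hD v)
      rw [List.countP_cons]
      by_cases h : c.fn = delta0 ∨ c.fn = delta1
      · rw [List.filterMap_cons_none (by simp [Cstr.unpin, h])]
        omega
      · have hc : c.unpin = some ⟨c.fn, c.mem.resolve_right (by simpa using h), c.vars⟩ := by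
          simp [Cstr.unpin, h]
        rw [List.filterMap_cons_some hc, List.countP_cons]
        exact add_le_add ih le_rfl
  have h2 := countP_exists_le A (fun v (c : Cstr (F ∪ {delta0, delta1}) n) =>
    decide (∃ j, c.vars j = v)) (fun c => decide (∃ j, subst d x (c.vars j) = w))
    (fun c hc => by
      obtain ⟨j, hj⟩ := of_decide_eq_true hc
      exact ⟨c.vars j, by simp [A, hj], by simp⟩) l
  calc _ ≤ _ := h1
    _ ≤ _ := h2
    _ ≤ ∑ _v ∈ A, D := Finset.sum_le_sum fun v _ => hD v
    _ = A.card * D := by simp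
    _ ≤ d * D := Nat.mul_le_mul_right _ hA

theorem countP_finRange_le_one {m : ℕ} (q : Fin m → Bool)
    (h : ∀ b b', q b = true → q b' = true → b = b') : (List.finRange m).countP q ≤ 1 := by
  rw [List.countP_eq_length_filter,
    ← List.toFinset_card_of_nodup ((List.nodup_finRange m).filter _)]
  refine Finset.card_le_one.2 fun b hb b' hb' => h b b' ?_ ?_
  · simpa using hb
  · simpa using hb'

/-- Each of the two families of edges in `pathEdges` is a matching. -/
theorem countP_pathEdges_le (n m : ℕ) (w : Fin (n + (m + m + 1))) :
    (pathEdges m).countP (fun e => decide (Fin.natAdd n e.1 = w ∨ Fin.natAdd n e.2 = w)) ≤ 2 := by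
  rw [pathEdges, List.countP_append, List.countP_map, List.countP_map]
  refine (add_le_add (countP_finRange_le_one _ ?_) (countP_finRange_le_one _ ?_)).trans le_rfl
  · intro b b' hb hb'
    simp [Fin.ext_iff] at hb hb'
    refine Fin.ext ?_
    omega
  · intro b b' hb hb'
    simp [Fin.ext_iff] at hb hb'
    refine Fin.ext ?_
    omega

theorem countP_pathSteps_le (S : List (Factor F)) (n m : ℕ) (w : Fin (n + (m + m + 1))) :
    ((pathSteps S n m).map fun s => s.2.countP fun c => decide (∃ j, c.vars j = w)).sum ≤
      2 * (S.map fun s => s.2.length).sum := by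
  have hedge : ∀ e : Fin (m + m + 1) × Fin (m + m + 1),
      ((edgeSteps S (Fin.natAdd n e.1) (Fin.natAdd n e.2)).map fun s =>
        s.2.countP fun c => decide (∃ j, c.vars j = w)).sum ≤
      if decide (Fin.natAdd n e.1 = w ∨ Fin.natAdd n e.2 = w) = true then
        (S.map fun s => s.2.length).sum else 0 := by
    intro e
    split_ifs with h
    · unfold edgeSteps
      rw [List.map_map]
      refine List.sum_le_sum fun s _ => ?_
      exact List.countP_le_length.trans (by simp)
    · unfold edgeSteps
      rw [List.map_map, Nat.le_zero]
      refine List.sum_eq_zero fun z hz => ?_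
      obtain ⟨s, _, rfl⟩ := List.mem_map.1 hz
      simp only [Function.comp_apply, List.countP_eq_zero]
      intro c hc
      obtain ⟨g, _, rfl⟩ := List.mem_map.1 hc
      simp only [decide_eq_true_eq, not_exists, not_or] at h ⊢
      intro j
      split_ifs
      exacts [h.2, h.1]
  have h2 := countP_pathEdges_le n m w
  unfold pathSteps
  rw [List.map_flatten, List.sum_flatten, List.map_map, List.map_map]
  refine (List.sum_le_sum fun e _ => hedge e).trans ?_
  refine le_trans (le_of_eq ?_) (Nat.mul_le_mul_right (S.map fun s => s.2.length).sum h2)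
  generalize pathEdges m = E
  generalize (S.map fun s => s.2.length).sum = t
  clear h2 hedge
  induction E with
  | nil => simp
  | cons e E ih =>
    rw [List.map_cons, List.sum_cons, ih, List.countP_cons]
    split_ifs <;> ring

/-- The bound for the degree of the new instances. -/
def degBound (S : List (Factor F)) (d D : ℕ) : ℕ :=
  -- Two path edges with all their gadgets, and `d` merged variables; the `1` makes the bound
  -- positive.
  2 * (S.map fun s => s.2.length).sum + d * D + 1

theorem terms_spec {S : List (Factor F)} {k : ℕ} (hS : IsPinning F S k) {d : ℕ} (hd : 0 < d)
    {x : RawInst} {D : ℕ} (l : List (Cstr (F ∪ {delta0, delta1}) n))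
    (hD : ∀ v, l.countP (fun c => decide (∃ j, c.vars j = v)) ≤ D) :
    ∀ p ∈ terms S d x l, (∀ a ∈ p.1, a ∈ valueField F) ∧
      (⟨_, p.2⟩ : Inst F).DegreeLE (degBound S d D) := by
  have hmem : ∀ s ∈ pathSteps S n (n / d + 1), s.1.1 ∈ valueField F ∧ s.1.2 ∈ valueField F := by
    intro s hs
    obtain ⟨L, hL, hs⟩ := List.mem_flatten.1 hs
    obtain ⟨e, _, rfl⟩ := List.mem_map.1 hL
    obtain ⟨t, ht, rfl⟩ := List.mem_map.1 hs
    exact hS.coeff t ht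
  intro p hp
  refine ⟨(expand_mem (fun _ => true) (· ∈ valueField F) _ _ hmem p hp).1, fun w => ?_⟩
  have h1 := (expand_mem (fun c => decide (∃ j, c.vars j = w)) (· ∈ valueField F) _ _ hmem p hp).2
  have h2 := countP_pathSteps_le S n (n / d + 1) w
  have h3 := countP_base_le (x := x) hd l hD w
  exact h1.trans (by unfold degBound; omega)

end Reduction

/-! ### Correctness of the reduction -/

section Correctness

variable {F : Set BoolFn}

theorem rawPin_iff {name : BoolFn → ℕ} (I : Inst F) (s : ℕ) (v : Fin I.numVars) :
    rawPin s (rawI name I) ⟨v⟩ = true ↔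
      ∃ c ∈ I.cstrs, name c.fn = s ∧ ∃ j, c.vars j = v := by
  simp only [rawPin, rawI, List.any_map, List.any_eq_true, Function.comp_apply, rawC,
    Bool.and_eq_true, decide_eq_true_eq, List.mem_ofFn', Set.mem_range]
  refine exists_congr fun c => and_congr Iff.rfl (and_congr decide_eq_true_iff ?_)
  constructor
  · rintro ⟨_, ⟨j, rfl⟩, h⟩
    exact ⟨j, Fin.ext h⟩
  · rintro ⟨j, rfl⟩
    exact ⟨_, ⟨j, rfl⟩, rfl⟩

theorem value_eq_sum_evalAll (I : Inst F) : I.value = ∑ σ, evalAll I.cstrs σ := rfl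

theorem value_eq_zero_of_conflict {name : BoolFn → ℕ} (I : Inst (F ∪ {delta0, delta1}))
    (h : rawConflict (rawI (extName name) I) = true) : I.value = 0 := by
  simp only [rawConflict, List.any_map, List.any_eq_true, List.mem_range, Function.comp_apply,
    Bool.and_eq_true] at h
  obtain ⟨v, hv, h0, h1⟩ := h
  obtain ⟨c, hc, hc0, j, hj⟩ := (rawPin_iff I 0 ⟨v, hv⟩).1 h0
  obtain ⟨c', hc', hc1, j', hj'⟩ := (rawPin_iff I 1 ⟨v, hv⟩).1 h1
  rw [extName_eq_zero] at hc0
  rw [extName_eq_one] at hc1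
  rw [value_eq_sum_evalAll]
  refine Finset.sum_eq_zero fun τ _ => ?_
  rw [evalAll_eq_unpin, if_neg, zero_mul]
  intro hok
  have e0 := hok c hc (Or.inl hc0) j
  have e1 := hok c' hc' (Or.inr hc1) j'
  rw [hj] at e0
  rw [hj'] at e1
  have := e0.1 (e1.2 hc1)
  exact delta0_ne_delta1 (hc0.symm.trans this)

theorem pinsOK_iff {name : BoolFn → ℕ} (I : Inst (F ∪ {delta0, delta1}))
    (h : rawConflict (rawI (extName name) I) = false) (τ : Fin I.numVars → Bool) :
    PinsOK I.cstrs τ ↔ ∀ v : Fin I.numVars,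
      (rawPin 0 (rawI (extName name) I) ⟨v⟩ || rawPin 1 (rawI (extName name) I) ⟨v⟩) = true →
        τ v = !rawPin 0 (rawI (extName name) I) ⟨v⟩ := by
  constructor
  · intro hok v hv
    cases h0 : rawPin 0 (rawI (extName name) I) ⟨v⟩
    · rw [h0, Bool.false_or, rawPin_iff] at hv
      obtain ⟨c, hc, hc1, j, rfl⟩ := hv
      rw [extName_eq_one] at hc1
      exact (hok c hc (Or.inr hc1) j).2 hc1
    · rw [rawPin_iff] at h0
      obtain ⟨c, hc, hc0, j, rfl⟩ := h0
      rw [extName_eq_zero] at hc0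
      have := hok c hc (Or.inl hc0) j
      rw [hc0] at this
      simpa [delta0_ne_delta1] using this
  · intro hall c hc hδ j
    rcases hδ with hδ | hδ
    · have h0 := (rawPin_iff (name := extName name) I 0 (c.vars j)).2
        ⟨c, hc, extName_eq_zero.2 hδ, j, rfl⟩
      have := hall (c.vars j) (by rw [h0]; rfl)
      rw [this, h0, hδ]
      simp [delta0_ne_delta1]
    · have h1 := (rawPin_iff (name := extName name) I 1 (c.vars j)).2
        ⟨c, hc, extName_eq_one.2 hδ, j, rfl⟩
      have := hall (c.vars j) (by rw [h1, Bool.or_true])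
      have h0 : rawPin 0 (rawI (extName name) I) ⟨c.vars j⟩ = false := by
        by_contra hne
        rw [Bool.not_eq_false] at hne
        have : rawConflict (rawI (extName name) I) = true := by
          simp only [rawConflict, List.any_map, List.any_eq_true, List.mem_range,
            Function.comp_apply, Bool.and_eq_true]
          exact ⟨c.vars j, (c.vars j).2, hne, h1⟩
        rw [this] at h
        exact Bool.noConfusion h
      rw [this, h0, hδ]
      simp

theorem length_rawPinned (x : RawInst) :
    (rawPinned x).length =
      Fintype.card {v : Fin x.1.val // (rawPin 0 x ⟨v⟩ || rawPin 1 x ⟨v⟩) = true} := by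
  rw [rawPinned, ← List.map_coe_finRange_eq_range, List.map_map, List.filter_map, List.length_map,
    Fintype.card_subtype, ← List.toFinset_card_of_nodup ((List.nodup_finRange _).filter _)]
  congr 1
  ext v
  simp

theorem sum_map_sum {κ δ : Type} [Fintype κ] (T : List δ) (f : δ → κ → ℂ) :
    (T.map fun p => ∑ σ, f p σ).sum = ∑ σ, (T.map fun p => f p σ).sum := by
  induction T with
  | nil => simp
  | cons p T ih => simp [ih, Finset.sum_add_distrib]

/-- The output of the reduction is correct. -/
theorem rawOut_spec {S : List (Factor F)} {k : ℕ} (hS : IsPinning F S k) {d D : ℕ} (hd : 0 < d)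
    {name : BoolFn → ℕ} {r : ℕ} {ω : Fin r → ℂ} {mat : ℂ → Mat r}
    (hmat : ∀ α ∈ valueField F, (mat α).IsMul ω α) {O : RawInst → Vec r}
    (hO : ∀ J : Inst F, J.DegreeLE (degBound S d D) →
      0 < (O (rawI name J)).1 ∧ (O (rawI name J)).val ω = J.value)
    (I : Inst (F ∪ {delta0, delta1})) (hI : I.DegreeLE D) :
    0 < (rawOut (rawFactors mat name S) d k O (rawI (extName name) I)).1 ∧
      (rawOut (rawFactors mat name S) d k O (rawI (extName name) I)).val ω = I.value := by
  set x := rawI (extName name) I with hx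
  unfold rawOut
  cases hconf : rawConflict x
  swap
  · simp only [if_true, value_eq_zero_of_conflict I hconf]
    simp [Vec.val]
  simp only [Bool.false_eq_true, if_false]
  have hterms := terms_spec hS hd (x := x) I.cstrs hI
  set T := terms S d x I.cstrs with hT
  rw [rawTerms_eq (n := I.numVars) mat name S d x rfl I.cstrs rfl, ← hT, List.map_map]
  have hterm : ∀ p ∈ T,
      0 < (applyAll (p.1.map mat, O (⟨newNum d x.1.val⟩, p.2.map (rawC name)))).1 ∧
      (applyAll (p.1.map mat, O (⟨newNum d x.1.val⟩, p.2.map (rawC name)))).val ω =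
        p.1.prod * ∑ σ, evalAll p.2 σ := by
    intro p hp
    obtain ⟨h1, h2⟩ := hO ⟨_, p.2⟩ (hterms p hp).2
    obtain ⟨h3, h4⟩ := applyAll_val (mat := mat) p.1
      (fun a ha => hmat a ((hterms p hp).1 a ha)) _ h1
    exact ⟨h3, h4.trans (by rw [h2]; rfl)⟩
  obtain ⟨h1, h2⟩ := sumAll_val (ω := ω) (T.map
    ((fun p => applyAll (p.1, O (⟨newNum d x.1.val⟩, p.2))) ∘
      fun p => (p.1.map mat, p.2.map (rawC name)))) (by
    intro v hv
    obtain ⟨p, hp, rfl⟩ := List.mem_map.1 hv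
    exact (hterm p hp).1)
  obtain ⟨h3, h4⟩ := halveAll_val (ω := ω) (rawPinned x ++ List.replicate k ⟨0⟩) _ h1
  refine ⟨h3, h4.trans ?_⟩
  rw [h2, List.map_map, List.length_append, List.length_replicate, length_rawPinned]
  have hsum : (T.map (Vec.val ω ∘ ((fun p => applyAll (p.1, O (⟨newNum d x.1.val⟩, p.2))) ∘
      fun p => (p.1.map mat, p.2.map (rawC name))))).sum =
      ∑ σ : Fin (I.numVars + ((I.numVars / d + 1) + (I.numVars / d + 1) + 1)) → Bool,
        termSum (fun c => c.fn.toFun fun j => σ (c.vars j)) T := by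
    have : T.map (Vec.val ω ∘ ((fun p => applyAll (p.1, O (⟨newNum d x.1.val⟩, p.2))) ∘
      fun p => (p.1.map mat, p.2.map (rawC name)))) =
      T.map fun p => ∑ σ, p.1.prod * evalAll p.2 σ :=
      List.map_congr_left fun p hp => (hterm p hp).2.trans (Finset.mul_sum _ _ _)
    rw [this, sum_map_sum]
    rfl
  rw [hsum]
  have hm : 0 < I.numVars / d + 1 := Nat.succ_pos _
  -- Sum over the path assignments `a` outermost: those of nonzero weight all give the inner sum of
  -- the alternating one, and the weights add up to `2 ^ k`.
  have hsplit : ∑ σ : Fin (I.numVars + ((I.numVars / d + 1) + (I.numVars / d + 1) + 1)) → Bool,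
      termSum (fun c => c.fn.toFun fun j => σ (c.vars j)) T =
      2 ^ k * ∑ τ : Fin I.numVars → Bool, evalAll (I.cstrs.filterMap Cstr.unpin) fun v =>
        Fin.append τ (alt (I.numVars / d + 1)) (subst d x v) := by
    rw [← (Fin.appendEquiv I.numVars ((I.numVars / d + 1) + (I.numVars / d + 1) + 1)).sum_comp, Fintype.sum_prod_type_right]
    have hval : ∀ (τ : Fin I.numVars → Bool) (a : Fin ((I.numVars / d + 1) + (I.numVars / d + 1) + 1) → Bool),
        termSum (fun c => c.fn.toFun fun j => (Fin.appendEquiv I.numVars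
          ((I.numVars / d + 1) + (I.numVars / d + 1) + 1)) (τ, a) (c.vars j)) T =
        pathVal (edgeVal S) a * evalAll (I.cstrs.filterMap Cstr.unpin) fun v =>
          Fin.append τ a (subst d x v) := by
      intro τ a
      rw [hT, terms, termSum_expand]
      exact congrArg₂ _ (pathSteps_val S I.numVars (I.numVars / d + 1) τ a) (evalAll_mapVars _ _ _)
    rw [← hS.sum_eq _ hm, Finset.sum_mul]
    refine Finset.sum_congr rfl fun a _ => ?_
    simp only [hval]
    rw [← Finset.mul_sum]
    by_cases ha : pathVal (edgeVal S) a = 0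
    · rw [ha, zero_mul, zero_mul]
    · rw [hS.equiv _ hm a ha]
  have hvalue : I.value = ∑ τ : Fin I.numVars → Bool,
      if ∀ v : Fin I.numVars, (rawPin 0 x ⟨v⟩ || rawPin 1 x ⟨v⟩) = true → τ v = !rawPin 0 x ⟨v⟩ then
        evalAll (I.cstrs.filterMap Cstr.unpin) τ else 0 := by
    rw [value_eq_sum_evalAll]
    refine Finset.sum_congr rfl fun τ _ => ?_
    rw [evalAll_eq_unpin]
    have := pinsOK_iff I hconf τ
    by_cases hp : PinsOK I.cstrs τ
    · rw [if_pos hp, if_pos (this.1 hp), one_mul]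
    · rw [if_neg hp, if_neg fun h => hp (this.2 h), zero_mul]
  rw [hsplit]
  simp only [append_subst]
  -- The free pinned variables produce the power of two that the halvings cancel.
  rw [sum_override (fun v : Fin I.numVars => (rawPin 0 x ⟨v⟩ || rawPin 1 x ⟨v⟩) = true), ← hvalue,
    pow_add, ← mul_assoc, mul_comm (2 ^ k : ℂ)]
  exact mul_div_cancel_left₀ _ (mul_ne_zero (pow_ne_zero _ two_ne_zero) (pow_ne_zero _ two_ne_zero))

end Correctness

/-! ### Sizes of instances -/

section Sizes

variable {F : Set BoolFn}

theorem valueField_union_delta (F : Set BoolFn) :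
    valueField (F ∪ {delta0, delta1}) = valueField F := by
  unfold valueField
  refine le_antisymm (IntermediateField.adjoin_le_iff.2 ?_) (IntermediateField.adjoin.mono _ _ _ ?_)
  · rintro z ⟨f, hf | rfl | rfl, x, rfl⟩
    · exact IntermediateField.subset_adjoin ℚ _ ⟨f, hf, x, rfl⟩
    · simp only [delta0]
      split_ifs
      exacts [one_mem _, zero_mem _]
    · simp only [delta1]
      split_ifs
      exacts [one_mem _, zero_mem _]
  · rintro z ⟨f, hf, x, rfl⟩
    exact ⟨f, Or.inl hf, x, rfl⟩

/-- This allows the rank `r` to be fixed before the algorithm, and its basis, are chosen. -/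
theorem IsValueBasis.card_eq {r r' : ℕ} {ω : Fin r → ℂ} {ω' : Fin r' → ℂ}
    (h : IsValueBasis F ω) (h' : IsValueBasis F ω') : r = r' := by
  have hspan : Submodule.span ℚ (Set.range ω) = Submodule.span ℚ (Set.range ω') :=
    Submodule.ext fun z => (h.2 z).trans (h'.2 z).symm
  have h1 := finrank_span_eq_card h.1
  have h2 := finrank_span_eq_card h'.1
  rw [hspan, h2] at h1
  simpa using h1.symm

/-- Positive arity is essential: a degree bound does not see constraints without variables. -/
theorem length_cstrs_le (har : ∀ f ∈ F, 0 < f.arity) {D : ℕ} {I : Inst F} (hI : I.DegreeLE D) :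
    I.cstrs.length ≤ I.numVars * D := by
  have h := countP_exists_le Finset.univ (fun v (c : Cstr F I.numVars) =>
    decide (∃ j, c.vars j = v)) (fun _ => true)
    (fun c _ => ⟨c.vars ⟨0, har _ c.mem⟩, Finset.mem_univ _, decide_eq_true ⟨_, rfl⟩⟩) I.cstrs
  rw [List.countP_true] at h
  exact h.trans ((Finset.sum_le_sum fun v _ => hI v).trans (by simp))

/-- The height of an encoded instance of bounded degree is linear in the number of variables. -/
theorem exists_ht_rawI_le (hfin : F.Finite) (har : ∀ f ∈ F, 0 < f.arity) (name : BoolFn → ℕ)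
    (D : ℕ) : ∃ K : ℕ, ∀ I : Inst F, I.DegreeLE D → (enc (rawI name I)).ht ≤ K * (I.numVars + 1) := by
  obtain ⟨A, hA⟩ := (hfin.image fun f => f.arity).bddAbove
  obtain ⟨M, hM⟩ := (hfin.image name).bddAbove
  refine ⟨D + A + M + 3, fun I hI => ?_⟩
  have hc : ∀ c ∈ I.cstrs.map (rawC name), (enc c).ht ≤ A + M + I.numVars + 1 := by
    intro c hc
    obtain ⟨c, _, rfl⟩ := List.mem_map.1 hc
    have h1 : c.fn.arity ≤ A := hA ⟨_, c.mem, rfl⟩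
    have h2 : name c.fn ≤ M := hM ⟨_, c.mem, rfl⟩
    have h3 := ht_list_le (l := List.ofFn fun j => Un.mk (c.vars j).val) (m := I.numVars)
      fun a ha => by
        obtain ⟨j, rfl⟩ := (List.mem_ofFn' _ _).1 ha
        rw [ht_un]
        exact (c.vars j).2.le
    rw [List.length_ofFn] at h3
    rw [rawC, enc_pair, Data.ht_node, ht_un]
    dsimp only
    omega
  have h1 := ht_list_le hc
  have h2 := length_cstrs_le har hI
  rw [List.length_map] at h1
  rw [rawI, enc_pair, Data.ht_node, ht_un]
  have h3 : (D + A + M + 3) * (I.numVars + 1) =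
      I.numVars * D + (A + M) * I.numVars + 3 * I.numVars + (D + A + M + 3) := by ring
  rw [h3]
  dsimp only
  have h4 : 0 ≤ (A + M) * I.numVars := Nat.zero_le _
  omega

end Sizes

/-! ### The oracle -/

/-- An algorithm for `#CSP(F)` for the instances that the reduction produces. -/
structure Oracle (F : Set BoolFn) (S : List (Factor F)) (D r : ℕ) where
  -- Everything chosen after the degree `B` is a field, hence part of the index of the family; `F`,
  -- `S`, `D` and `r` are fixed beforehand.
  d : ℕ
  d_pos : 0 < d
  name : BoolFn → ℕ
  ω : Fin r → ℂ
  prog : Prog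
  C : ℝ
  ε : ℝ
  inj : Set.InjOn name F
  basis : IsValueBasis F ω
  spec : ∀ I : Inst F, I.DegreeLE (degBound S d D) →
    ∃ (y : Data) (t : ℕ), Run prog (I.enc name) y t ∧ Represents ω y I.value ∧
      (t : ℝ) ≤ C * (2 : ℝ) ^ (ε * (I.numVars : ℝ))

namespace Oracle

variable {F : Set BoolFn} {S : List (Factor F)} {D r : ℕ} (i : Oracle F S D r)

/-- The time bound. -/
noncomputable def time (n : ℕ) : ℕ := ⌈i.C * (2 : ℝ) ^ (i.ε * (n : ℝ))⌉₊

theorem exists_output (I : Inst F) (hI : I.DegreeLE (degBound S i.d D)) :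
    ∃ v : Vec r, RunLE i.prog (enc (rawI i.name I)) (enc v) (i.time I.numVars) ∧
      0 < v.1 ∧ v.val i.ω = I.value := by
  obtain ⟨y, t, hrun, ⟨q, z, hq, rfl, hw⟩, ht⟩ := i.spec I hI
  refine ⟨(q, z), ⟨t, ?_, ?_⟩, hq, hw.symm⟩
  · exact_mod_cast ht.trans (Nat.le_ceil _)
  · rw [enc_rawI]
    exact hrun

open Classical in
/-- The function that the algorithm computes. -/
noncomputable def out (x : RawInst) : Vec r :=
  -- The encoding is injective, so the chosen instance is the intended one; the value `(1, 0)`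
  -- elsewhere is arbitrary.
  if h : ∃ I : Inst F, I.DegreeLE (degBound S i.d D) ∧ rawI i.name I = x then
    (i.exists_output h.choose h.choose_spec.1).choose else (1, 0)

theorem out_spec (I : Inst F) (hI : I.DegreeLE (degBound S i.d D)) :
    RunLE i.prog (enc (rawI i.name I)) (enc (i.out (rawI i.name I))) (i.time I.numVars) ∧
      0 < (i.out (rawI i.name I)).1 ∧ (i.out (rawI i.name I)).val i.ω = I.value := by
  have h : ∃ I' : Inst F, I'.DegreeLE (degBound S i.d D) ∧ rawI i.name I' = rawI i.name I :=
    ⟨I, hI, rfl⟩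
  have h1 : i.out (rawI i.name I) = (i.exists_output h.choose h.choose_spec.1).choose := dif_pos h
  have h2 := (i.exists_output h.choose h.choose_spec.1).choose_spec
  rw [← h1, rawI_injective i.inj h.choose_spec.2] at h2
  exact h2

open Classical in
/-- The matrices of multiplications. -/
noncomputable def mat (α : ℂ) : Mat r :=
  if h : ∃ M : Mat r, M.IsMul i.ω α then h.choose else (0, 0)

theorem mat_spec {α : ℂ} (hα : α ∈ valueField F) : (i.mat α).IsMul i.ω α := by
  have h := exists_isMul i.basis hα
  have : i.mat α = h.choose := dif_pos h
  rw [this]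
  exact h.choose_spec

/-- The resources granted to the reduction. -/
noncomputable def budget (n : ℕ) : ℕ :=
  2 ^ (2 * (n / i.d + 1) * S.length) + i.time (newNum i.d n)

/-- The reduction runs in polynomial time. -/
theorem polyTime_rawOut {k : ℕ} (hS : IsPinning F S k) :
    PolyTime (⟨fun i x => ∃ I : Inst (F ∪ {delta0, delta1}), I.DegreeLE D ∧
        rawI (extName i.name) I = x, fun i x => i.budget x.1.val⟩ : Ctx (Oracle F S D r) RawInst)
      fun i x => rawOut (rawFactors i.mat i.name S) i.d k i.out x := by
  refine PolyTime.rawOut (Δ := ⟨fun i x => ∃ J : Inst F, J.DegreeLE (degBound S i.d D) ∧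
    rawI i.name J = x, fun i x => i.time x.1.val⟩) k (fun i => i.d_pos) ?_ ?_ ?_
  -- The time of the oracle is declared to be its size, so it counts as polynomial whatever its
  -- exponent.
  · refine ⟨fun i => i.prog, fun i x => i.time x.1.val, PolyBdd.size _, ?_⟩
    rintro i _ ⟨J, hJ, rfl⟩
    exact (i.out_spec J hJ).1
  · rintro i _ ⟨I, hI, rfl⟩ p hp
    rw [rawTerms_eq (n := I.numVars) i.mat i.name S i.d _ rfl I.cstrs rfl] at hp
    obtain ⟨q, hq, rfl⟩ := List.mem_map.1 hp
    exact ⟨⟨⟨_, q.2⟩, (terms_spec hS i.d_pos I.cstrs hI q hq).2, rfl⟩, Nat.le_add_left _ _⟩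
  · rintro i _ ⟨I, hI, rfl⟩
    rw [length_rawSteps]
    simp only [rawFactors, List.length_map]
    exact Nat.le_add_right _ _

end Oracle

/-! ### The time bound -/

theorem natCast_le_const_mul_two_rpow {δ : ℝ} (hδ : 0 < δ) (n : ℕ) :
    (n : ℝ) ≤ (δ * Real.log 2)⁻¹ * (2 : ℝ) ^ (δ * (n : ℝ)) := by
  have hlog : 0 < Real.log 2 := Real.log_pos (by norm_num)
  rw [inv_mul_eq_div, le_div_iff₀ (by positivity), Real.rpow_def_of_pos (by norm_num)]
  have := Real.add_one_le_exp (Real.log 2 * (δ * n))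
  nlinarith

/-- By the choice of `d`, the number of binomials is at most `δ n + 2 |S|`. The new instances have
`N ≤ 3 n + 3` variables, so `(δ / 3) N ≤ δ n + δ`. -/
theorem Oracle.exists_budget_le {F : Set BoolFn} {S : List (Factor F)} {D r : ℕ}
    (i : Oracle F S D r) {δ : ℝ} (hδ : 0 < δ) (hd : 2 * (S.length : ℝ) ≤ δ * i.d)
    (hε : i.ε = δ / 3) : ∃ K : ℝ, 0 ≤ K ∧ ∀ n : ℕ,
      (i.budget n : ℝ) ≤ K * (2 : ℝ) ^ (δ * (n : ℝ)) := by
  have hd0 : (0 : ℝ) < i.d := by exact_mod_cast i.d_pos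
  refine ⟨2 ^ (2 * S.length) + (|i.C| * (2 : ℝ) ^ δ + 1), by positivity, fun n => ?_⟩
  have hone : (1 : ℝ) ≤ (2 : ℝ) ^ (δ * (n : ℝ)) :=
    Real.one_le_rpow (by norm_num) (by positivity)
  have h1 : ((2 ^ (2 * (n / i.d + 1) * S.length) : ℕ) : ℝ) ≤
      2 ^ (2 * S.length) * (2 : ℝ) ^ (δ * (n : ℝ)) := by
    have hdiv : ((n / i.d : ℕ) : ℝ) ≤ n / i.d := Nat.cast_div_le
    have he : 2 * (n / i.d + 1) * S.length = 2 * S.length + 2 * S.length * (n / i.d) := by ring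
    rw [he, pow_add]
    push_cast
    refine mul_le_mul_of_nonneg_left ?_ (by positivity)
    rw [← Real.rpow_natCast]
    refine Real.rpow_le_rpow_of_exponent_le (by norm_num) ?_
    push_cast
    calc 2 * (S.length : ℝ) * ((n / i.d : ℕ) : ℝ) ≤ (δ * i.d) * (n / i.d) :=
          mul_le_mul hd hdiv (by positivity) (by positivity)
      _ = δ * n := by field_simp
  have h2 : ((i.time (newNum i.d n) : ℕ) : ℝ) ≤
      (|i.C| * (2 : ℝ) ^ δ + 1) * (2 : ℝ) ^ (δ * (n : ℝ)) := by
    have hN : ((newNum i.d n : ℕ) : ℝ) ≤ 3 * n + 3 := by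
      have : newNum i.d n ≤ 3 * n + 3 := by
        have := Nat.div_le_self n i.d
        unfold newNum
        omega
      exact_mod_cast this
    have h3 : (2 : ℝ) ^ (i.ε * (newNum i.d n : ℕ)) ≤ (2 : ℝ) ^ δ * (2 : ℝ) ^ (δ * (n : ℝ)) := by
      rw [← Real.rpow_add (by norm_num)]
      refine Real.rpow_le_rpow_of_exponent_le (by norm_num) ?_
      rw [hε]
      nlinarith
    have h4 : i.C * (2 : ℝ) ^ (i.ε * (newNum i.d n : ℕ)) ≤
        |i.C| * ((2 : ℝ) ^ δ * (2 : ℝ) ^ (δ * (n : ℝ))) :=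
      mul_le_mul (le_abs_self _) h3 (by positivity) (abs_nonneg _)
    have h5 : ((i.time (newNum i.d n) : ℕ) : ℝ) ≤
        |i.C| * ((2 : ℝ) ^ δ * (2 : ℝ) ^ (δ * (n : ℝ))) + 1 := by
      unfold Oracle.time
      calc ((⌈i.C * (2 : ℝ) ^ (i.ε * (newNum i.d n : ℕ))⌉₊ : ℕ) : ℝ)
          ≤ ((⌈|i.C| * ((2 : ℝ) ^ δ * (2 : ℝ) ^ (δ * (n : ℝ)))⌉₊ : ℕ) : ℝ) := by
            exact_mod_cast Nat.ceil_le_ceil h4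
        _ ≤ _ := (Nat.ceil_lt_add_one (by positivity)).le
    refine h5.trans ?_
    rw [add_mul, one_mul, mul_assoc]
    linarith
  unfold Oracle.budget
  push_cast at h1 h2 ⊢
  rw [add_mul]
  exact add_le_add h1 h2

/-- Algorithms for `#CSP(F)` with arbitrarily small exponents and arbitrarily large degrees yield
algorithms for `#CSP(F ∪ {δ₀, δ₁})`. -/
theorem hasAlgorithm_union_delta {F : Set BoolFn} (hfin : F.Finite) (har : ∀ f ∈ F, 0 < f.arity)
    (h : ∀ ε' : ℝ, 0 < ε' → ∀ D' : ℕ, 0 < D' → HasAlgorithm F D' ε') {ε : ℝ} (hε : 0 < ε) (D : ℕ) :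
    HasAlgorithm (F ∪ {delta0, delta1}) D ε := by
  obtain ⟨S, k, hS⟩ := exists_isPinning F
  obtain ⟨_, r, ω₀, _, _, _, hω₀, _⟩ := h 1 one_pos 1 one_pos
  -- The degree `B` is obtained here, before `δ`, `d` and the algorithm, all of which depend on it.
  obtain ⟨p, m, ⟨B, hB⟩, hrun⟩ := Oracle.polyTime_rawOut (D := D) (r := r) hS
  set δ : ℝ := ε / (B + 1) with hδ
  have hδ0 : 0 < δ := by positivity
  have hδB : δ * B ≤ ε := by
    rw [hδ, div_mul_eq_mul_div, div_le_iff₀ (by positivity)]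
    nlinarith
  obtain ⟨d, hd⟩ := exists_nat_ge (2 * (S.length : ℝ) / δ)
  have hd' : 2 * (S.length : ℝ) ≤ δ * ((d + 1 : ℕ) : ℝ) := by
    rw [div_le_iff₀ hδ0] at hd
    push_cast
    nlinarith
  obtain ⟨name, r', ω, prog, C, hinj, hω, hspec⟩ :=
    h (δ / 3) (by positivity) (degBound S (d + 1) D) (Nat.succ_pos _)
  obtain rfl := hω₀.card_eq hω
  let i : Oracle F S D r := ⟨d + 1, Nat.succ_pos d, name, ω, prog, C, δ / 3, hinj, hω, hspec⟩
  obtain ⟨K₁, hK₁, hbudget⟩ := i.exists_budget_le hδ0 hd' rfl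
  have hfin' : (F ∪ {delta0, delta1}).Finite := hfin.union (by simp)
  have har' : ∀ f ∈ F ∪ {delta0, delta1}, 0 < f.arity := by
    rintro f (hf | rfl | rfl)
    exacts [har f hf, Nat.one_pos, Nat.one_pos]
  obtain ⟨K₂, hht⟩ := exists_ht_rawI_le hfin' har' (extName name) D
  obtain ⟨c, hc⟩ := hB i
  have hlog : 0 < Real.log 2 := Real.log_pos (by norm_num)
  -- The three summands absorb the budget, the height of the input, linear in `n`, and the `1` in
  -- the total size.
  set K : ℝ := K₁ + (K₂ * ((δ * Real.log 2)⁻¹ + 1) + 1) with hK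
  have hK0 : 0 ≤ K := by positivity
  refine ⟨extName name, r, ω, p i, c * K ^ B, extName_injOn hinj, ?_, fun I hI => ?_⟩
  · exact ⟨hω.1, fun z => by rw [valueField_union_delta]; exact hω.2 z⟩
  · have hdom : ∃ I' : Inst (F ∪ {delta0, delta1}), I'.DegreeLE D ∧
        rawI (extName name) I' = rawI (extName name) I := ⟨I, hI, rfl⟩
    obtain ⟨t, ht, hr⟩ := hrun i (rawI (extName name) I) hdom
    obtain ⟨h1, h2⟩ := rawOut_spec hS i.d_pos (fun α hα => i.mat_spec hα)
      (fun J hJ => (i.out_spec J hJ).2) I hI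
    refine ⟨_, t, (enc_rawI (extName name) I) ▸ hr, represents_iff h1 h2, ?_⟩
    have hone : (1 : ℝ) ≤ (2 : ℝ) ^ (δ * (I.numVars : ℝ)) :=
      Real.one_le_rpow (by norm_num) (by positivity)
    have h3 := hc (rawI (extName name) I) hdom
    have htotal : ((i.budget I.numVars + (enc (rawI (extName name) I)).ht + 1 : ℕ) : ℝ) ≤
        K * (2 : ℝ) ^ (δ * (I.numVars : ℝ)) := by
      have h4 : (((enc (rawI (extName name) I)).ht : ℕ) : ℝ) ≤ K₂ * ((I.numVars : ℝ) + 1) := by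
        exact_mod_cast hht I hI
      have h5 := natCast_le_const_mul_two_rpow hδ0 I.numVars
      have h6 : (K₂ : ℝ) * ((I.numVars : ℝ) + 1) ≤
          K₂ * (((δ * Real.log 2)⁻¹ + 1) * (2 : ℝ) ^ (δ * (I.numVars : ℝ))) := by
        refine mul_le_mul_of_nonneg_left ?_ (by positivity)
        rw [add_mul, one_mul]
        exact add_le_add h5 hone
      have h7 := hbudget I.numVars
      push_cast
      rw [hK]
      nlinarith
    calc (t : ℝ) ≤ ((c * (i.budget I.numVars + (enc (rawI (extName name) I)).ht + 1) ^ B : ℕ) : ℝ) :=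
          by exact_mod_cast ht.trans h3
      _ = c * ((i.budget I.numVars + (enc (rawI (extName name) I)).ht + 1 : ℕ) : ℝ) ^ B := by
          push_cast
          rfl
      _ ≤ c * (K * (2 : ℝ) ^ (δ * (I.numVars : ℝ))) ^ B := by gcongr
      _ = c * K ^ B * (2 : ℝ) ^ (δ * B * (I.numVars : ℝ)) := by
          rw [mul_pow, ← Real.rpow_natCast ((2 : ℝ) ^ (δ * (I.numVars : ℝ))),
            ← Real.rpow_mul (by norm_num), ← mul_assoc]
          congr 2
          ring
      _ ≤ c * K ^ B * (2 : ℝ) ^ (ε * (I.numVars : ℝ)) := by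
          refine mul_le_mul_of_nonneg_left ?_ (by positivity)
          exact Real.rpow_le_rpow_of_exponent_le (by norm_num)
            (mul_le_mul_of_nonneg_right hδB (by positivity))

end PinCSP

theorem theorem1p1 (F : Set BoolFn) (hfin : F.Finite)
    (halg : ∀ f ∈ F, ∀ x, IsAlgebraic ℚ (f.toFun x))
    (har : ∀ f ∈ F, 0 < f.arity)
    (hhard : ∃ ε : ℝ, 0 < ε ∧ ∃ D : ℕ, 0 < D ∧
      ¬ HasAlgorithm (F ∪ {delta0, delta1}) D ε) :
    ∃ ε' : ℝ, 0 < ε' ∧ ∃ D' : ℕ, 0 < D' ∧ ¬ HasAlgorithm F D' ε' := by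
  by_contra hcon
  push Not at hcon
  obtain ⟨ε, hε, D, _, hno⟩ := hhard
  exact hno (hasAlgorithm_union_delta hfin har hcon hε D)
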